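/- **Setting.** On Minkowski space with metric $\mathrm{diag}(-1,1,1,1)$ let $A_0,A_1,A_2$ be smooth covector potentials on an open set $O$, $F_i=dA_i$, $\mathcal F_0={}^*F_0$ (with $\epsilon^{0123}=-1$). With $\lambda_1=\tfrac12F_0{:}F_0$, $\lambda_2=\tfrac14\mathcal F_0{:}F_0$ (where $A{:}B=A_{\mu\nu}B^{\mu\nu}$) put $\lambda_{B}^2=\tfrac12(\sqrt{\lambda_1^2+4\lambda_2^2}+\lambda_1)$, $\lambda_E=\mathrm{sgn}(\lambda_2)\big[\tfrac12(\sqrt{\lambda_1^2+4\lambda_2^2}-\lambda_1)\big]^{1/2}$, and assume $\lambda_E=0$, $\lambda_B>0$ on $O$. Let $m,c>0$, $e\ne0$, $\epsilon\neq0$ be constants, $\Omega_B=e\lambda_B/mc$, $P_\perp=-F_0^2/\lambda_B^2$, $P_\parallel=1-P_\perp$. Let $(\hat e_0,\hat e_1,\hat e_2,\hat e_3)$ be a smooth orthonormal tetrad on $O$ with $F_0\hat e_0=F_0\hat e_1=0$, $F_0\hat e_2=-\lambda_B\hat e_3$, $F_0\hat e_3=\lambda_B\hat e_2$, $\mathcal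 F_0\hat e_0=-\lambda_B\hat e_1$, $\mathcal F_0\hat e_1=-\lambda_B\hat e_0$, $\mathcal F_0\hat e_2=\mathcal F_0\hat e_3=0$. Put $$\hat t=\hat e_0\cosh\mathcal B+\hat e_1\sinh\mathcal B,\quad \hat b=\hat e_0\sinh\mathcal B+\hat e_1\cosh\mathcal B,\quad \hat c=-\hat e_2\sin\Theta-\hat e_3\cos\Theta,\quad \hat a=\hat e_2\cos\Theta-\hat e_3\sin\Theta,$$ and $\mathcal R=(\nabla\hat e_2)\cdot\hat e_3$, $\mathcal N=d\mathcal R$. Dots contract adjacent indices with the metric, $(\nabla V)^{\mu\nu}=\partial^\mu V^\nu$, and $\nabla P\cdot v$ means $(\partial^\mu P^{\nu\tau})v_\tau$. On the phase space with coordinates $(R,K,\mathcal B,\mu,\Theta)$ let $$\Gamma=\Big[\tfrac{e}{\epsilon c}(A_0+\epsilon A_1+\epsilon^2A_2)+mK\hat t-\epsilon\mu\mathcal R\Big]\cdot dR+\epsilon\mu\,d\Theta\quad\text{(higher order)},$$ and let the classical order be the same one-form without the terms in $A_2$ and $\mathcal R$. Let $\Omega=d\Gamma$ be the guiding-center Lagrangian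 two-form, with $\Omega_{ij}=\partial_i\Gamma_j-\partial_j\Gamma_i$. Put $F'=F_1$ (classical order) or $F'=F_1+\epsilon F_2-\frac{\epsilon c}{e}\mu\mathcal N$ (higher order), and $$F''=F'+\tfrac{mcK}{e}\big(\nabla\hat t-(\nabla\hat t)^T\big),\qquad \Upsilon=1+\frac{\epsilon F_0{:}F''}{2\lambda_B^2},\qquad \Xi=1+\frac{\epsilon F''\cdot F_0}{\lambda_B^2\Upsilon}.$$ Let $D$ be the region $R\in O$, $K>0$, $\Upsilon\neq0$. **Theorem.** At each of the two orders: (1) $\Omega$ is exactly closed and is invertible on $D$. The Poisson tensor $J=\Omega^{-1}$ is given on $D$ by $$\{R,R\}=-\frac{\epsilon F_0}{m\lambda_B\Omega_B\Upsilon},\quad \{R,K\}=-\frac{\hat t}{m}\cdot\Xi,\quad \{R,\mathcal B\}=\frac{\hat b}{mK}\cdot\Xi,\quad \{K,\mathcal B\}=-\frac{e}{m^2cK}\,\hat t\cdot\Xi\cdot F''\cdot\hat b,\quad \{\Theta,\mu\}=\epsilon^{-1};$$ at classical order $\{R,\Theta\}$, $\{K,\Theta\}$, $\{\mathcal B,\Theta\}$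 vanish, and at higher order $$\{R,\Theta\}=\{R,R\}\cdot\mathcal R,\quad \{K,\Theta\}=\{K,R\}\cdot\mathcal R,\quad \{\mathcal B,\Theta\}=\{\mathcal B,R\}\cdot\mathcal R.$$ All brackets not listed (and not obtained by antisymmetry) vanish. On the open set $D$ this bracket is smooth and antisymmetric and satisfies the Jacobi identity exactly. (2) Append coordinates $C_{1a},C_{1b},C_{2a},C_{2b},C_3$ (with $C_3>0$) whose brackets with all coordinates are zero. On the open set $D\times\{C_3>0\}$ this is again a smooth Poisson structure. The map to coordinates $(R,U,\mu,\hat\alpha)\in\mathbb R^{13}$, $$U=K\hat t+\tfrac1{\sqrt{C_3}}\big(\tfrac{C_{1a}}{\lambda_B}\hat c+C_{1b}\hat a\big),\qquad \hat\alpha=\sqrt{C_3}\,\hat a+\tfrac1K\big(-C_{2a}\hat t+\tfrac{C_{2b}}{\lambda_B}\hat b\big),$$ has invertible derivative, and along it $U\cdot F_0\cdot\hat\alpha=C_{1a}$, $U\cdot P_\perp\cdot\hat\alpha=C_{1b}$, $U\cdot P_\parallel\cdot\hat\alpha=C_{2a}$, $U\cdot\mathcal F_0\cdot\hat\alpha=C_{2b}$,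 $\hat\alpha\cdot P_\perp\cdot\hat\alpha=C_3$. The bracket pushes forward to a well-defined smooth Poisson structure on the open image $D'$ of this map; it satisfies the Jacobi identity exactly, and the five functions just listed are Casimir functions of it on all of $D'$. (3) On the hypersurface $P_\perp\cdot U=0$, $P_\parallel\cdot\hat\alpha=0$ in $D'$ (which contains the physical one, where also $\hat\alpha\cdot\hat\alpha=1$) the pushed-forward bracket is given explicitly as follows. Let $$F'''=F'+\tfrac{mc}{e}\big((\nabla P_\parallel\cdot U)-(\nabla P_\parallel\cdot U)^T\big),\quad \Upsilon'=1+\frac{\epsilon F_0{:}F'''}{2\lambda_B^2},\quad \Xi'=1+\frac{\epsilon F'''\cdot F_0}{\lambda_B^2\Upsilon'},$$ $G=\nabla P_\perp\cdot\hat\alpha$ at higher order, and $G=\nabla P_\perp\cdot\hat\alpha-\lambda_B^{-1}\mathcal R\,(F_0\cdot\hat\alpha)$ at classical order. Then $$\{R,R\}=-\frac{\epsilon F_0}{m\lambda_B\Omega_B\Upsilon'},\qquad \{R,U\}=\frac1mP_\parallel+\frac{\epsilon}{m\lambda_B^2\Upsilon'}F_0\cdot\Big[F'''\cdot P_\parallel-\frac{mc}{e}(\nabla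 P_\parallel\cdot U)\Big],$$ $$\{U,U\}=-\frac{\Omega_B}{2m\lambda_B^3}\big[\mathcal F_0{:}(F'''\cdot\Xi'^T)\big]\mathcal F_0-\frac1m\Big(P_\parallel\cdot\Xi'\cdot(\nabla P_\parallel\cdot U)-(\nabla P_\parallel\cdot U)^T\cdot\Xi'^T\cdot P_\parallel\Big)-\frac{\epsilon}{m\lambda_B\Omega_B\Upsilon'}(\nabla P_\parallel\cdot U)^T\cdot F_0\cdot(\nabla P_\parallel\cdot U),$$ $$\{R,\hat\alpha\}=\{R,R\}\cdot G,\quad \{U,\hat\alpha\}=\{U,R\}\cdot G,\quad \{\hat\alpha,\mu\}=\frac{1}{\epsilon\lambda_B}F_0\cdot\hat\alpha,\quad \{\hat\alpha,\hat\alpha\}=-\frac{\epsilon}{m\lambda_B\Omega_B\Upsilon'}\,G^T\cdot F_0\cdot G,$$ and $\{R,\mu\}=\{U,\mu\}=0$. At higher order these expressions are boostgauge and gyrogauge invariant: they take the same value for every smooth tetrad $(\hat e_\alpha)$ on $O$ with the properties listed in the setting. (4) At every point of that hypersurface each component of $P_\perp\cdot U$ and of $P_\parallel\cdot\hat\alpha$,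 and $\hat\alpha\cdot\hat\alpha$, has zero bracket with every smooth function; that is, they are Casimir functions there. The bracket defined by the explicit formulas of (3) satisfies the Jacobi identity exactly at every point of the hypersurface. -/

import Mathlib

open scoped ContDiff

namespace GuidingCenter

noncomputable section

/-! ### Coordinate calculus, Poisson tensors -/

/-- Partial derivative of a scalar function in the coordinate `i`. -/
def pd {ι : Type} [Fintype ι] [DecidableEq ι] (f : (ι → ℝ) → ℝ) (i : ι) (z : ι → ℝ) : ℝ :=
  fderiv ℝ f z (Pi.single i 1)

/-- Components `∂ᵢ γⱼ - ∂ⱼ γᵢ` of the exterior derivative of a one-form with components `γ`. -/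
def extD {ι : Type} [Fintype ι] [DecidableEq ι] (γ : (ι → ℝ) → ι → ℝ) (z : ι → ℝ) :
    Matrix ι ι ℝ :=
  Matrix.of fun i j => pd (fun y => γ y j) i z - pd (fun y => γ y i) j z

/-- The bracket `{f, g} = ∂ᵢf Jⁱʲ ∂ⱼg` of a contravariant tensor field `J`. -/
def bracket {ι : Type} [Fintype ι] [DecidableEq ι] (J : (ι → ℝ) → Matrix ι ι ℝ)
    (f g : (ι → ℝ) → ℝ) (z : ι → ℝ) : ℝ :=
  ∑ i, ∑ j, pd f i z * J z i j * pd g j z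

/-- The Jacobi identity for the bracket of `J` at the point `z`, for all functions that are
smooth on `D`. -/
def JacobiAt {ι : Type} [Fintype ι] [DecidableEq ι] (J : (ι → ℝ) → Matrix ι ι ℝ)
    (D : Set (ι → ℝ)) (z : ι → ℝ) : Prop :=
  ∀ f g h : (ι → ℝ) → ℝ, ContDiffOn ℝ ∞ f D → ContDiffOn ℝ ∞ g D → ContDiffOn ℝ ∞ h D →
    bracket J f (bracket J g h) z + bracket J g (bracket J h f) z
      + bracket J h (bracket J f g) z = 0

/-- `J` is a smooth Poisson tensor on the open set `D`. -/
structure IsPoissonOn {ι : Type} [Fintype ι] [DecidableEq ι] (J : (ι → ℝ) → Matrix ι ι ℝ)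
    (D : Set (ι → ℝ)) : Prop where
  isOpen : IsOpen D
  smooth : ∀ i j, ContDiffOn ℝ ∞ (fun z => J z i j) D
  antisymm : ∀ z ∈ D, ∀ i j, J z i j = -J z j i
  jacobi : ∀ z ∈ D, JacobiAt J D z

/-- At the point `z`, the function `C` has zero bracket with every function smooth on `D`. -/
def CasimirAt {ι : Type} [Fintype ι] [DecidableEq ι] (J : (ι → ℝ) → Matrix ι ι ℝ)
    (D : Set (ι → ℝ)) (C : (ι → ℝ) → ℝ) (z : ι → ℝ) : Prop :=
  ∀ g : (ι → ℝ) → ℝ, ContDiffOn ℝ ∞ g D → bracket J C g z = 0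

/-! ### Minkowski four-vectors and second-rank tensors

All four-vectors and all second-rank tensors are stored with contravariant components; every dot
contracts adjacent indices with the metric. -/

/-- Four-vectors. -/
abbrev Vec : Type := Fin 4 → ℝ

/-- Second-rank tensors. -/
abbrev Ten : Type := Matrix (Fin 4) (Fin 4) ℝ

/-- The Minkowski metric `diag(-1, 1, 1, 1)`. It equals its inverse, so it is also the
contravariant form of the unit tensor. -/
def eta : Ten := Matrix.diagonal ![-1, 1, 1, 1]

/-- `A · B`. -/
def tdot (A B : Ten) : Ten := A * eta * B

/-- `A · v`. -/
def tvec (A : Ten) (v : Vec) : Vec := A.mulVec (eta.mulVec v)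

/-- `v · A`. -/
def vten (v : Vec) (A : Ten) : Vec := A.transpose.mulVec (eta.mulVec v)

/-- `u · v`. -/
def vdot (u v : Vec) : ℝ := ∑ μ, ∑ ν, u μ * eta μ ν * v ν

/-- The double contraction `A : B = A_{μν} B^{μν}`. -/
def ddot (A B : Ten) : ℝ := ∑ μ, ∑ ν, (eta * A * eta) μ ν * B μ ν

/-- The dyad `u v`. -/
def dyad (u v : Vec) : Ten := Matrix.of fun μ ν => u μ * v ν

/-- Raise both indices of a covariant tensor. -/
def raise (A : Ten) : Ten := eta * A * eta

/-- The gradient `(∇V)^{μν} = ∂^μ V^ν` of a vector field. -/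
def grad (V : Vec → Vec) (x : Vec) : Ten :=
  eta * Matrix.of fun σ ν => pd (fun y => V y ν) σ x

/-- `(∇P) · v`, with components `(∂^μ P^{ντ}) v_τ`: the gradient acts on `P` only. -/
def gradDot (P : Vec → Ten) (v : Vec) (x : Vec) : Ten :=
  grad (fun y => tvec (P y) v) x

infixl:70 " ⊡ " => tdot

/-! ### Phase-space coordinates -/

/-- Indices of the eight guiding-center coordinates: `inl μ` is `R^μ`, and `inr 0`, `inr 1`,
`inr 2`, `inr 3` are `K`, the boost angle `𝓑`, the gyromomentum `μ` and the gyroangle `Θ`. -/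
abbrev GCIdx : Type := Fin 4 ⊕ Fin 4

/-- Indices after appending the five constraint coordinates
`C₁ₐ`, `C₁ᵦ`, `C₂ₐ`, `C₂ᵦ`, `C₃`, in this order. -/
abbrev ExtIdx : Type := GCIdx ⊕ Fin 5

/-- Indices of the thirteen gauge-invariant coordinates, in the order `R`, `U`, `μ`, `α̂`. -/
abbrev InvIdx : Type := Fin 4 ⊕ Fin 4 ⊕ Unit ⊕ Fin 4

def zR (z : GCIdx → ℝ) : Vec := fun μ => z (.inl μ)
def zK (z : GCIdx → ℝ) : ℝ := z (.inr 0)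
def zB (z : GCIdx → ℝ) : ℝ := z (.inr 1)
def zMu (z : GCIdx → ℝ) : ℝ := z (.inr 2)
def zTheta (z : GCIdx → ℝ) : ℝ := z (.inr 3)

/-- The guiding-center part of a point of the extended phase space. -/
def base (y : ExtIdx → ℝ) : GCIdx → ℝ := fun i => y (.inl i)

def invR (Z : InvIdx → ℝ) : Vec := fun μ => Z (.inl μ)
def invU (Z : InvIdx → ℝ) : Vec := fun μ => Z (.inr (.inl μ))
def invMu (Z : InvIdx → ℝ) : ℝ := Z (.inr (.inr (.inl ())))
def invAlpha (Z : InvIdx → ℝ) : Vec := fun μ => Z (.inr (.inr (.inr μ)))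

/-- The two levels of truncation of the guiding-center Lagrangian. -/
inductive GCOrder where
  | classical
  | higher

/-! ### Fields and tetrads -/

/-- Mass, charge, speed of light, ordering parameter, the covariant components of the four-potentials
of order zero, one and two, and a tetrad field `ê₀, ê₁, ê₂, ê₃`. -/
structure Data where
  m : ℝ
  q : ℝ
  c : ℝ
  ε : ℝ
  A0 : Vec → Vec
  A1 : Vec → Vec
  A2 : Vec → Vec
  e : Fin 4 → Vec → Vec

namespace Data

variable (S : Data)

def F0 (x : Vec) : Ten := raise (extD S.A0 x)
def F1 (x : Vec) : Ten := raise (extD S.A1 x)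
def F2 (x : Vec) : Ten := raise (extD S.A2 x)

/-- The dual tensor `𝓕₀^{μν} = ½ ε^{μναβ} F₀_{αβ}` with `ε^{0123} = -1`, written out. -/
def dualF0 (x : Vec) : Ten :=
  !![0, -extD S.A0 x 2 3, -extD S.A0 x 3 1, -extD S.A0 x 1 2;
     extD S.A0 x 2 3, 0, -extD S.A0 x 0 3, extD S.A0 x 0 2;
     extD S.A0 x 3 1, extD S.A0 x 0 3, 0, -extD S.A0 x 0 1;
     extD S.A0 x 1 2, -extD S.A0 x 0 2, extD S.A0 x 0 1, 0]

/-- The Lorentz scalar `½ F₀ : F₀ = B² - E²`. -/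
def lam1 (x : Vec) : ℝ := 1 / 2 * ddot (S.F0 x) (S.F0 x)

/-- The Lorentz scalar `¼ 𝓕₀ : F₀ = E · B`. -/
def lam2 (x : Vec) : ℝ := 1 / 4 * ddot (S.dualF0 x) (S.F0 x)

def lamE (x : Vec) : ℝ :=
  Real.sign (S.lam2 x) * √(1 / 2 * (√(S.lam1 x ^ 2 + 4 * S.lam2 x ^ 2) - S.lam1 x))

def lamB (x : Vec) : ℝ :=
  √(1 / 2 * (√(S.lam1 x ^ 2 + 4 * S.lam2 x ^ 2) + S.lam1 x))

/-- The gyrofrequency. -/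
def OmegaB (x : Vec) : ℝ := S.q * S.lamB x / (S.m * S.c)

/-- The projector on the parallel two-flat, for `λ_E = 0`. -/
def Ppar (x : Vec) : Ten := eta + (S.lamB x ^ 2)⁻¹ • (S.F0 x ⊡ S.F0 x)

/-- The projector on the perpendicular two-flat, for `λ_E = 0`. -/
def Pperp (x : Vec) : Ten := -(S.lamB x ^ 2)⁻¹ • (S.F0 x ⊡ S.F0 x)

/-- Standing assumptions over a spacetime region `O`: the fields are smooth, `F₀` has `λ_E = 0` and
`λ_B > 0`, and the tetrad is a smooth orthonormal tetrad adapted to the two-flats of `F₀`. -/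
structure Admissible (O : Set Vec) : Prop where
  m_pos : 0 < S.m
  q_ne : S.q ≠ 0
  c_pos : 0 < S.c
  ε_ne : S.ε ≠ 0
  isOpen : IsOpen O
  smooth_A0 : ContDiffOn ℝ ∞ S.A0 O
  smooth_A1 : ContDiffOn ℝ ∞ S.A1 O
  smooth_A2 : ContDiffOn ℝ ∞ S.A2 O
  smooth_e : ∀ i, ContDiffOn ℝ ∞ (S.e i) O
  lamE_eq : ∀ x ∈ O, S.lamE x = 0
  lamB_pos : ∀ x ∈ O, 0 < S.lamB x
  orthonormal : ∀ x ∈ O, ∀ i j, vdot (S.e i x) (S.e j x) = eta i j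
  F_e0 : ∀ x ∈ O, tvec (S.F0 x) (S.e 0 x) = 0
  F_e1 : ∀ x ∈ O, tvec (S.F0 x) (S.e 1 x) = 0
  F_e2 : ∀ x ∈ O, tvec (S.F0 x) (S.e 2 x) = -S.lamB x • S.e 3 x
  F_e3 : ∀ x ∈ O, tvec (S.F0 x) (S.e 3 x) = S.lamB x • S.e 2 x
  dualF_e0 : ∀ x ∈ O, tvec (S.dualF0 x) (S.e 0 x) = -S.lamB x • S.e 1 x
  dualF_e1 : ∀ x ∈ O, tvec (S.dualF0 x) (S.e 1 x) = -S.lamB x • S.e 0 x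
  dualF_e2 : ∀ x ∈ O, tvec (S.dualF0 x) (S.e 2 x) = 0
  dualF_e3 : ∀ x ∈ O, tvec (S.dualF0 x) (S.e 3 x) = 0

def that (x : Vec) (β : ℝ) : Vec := Real.cosh β • S.e 0 x + Real.sinh β • S.e 1 x
def bhat (x : Vec) (β : ℝ) : Vec := Real.sinh β • S.e 0 x + Real.cosh β • S.e 1 x
def chat (x : Vec) (θ : ℝ) : Vec := -(Real.sin θ) • S.e 2 x - Real.cos θ • S.e 3 x
def ahat (x : Vec) (θ : ℝ) : Vec := Real.cos θ • S.e 2 x - Real.sin θ • S.e 3 x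

/-- Covariant components of the gyrogauge one-form `𝓡 = (∇ê₂) · ê₃`. -/
def Rcov (x : Vec) : Vec := fun σ => vdot (fun ν => pd (fun y => S.e 2 y ν) σ x) (S.e 3 x)

/-- Contravariant components of `𝓡`. -/
def Rvec (x : Vec) : Vec := eta.mulVec (S.Rcov x)

/-- `𝓝 = d𝓡`. -/
def Ncurv (x : Vec) : Ten := raise (extD S.Rcov x)

/-! ### The guiding-center Lagrangian and its Poisson tensor -/

/-- The guiding-center action one-form
`[(e/εc)(A₀ + εA₁ + ε²A₂) + m K t̂ - εμ𝓡] · dR + εμ dΘ`; the classical order drops `A₂` and `𝓡`. -/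
def action (ord : GCOrder) (z : GCIdx → ℝ) : GCIdx → ℝ
  | .inl μ =>
      match ord with
      | .classical =>
          S.q / (S.ε * S.c) * (S.A0 (zR z) μ + S.ε * S.A1 (zR z) μ)
            + S.m * zK z * eta.mulVec (S.that (zR z) (zB z)) μ
      | .higher =>
          S.q / (S.ε * S.c) * (S.A0 (zR z) μ + S.ε * S.A1 (zR z) μ + S.ε ^ 2 * S.A2 (zR z) μ)
            + S.m * zK z * eta.mulVec (S.that (zR z) (zB z)) μ
            - S.ε * zMu z * S.Rcov (zR z) μ
  | .inr k => ![0, 0, 0, S.ε * zMu z] k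

/-- The guiding-center Lagrangian two-form. -/
def omega (ord : GCOrder) (z : GCIdx → ℝ) : Matrix GCIdx GCIdx ℝ := extD (S.action ord) z

/-- The guiding-center Poisson tensor: the inverse matrix of the Lagrangian two-form. -/
def poisson (ord : GCOrder) (z : GCIdx → ℝ) : Matrix GCIdx GCIdx ℝ := (S.omega ord z)⁻¹

/-! ### The explicit brackets in the coordinates `(R, K, 𝓑, μ, Θ)` -/

/-- The tensor `F'`. -/
def Fp (ord : GCOrder) (x : Vec) (μ : ℝ) : Ten :=
  match ord with
  | .classical => S.F1 x
  | .higher => S.F1 x + S.ε • S.F2 x - (S.ε * S.c / S.q * μ) • S.Ncurv x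

/-- The tensor `F'' = F' + (mcK/e)(∇t̂ - (∇t̂)ᵀ)`. -/
def Fpp (ord : GCOrder) (z : GCIdx → ℝ) : Ten :=
  S.Fp ord (zR z) (zMu z) + (S.m * S.c * zK z / S.q) •
    (grad (fun y => S.that y (zB z)) (zR z)
      - (grad (fun y => S.that y (zB z)) (zR z)).transpose)

/-- The scalar `Υ = 1 + ε F₀ : F'' / (2 λ_B²)`. -/
def Ups (ord : GCOrder) (z : GCIdx → ℝ) : ℝ :=
  1 + S.ε * ddot (S.F0 (zR z)) (S.Fpp ord z) / (2 * S.lamB (zR z) ^ 2)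

/-- The tensor `Ξ = 1 + ε F'' · F₀ / (λ_B² Υ)`. -/
def Xi (ord : GCOrder) (z : GCIdx → ℝ) : Ten :=
  eta + (S.ε / (S.lamB (zR z) ^ 2 * S.Ups ord z)) • (S.Fpp ord z ⊡ S.F0 (zR z))

/-- The region of guiding-center phase space over `O` where `K > 0` and `Υ ≠ 0`. -/
def domain (ord : GCOrder) (O : Set Vec) : Set (GCIdx → ℝ) :=
  {z | zR z ∈ O ∧ 0 < zK z ∧ S.Ups ord z ≠ 0}

/-- `{R, R}`. -/
def brRR (ord : GCOrder) (z : GCIdx → ℝ) : Ten :=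
  -(S.ε / (S.m * S.lamB (zR z) * S.OmegaB (zR z) * S.Ups ord z)) • S.F0 (zR z)

/-- `{R, K}`. -/
def brRK (ord : GCOrder) (z : GCIdx → ℝ) : Vec :=
  -(1 / S.m) • vten (S.that (zR z) (zB z)) (S.Xi ord z)

/-- `{R, 𝓑}`. -/
def brRB (ord : GCOrder) (z : GCIdx → ℝ) : Vec :=
  (1 / (S.m * zK z)) • vten (S.bhat (zR z) (zB z)) (S.Xi ord z)

/-- `{R, Θ}`. -/
def brRTheta (ord : GCOrder) (z : GCIdx → ℝ) : Vec :=
  match ord with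
  | .classical => 0
  | .higher => tvec (S.brRR ord z) (S.Rvec (zR z))

/-- `{K, 𝓑}`. -/
def brKB (ord : GCOrder) (z : GCIdx → ℝ) : ℝ :=
  -(S.q / (S.m ^ 2 * S.c * zK z)) *
    vdot (vten (S.that (zR z) (zB z)) (S.Xi ord z ⊡ S.Fpp ord z)) (S.bhat (zR z) (zB z))

/-- `{K, Θ}`, where `{K, R} = -{R, K}`. -/
def brKTheta (ord : GCOrder) (z : GCIdx → ℝ) : ℝ :=
  match ord with
  | .classical => 0
  | .higher => vdot (-S.brRK ord z) (S.Rvec (zR z))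

/-- `{𝓑, Θ}`, where `{𝓑, R} = -{R, 𝓑}`. -/
def brBTheta (ord : GCOrder) (z : GCIdx → ℝ) : ℝ :=
  match ord with
  | .classical => 0
  | .higher => vdot (-S.brRB ord z) (S.Rvec (zR z))

/-- The matrix of the explicit brackets among the coordinates `(R, K, 𝓑, μ, Θ)`; the rows and columns
of the lower right block are `K`, `𝓑`, `μ`, `Θ`, and `{Θ, μ} = 1/ε`. -/
def gcTensor (ord : GCOrder) (z : GCIdx → ℝ) : Matrix GCIdx GCIdx ℝ :=
  Matrix.of fun i j =>
    match i, j with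
    | .inl μ, .inl ν => S.brRR ord z μ ν
    | .inl μ, .inr l => ![S.brRK ord z μ, S.brRB ord z μ, 0, S.brRTheta ord z μ] l
    | .inr k, .inl ν => ![-S.brRK ord z ν, -S.brRB ord z ν, 0, -S.brRTheta ord z ν] k
    | .inr k, .inr l =>
        !![0, S.brKB ord z, 0, S.brKTheta ord z;
           -S.brKB ord z, 0, 0, S.brBTheta ord z;
           0, 0, 0, -(1 / S.ε);
           -S.brKTheta ord z, -S.brBTheta ord z, 1 / S.ε, 0] k l

/-! ### The embedding in the thirteen-dimensional phase space -/

/-- The extended phase space: a guiding-center point with five constraint coordinates, `C₃ > 0`. -/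
def extDomain (ord : GCOrder) (O : Set Vec) : Set (ExtIdx → ℝ) :=
  {y | base y ∈ S.domain ord O ∧ 0 < y (.inr 4)}

/-- The Poisson tensor of the extended phase space: the brackets of `(R, K, 𝓑, μ, Θ)` are kept, and
the five constraint coordinates have zero bracket with every coordinate. -/
def extPoisson (ord : GCOrder) (y : ExtIdx → ℝ) : Matrix ExtIdx ExtIdx ℝ :=
  Matrix.fromBlocks (S.poisson ord (base y)) 0 0 0

/-- The transformation to the coordinates `(R, U, μ, α̂)`:
`U = K t̂ + C₃^{-1/2} (C₁ₐ ĉ / λ_B + C₁ᵦ â)`, `α̂ = C₃^{1/2} â + K⁻¹ (-C₂ₐ t̂ + C₂ᵦ b̂ / λ_B)`. -/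
def toInv (y : ExtIdx → ℝ) : InvIdx → ℝ
  | .inl μ => zR (base y) μ
  | .inr (.inl μ) =>
      zK (base y) * S.that (zR (base y)) (zB (base y)) μ
        + 1 / √(y (.inr 4)) *
          (y (.inr 0) / S.lamB (zR (base y)) * S.chat (zR (base y)) (zTheta (base y)) μ
            + y (.inr 1) * S.ahat (zR (base y)) (zTheta (base y)) μ)
  | .inr (.inr (.inl _)) => zMu (base y)
  | .inr (.inr (.inr μ)) =>
      √(y (.inr 4)) * S.ahat (zR (base y)) (zTheta (base y)) μ
        + 1 / zK (base y) *
          (-y (.inr 2) * S.that (zR (base y)) (zB (base y)) μ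
            + y (.inr 3) / S.lamB (zR (base y)) * S.bhat (zR (base y)) (zB (base y)) μ)

/-- The Jacobian matrix of `toInv`. -/
def jacInv (y : ExtIdx → ℝ) : Matrix InvIdx ExtIdx ℝ :=
  Matrix.of fun a i => pd (fun y' => S.toInv y' a) i y

/-- The region of the gauge-invariant phase space covered by the extended phase space. -/
def invDomain (ord : GCOrder) (O : Set Vec) : Set (InvIdx → ℝ) :=
  S.toInv '' S.extDomain ord O

/-- The five constraint coordinates as functions of `(R, U, μ, α̂)`:
`U·F₀·α̂`, `U·P_⊥·α̂`, `U·P_∥·α̂`, `U·𝓕₀·α̂`, `α̂·P_⊥·α̂`. -/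
def constraint (k : Fin 5) (Z : InvIdx → ℝ) : ℝ :=
  ![vdot (invU Z) (tvec (S.F0 (invR Z)) (invAlpha Z)),
    vdot (invU Z) (tvec (S.Pperp (invR Z)) (invAlpha Z)),
    vdot (invU Z) (tvec (S.Ppar (invR Z)) (invAlpha Z)),
    vdot (invU Z) (tvec (S.dualF0 (invR Z)) (invAlpha Z)),
    vdot (invAlpha Z) (tvec (S.Pperp (invR Z)) (invAlpha Z))] k

/-- `P_⊥ · U`. -/
def perpU (Z : InvIdx → ℝ) : Vec := tvec (S.Pperp (invR Z)) (invU Z)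

/-- `P_∥ · α̂`. -/
def parAlpha (Z : InvIdx → ℝ) : Vec := tvec (S.Ppar (invR Z)) (invAlpha Z)

/-! ### The explicit brackets in the coordinates `(R, U, μ, α̂)` -/

/-- `∇P_∥ · U`. -/
def gradU (Z : InvIdx → ℝ) : Ten := gradDot S.Ppar (invU Z) (invR Z)

/-- The gradient of `α̂`: `∇P_⊥ · α̂` at the higher order. At the classical order the gyrogauge
one-form survives, `∇P_⊥ · α̂ - 𝓡 (F₀ · α̂) / λ_B`. -/
def gradAlpha (ord : GCOrder) (Z : InvIdx → ℝ) : Ten :=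
  match ord with
  | .classical =>
      gradDot S.Pperp (invAlpha Z) (invR Z)
        - (1 / S.lamB (invR Z)) • dyad (S.Rvec (invR Z)) (tvec (S.F0 (invR Z)) (invAlpha Z))
  | .higher => gradDot S.Pperp (invAlpha Z) (invR Z)

/-- The tensor `F''' = F' + (mc/e)(∇P_∥ · U - (∇P_∥ · U)ᵀ)`. -/
def Fppp (ord : GCOrder) (Z : InvIdx → ℝ) : Ten :=
  S.Fp ord (invR Z) (invMu Z) + (S.m * S.c / S.q) • (S.gradU Z - (S.gradU Z).transpose)

/-- The scalar `Υ' = 1 + ε F₀ : F''' / (2 λ_B²)`. -/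
def Upsp (ord : GCOrder) (Z : InvIdx → ℝ) : ℝ :=
  1 + S.ε * ddot (S.F0 (invR Z)) (S.Fppp ord Z) / (2 * S.lamB (invR Z) ^ 2)

/-- The tensor `Ξ' = 1 + ε F''' · F₀ / (λ_B² Υ')`. -/
def Xip (ord : GCOrder) (Z : InvIdx → ℝ) : Ten :=
  eta + (S.ε / (S.lamB (invR Z) ^ 2 * S.Upsp ord Z)) • (S.Fppp ord Z ⊡ S.F0 (invR Z))

/-- `{R, R}`. -/
def invRR (ord : GCOrder) (Z : InvIdx → ℝ) : Ten :=
  -(S.ε / (S.m * S.lamB (invR Z) * S.OmegaB (invR Z) * S.Upsp ord Z)) • S.F0 (invR Z)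

/-- `{R, U}`. -/
def invRU (ord : GCOrder) (Z : InvIdx → ℝ) : Ten :=
  (1 / S.m) • S.Ppar (invR Z)
    + (S.ε / (S.m * S.lamB (invR Z) ^ 2 * S.Upsp ord Z)) •
      (S.F0 (invR Z) ⊡ (S.Fppp ord Z ⊡ S.Ppar (invR Z) - (S.m * S.c / S.q) • S.gradU Z))

/-- `{U, U}`. -/
def invUU (ord : GCOrder) (Z : InvIdx → ℝ) : Ten :=
  -(S.OmegaB (invR Z) / (2 * S.m * S.lamB (invR Z) ^ 3)
      * ddot (S.dualF0 (invR Z)) (S.Fppp ord Z ⊡ (S.Xip ord Z).transpose)) • S.dualF0 (invR Z)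
    - (1 / S.m) •
      (S.Ppar (invR Z) ⊡ S.Xip ord Z ⊡ S.gradU Z
        - (S.gradU Z).transpose ⊡ (S.Xip ord Z).transpose ⊡ S.Ppar (invR Z))
    - (S.ε / (S.m * S.lamB (invR Z) * S.OmegaB (invR Z) * S.Upsp ord Z)) •
      ((S.gradU Z).transpose ⊡ S.F0 (invR Z) ⊡ S.gradU Z)

/-- `{R, α̂} = {R, R} · ∇α̂`. -/
def invRAlpha (ord : GCOrder) (Z : InvIdx → ℝ) : Ten :=
  S.invRR ord Z ⊡ S.gradAlpha ord Z

/-- `{U, α̂} = {U, R} · ∇α̂`, where `{U, R} = -{R, U}ᵀ`. -/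
def invUAlpha (ord : GCOrder) (Z : InvIdx → ℝ) : Ten :=
  -(S.invRU ord Z).transpose ⊡ S.gradAlpha ord Z

/-- `{α̂, μ}`. -/
def invAlphaMu (Z : InvIdx → ℝ) : Vec :=
  (1 / (S.ε * S.lamB (invR Z))) • tvec (S.F0 (invR Z)) (invAlpha Z)

/-- `{α̂, α̂}`. -/
def invAlphaAlpha (ord : GCOrder) (Z : InvIdx → ℝ) : Ten :=
  -(S.ε / (S.m * S.lamB (invR Z) * S.OmegaB (invR Z) * S.Upsp ord Z)) •
    ((S.gradAlpha ord Z).transpose ⊡ S.F0 (invR Z) ⊡ S.gradAlpha ord Z)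

/-- The matrix of the explicit brackets among the coordinates `(R, U, μ, α̂)`. -/
def invTensor (ord : GCOrder) (Z : InvIdx → ℝ) : Matrix InvIdx InvIdx ℝ :=
  Matrix.of fun a b =>
    match a, b with
    | .inl μ, .inl ν => S.invRR ord Z μ ν
    | .inl μ, .inr (.inl ν) => S.invRU ord Z μ ν
    | .inl _, .inr (.inr (.inl _)) => 0
    | .inl μ, .inr (.inr (.inr ν)) => S.invRAlpha ord Z μ ν
    | .inr (.inl μ), .inl ν => -S.invRU ord Z ν μ
    | .inr (.inl μ), .inr (.inl ν) => S.invUU ord Z μ ν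
    | .inr (.inl _), .inr (.inr (.inl _)) => 0
    | .inr (.inl μ), .inr (.inr (.inr ν)) => S.invUAlpha ord Z μ ν
    | .inr (.inr (.inl _)), .inl _ => 0
    | .inr (.inr (.inl _)), .inr (.inl _) => 0
    | .inr (.inr (.inl _)), .inr (.inr (.inl _)) => 0
    | .inr (.inr (.inl _)), .inr (.inr (.inr ν)) => -S.invAlphaMu Z ν
    | .inr (.inr (.inr μ)), .inl ν => -S.invRAlpha ord Z ν μ
    | .inr (.inr (.inr μ)), .inr (.inl ν) => -S.invUAlpha ord Z ν μ
    | .inr (.inr (.inr μ)), .inr (.inr (.inl _)) => S.invAlphaMu Z μ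
    | .inr (.inr (.inr μ)), .inr (.inr (.inr ν)) => S.invAlphaAlpha ord Z μ ν

/-- The hypersurface `P_⊥ · U = 0`, `P_∥ · α̂ = 0`, in the gauge-invariant phase space. It contains the
physical one, where also `α̂ · α̂ = 1`. -/
def constraintSurface (ord : GCOrder) (O : Set Vec) : Set (InvIdx → ℝ) :=
  {Z | Z ∈ S.invDomain ord O ∧ S.perpU Z = 0 ∧ S.parAlpha Z = 0}

end Data

end

end GuidingCenter

/-! The Lagrangian two-form is an exterior derivative, so it is closed because second partial
derivatives commute. For any closed, invertible two-form the Jacobi identity of the inverse is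
formal: the derivative of the inverse is minus inverse times derivative times inverse, the second
derivatives of the functions cancel in the cyclic sum, and what remains is the exterior derivative
of the form evaluated on three Hamiltonian vectors (`isPoissonOn_inv`). Invertibility and the
explicit table are obtained together, by multiplying the two-form with the table
(`omega_mul_gcTensor`).

The algebra is done in the orthonormal frame of the vectors t̂, b̂, ĉ, â. There F₀ has a single
independent component, every contraction commutes with passing to components (`tdot_conj` and its
companions), and each tensor identity becomes sixteen rational identities.

The map to the thirteen coordinates is a local diffeomorphism (`eq_zero_of_fderiv_toInv`), but it is
not injective: the gyroangle enters through its sine and cosine only. Points with equal image differ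
by a translation of the gyroangle that leaves both the map and the action form unchanged, so the
push-forward does not depend on the preimage (`push_eq_of_toInv_eq`). Its Jacobi identity comes from
`jacobi_push`, which needs only a smooth map relating two brackets, not a diffeomorphism.

The hypersurface is the union of the leaves on which the first four appended coordinates vanish and
the fifth is a constant r. Each leaf is parametrized by the original eight coordinates (`surf`),
with U = K t̂ and α̂ = √r â, so the explicit brackets there follow from the chain rule
(`sum_surfJac_eq_invTensor`). Two mechanisms make the result invariant. The gradient of P_∥ applied
to t̂ is ∇t̂ with its b̂-component removed, and that component is what a local boost changes
(`gradU_surf`). The gradient of P_⊥ applied to â is ∇â plus 𝓡 ĉ, the combination that the brackets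
with the gyroangle supply (`gradAlpha_surf`). The explicit tensor is compared with the push-forward
only on the hypersurface; its Jacobi identity there is carried over from the eight-dimensional
bracket along a leaf, and functions constant on a leaf are Casimirs at its points.

At the higher order the tetrad enters the explicit brackets only through 𝓝 = d𝓡. Adapted tetrads
differ by a rotation in the perpendicular two-flat, which changes 𝓡 by a closed form
(`Ncurv_eq_of_tetrad`). -/

namespace GuidingCenter

/-! ### Coordinate partial derivatives and the exterior derivative -/

section Calculus

variable {ι κ : Type} [Fintype ι] [DecidableEq ι] [Fintype κ] [DecidableEq κ]

theorem contDiffAt_pd {f : (ι → ℝ) → ℝ} {z : ι → ℝ} (hf : ContDiffAt ℝ ∞ f z) (i : ι) :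
    ContDiffAt ℝ ∞ (fun y => pd f i y) z :=
  (hf.fderiv_right (m := ∞) (by simp)).clm_apply contDiffAt_const

theorem _root_.ContDiffAt.diff {E F : Type*} [NormedAddCommGroup E] [NormedSpace ℝ E]
    [NormedAddCommGroup F] [NormedSpace ℝ F] {f : E → F} {z : E} (hf : ContDiffAt ℝ ∞ f z) :
    DifferentiableAt ℝ f z :=
  hf.differentiableAt (by simp)

theorem pd_congr {f g : (ι → ℝ) → ℝ} {z : ι → ℝ} (h : f =ᶠ[nhds z] g) (i : ι) :
    pd f i z = pd g i z := by
  simp only [pd, h.fderiv_eq]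

theorem pd_const (c : ℝ) (i : ι) (z : ι → ℝ) : pd (fun _ => c) i z = 0 := by
  simp [pd]

theorem pd_add {f g : (ι → ℝ) → ℝ} {z : ι → ℝ} (hf : DifferentiableAt ℝ f z)
    (hg : DifferentiableAt ℝ g z) (i : ι) :
    pd (fun y => f y + g y) i z = pd f i z + pd g i z := by
  simp [pd, fderiv_fun_add hf hg]

theorem pd_sub {f g : (ι → ℝ) → ℝ} {z : ι → ℝ} (hf : DifferentiableAt ℝ f z)
    (hg : DifferentiableAt ℝ g z) (i : ι) :
    pd (fun y => f y - g y) i z = pd f i z - pd g i z := by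
  simp [pd, fderiv_fun_sub hf hg]

theorem pd_mul {f g : (ι → ℝ) → ℝ} {z : ι → ℝ} (hf : DifferentiableAt ℝ f z)
    (hg : DifferentiableAt ℝ g z) (i : ι) :
    pd (fun y => f y * g y) i z = pd f i z * g z + f z * pd g i z := by
  simp [pd, fderiv_fun_mul hf hg]; ring

theorem pd_const_mul {f : (ι → ℝ) → ℝ} {z : ι → ℝ} (c : ℝ) (hf : DifferentiableAt ℝ f z)
    (i : ι) : pd (fun y => c * f y) i z = c * pd f i z := by
  rw [pd, fderiv_const_mul hf]; rfl

theorem pd_mul_const {f : (ι → ℝ) → ℝ} {z : ι → ℝ} (c : ℝ) (hf : DifferentiableAt ℝ f z)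
    (i : ι) : pd (fun y => f y * c) i z = pd f i z * c := by
  simp only [mul_comm _ c, pd_const_mul c hf]

theorem pd_sum {α : Type} (s : Finset α) {f : α → (ι → ℝ) → ℝ} {z : ι → ℝ}
    (hf : ∀ a ∈ s, DifferentiableAt ℝ (f a) z) (i : ι) :
    pd (fun y => ∑ a ∈ s, f a y) i z = ∑ a ∈ s, pd (f a) i z := by
  simp [pd, fderiv_fun_sum hf]

theorem fderiv_apply_eq_sum_pd (f : (ι → ℝ) → ℝ) (z v : ι → ℝ) :
    fderiv ℝ f z v = ∑ i, v i * pd f i z := by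
  conv_lhs => rw [pi_eq_sum_univ' v]
  simp [pd, map_sum, Pi.single]

theorem pd_proj (j i : ι) (z : ι → ℝ) : pd (fun y => y j) i z = if j = i then 1 else 0 := by
  have : fderiv ℝ (fun y : ι → ℝ => y j) z = ContinuousLinearMap.proj j :=
    (ContinuousLinearMap.proj (R := ℝ) (φ := fun _ : ι => ℝ) j).hasFDerivAt.fderiv
  simp [pd, this, Pi.single_apply]

theorem pd_comp {f : (κ → ℝ) → ℝ} {φ : (ι → ℝ) → κ → ℝ} {z : ι → ℝ}
    (hf : DifferentiableAt ℝ f (φ z)) (hφ : DifferentiableAt ℝ φ z) (i : ι) :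
    pd (fun y => f (φ y)) i z = ∑ a, pd (fun y => φ y a) i z * pd f a (φ z) := by
  have h : fderiv ℝ (fun y => f (φ y)) z = (fderiv ℝ f (φ z)).comp (fderiv ℝ φ z) :=
    fderiv_comp z hf hφ
  rw [pd, h, ContinuousLinearMap.comp_apply, fderiv_apply_eq_sum_pd]
  refine Finset.sum_congr rfl fun a _ => ?_
  have h2 : fderiv ℝ (fun y => φ y a) z = (ContinuousLinearMap.proj a).comp (fderiv ℝ φ z) :=
    ((ContinuousLinearMap.proj (R := ℝ) (φ := fun _ : κ => ℝ) a).hasFDerivAt.comp z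
      hφ.hasFDerivAt).fderiv
  unfold pd
  rw [h2]; rfl

/-- Schwarz's theorem; the source of every closedness statement below and of the cancellation of
Hessians in the Jacobi identity. -/
theorem pd_pd_comm {f : (ι → ℝ) → ℝ} {z : ι → ℝ} (hf : ContDiffAt ℝ ∞ f z) (i j : ι) :
    pd (fun y => pd f i y) j z = pd (fun y => pd f j y) i z := by
  have hs : IsSymmSndFDerivAt ℝ f z := hf.isSymmSndFDerivAt (by
    simp only [minSmoothness_of_isRCLikeNormedField]; exact WithTop.coe_le_coe.2 le_top)
  have hd : DifferentiableAt ℝ (fderiv ℝ f) z := (hf.fderiv_right (m := ∞) (by simp)).diff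
  have key : ∀ a b : ι, pd (fun y => pd f a y) b z
      = fderiv ℝ (fderiv ℝ f) z (Pi.single b 1) (Pi.single a 1) := by
    intro a b
    unfold pd
    rw [fderiv_clm_apply hd (differentiableAt_const _)]
    simp
  rw [key, key]
  exact hs _ _

/-- The exterior derivative of a smooth one-form is closed. -/
theorem extD_closed {γ : (ι → ℝ) → ι → ℝ} {z : ι → ℝ}
    (hγ : ∀ i, ContDiffAt ℝ ∞ (fun y => γ y i) z) (i j k : ι) :
    pd (fun y => extD γ y j k) i z + pd (fun y => extD γ y k i) j z
      + pd (fun y => extD γ y i j) k z = 0 := by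
  have h : ∀ a b c : ι, pd (fun y => extD γ y a b) c z
      = pd (fun y => pd (fun w => γ w b) a y) c z - pd (fun y => pd (fun w => γ w a) b y) c z :=
    fun a b c => pd_sub (contDiffAt_pd (hγ b) a).diff (contDiffAt_pd (hγ a) b).diff c
  rw [h, h, h, pd_pd_comm (hγ k) j i, pd_pd_comm (hγ i) k j, pd_pd_comm (hγ j) i k]
  ring

theorem extD_antisymm (γ : (ι → ℝ) → ι → ℝ) (z : ι → ℝ) (i j : ι) :
    extD γ z i j = -extD γ z j i := by
  simp [extD]

theorem contDiffAt_extD {γ : (ι → ℝ) → ι → ℝ} {z : ι → ℝ}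
    (hγ : ∀ i, ContDiffAt ℝ ∞ (fun y => γ y i) z) (i j : ι) :
    ContDiffAt ℝ ∞ (fun y => extD γ y i j) z :=
  (contDiffAt_pd (hγ j) i).sub (contDiffAt_pd (hγ i) j)

theorem contDiffAt_det {α : Type} [Fintype α] {M : (α → ℝ) → Matrix κ κ ℝ} {z : α → ℝ}
    (hM : ∀ i j, ContDiffAt ℝ ∞ (fun y => M y i j) z) :
    ContDiffAt ℝ ∞ (fun y => (M y).det) z := by
  simp only [Matrix.det_apply]
  refine ContDiffAt.sum fun σ _ => ?_
  exact (contDiffAt_prod fun i _ => hM (σ i) i).const_smul _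

/-- Cramer's rule: each entry of the inverse is a determinant of smooth entries divided by a
determinant that does not vanish. -/
theorem contDiffAt_inv_apply {α : Type} [Fintype α] {M : (α → ℝ) → Matrix κ κ ℝ} {z : α → ℝ}
    (hM : ∀ i j, ContDiffAt ℝ ∞ (fun y => M y i j) z) (hz : IsUnit (M z).det) (i j : κ) :
    ContDiffAt ℝ ∞ (fun y => (M y)⁻¹ i j) z := by
  simp only [Matrix.inv_def, Ring.inverse_eq_inv', Matrix.smul_apply, smul_eq_mul,
    Matrix.adjugate_apply]
  refine ((contDiffAt_det hM).inv hz.ne_zero).mul (contDiffAt_det fun a b => ?_)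
  by_cases h : a = j
  · subst h; simpa using contDiffAt_const
  · simpa [Matrix.updateRow_ne h] using hM a b

theorem contDiffAt_bracket {J : (ι → ℝ) → Matrix ι ι ℝ} {f g : (ι → ℝ) → ℝ} {z : ι → ℝ}
    (hJ : ∀ i j, ContDiffAt ℝ ∞ (fun y => J y i j) z) (hf : ContDiffAt ℝ ∞ f z)
    (hg : ContDiffAt ℝ ∞ g z) : ContDiffAt ℝ ∞ (bracket J f g) z :=
  ContDiffAt.sum fun i _ => ContDiffAt.sum fun j _ =>
    ((contDiffAt_pd hf i).mul (hJ i j)).mul (contDiffAt_pd hg j)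

end Calculus

/-! ### Poisson tensors: transport along maps, and inverses of closed two-forms -/

section Poisson

variable {ι κ : Type} [Fintype ι] [DecidableEq ι] [Fintype κ] [DecidableEq κ]

/-- This is the chain rule. The two tensors are compared only at the single point and its image, and
the dimensions may differ, so it also applies to embeddings of leaves. -/
theorem bracket_push {J : (ι → ℝ) → Matrix ι ι ℝ} {P : (κ → ℝ) → Matrix κ κ ℝ}
    {φ : (ι → ℝ) → κ → ℝ} {z : ι → ℝ} (hφ : DifferentiableAt ℝ φ z)
    (hP : ∀ a b, P (φ z) a b
      = ∑ i, ∑ j, pd (fun y => φ y a) i z * J z i j * pd (fun y => φ y b) j z)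
    {f g : (κ → ℝ) → ℝ} (hf : DifferentiableAt ℝ f (φ z)) (hg : DifferentiableAt ℝ g (φ z)) :
    bracket P f g (φ z) = bracket J (fun y => f (φ y)) (fun y => g (φ y)) z := by
  simp only [bracket, pd_comp hf hφ, pd_comp hg hφ, hP]
  simp only [Finset.sum_mul, Finset.mul_sum]
  -- Both sides are the same fourfold sum in different orders; packing the indices into one product
  -- lets a single bijection do the reordering.
  calc _ = ∑ x : κ × κ × ι × ι, pd f x.1 (φ z) *
        (pd (fun y => φ y x.1) x.2.2.1 z * J z x.2.2.1 x.2.2.2 * pd (fun y => φ y x.2.1) x.2.2.2 z)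
        * pd g x.2.1 (φ z) := by
        simp only [Fintype.sum_prod_type]
    _ = ∑ x : ι × ι × κ × κ, pd f x.2.2.2 (φ z) *
        (pd (fun y => φ y x.2.2.2) x.1 z * J z x.1 x.2.1 * pd (fun y => φ y x.2.2.1) x.2.1 z)
        * pd g x.2.2.1 (φ z) := by
        refine Fintype.sum_equiv
          ⟨fun x => (x.2.2.1, x.2.2.2, x.2.1, x.1), fun x => (x.2.2.2, x.2.2.1, x.1, x.2.1),
            fun _ => rfl, fun _ => rfl⟩ _ _ fun _ => rfl
    _ = _ := by
        simp only [Fintype.sum_prod_type]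
        refine Finset.sum_congr rfl fun i _ => Finset.sum_congr rfl fun j _ =>
          Finset.sum_congr rfl fun b _ => Finset.sum_congr rfl fun a _ => ?_
        ring

/-- The Jacobi identity is transported along a smooth map that relates two brackets. -/
theorem jacobi_push {J : (ι → ℝ) → Matrix ι ι ℝ} {P : (κ → ℝ) → Matrix κ κ ℝ}
    {φ : (ι → ℝ) → κ → ℝ} {U : Set (ι → ℝ)} (hU : IsOpen U)
    (hφ : ∀ z ∈ U, ContDiffAt ℝ ∞ φ z)
    (hP : ∀ z ∈ U, ∀ a b, P (φ z) a b
      = ∑ i, ∑ j, pd (fun y => φ y a) i z * J z i j * pd (fun y => φ y b) j z)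
    {D : Set (κ → ℝ)} (hD : IsOpen D) (hUD : ∀ z ∈ U, φ z ∈ D)
    (hsm : ∀ z ∈ U, ∀ a b, ContDiffAt ℝ ∞ (fun y => P y a b) (φ z))
    (hJ : ∀ z ∈ U, JacobiAt J U z) {z : ι → ℝ} (hz : z ∈ U) : JacobiAt P D (φ z) := by
  intro f g h hf hg hh
  have sm : ∀ {f : (κ → ℝ) → ℝ}, ContDiffOn ℝ ∞ f D → ∀ y ∈ U, ContDiffAt ℝ ∞ f (φ y) :=
    fun hf y hy => hf.contDiffAt (hD.mem_nhds (hUD y hy))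
  have pull : ∀ {f : (κ → ℝ) → ℝ}, ContDiffOn ℝ ∞ f D →
      ContDiffOn ℝ ∞ (fun y => f (φ y)) U := fun hf y hy =>
    (ContDiffAt.comp y (sm hf y hy) (hφ y hy)).contDiffWithinAt
  have key : ∀ {f g h : (κ → ℝ) → ℝ}, ContDiffOn ℝ ∞ f D → ContDiffOn ℝ ∞ g D →
      ContDiffOn ℝ ∞ h D → bracket P f (bracket P g h) (φ z)
        = bracket J (fun y => f (φ y))
            (bracket J (fun y => g (φ y)) (fun y => h (φ y))) z := by
    intro f g h hf hg hh
    rw [bracket_push (hφ z hz).diff (hP z hz) (sm hf z hz).diff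
      (contDiffAt_bracket (hsm z hz) (sm hg z hz) (sm hh z hz)).diff]
    -- The inner bracket gets differentiated, so the relation is needed on a neighbourhood of `z` in
    -- the source. Off the image of `φ` nothing is required of `P` beyond smoothness.
    have : (fun y => bracket P g h (φ y)) =ᶠ[nhds z]
        bracket J (fun y => g (φ y)) (fun y => h (φ y)) := by
      filter_upwards [hU.mem_nhds hz] with y hy
      exact bracket_push (hφ y hy).diff (hP y hy) (sm hg y hy).diff (sm hh y hy).diff
    exact Finset.sum_congr rfl fun i _ => Finset.sum_congr rfl fun j _ => by rw [pd_congr this]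
  rw [key hf hg hh, key hg hh hf, key hh hf hg]
  exact hJ z hz _ _ _ (pull hf) (pull hg) (pull hh)

theorem bracket_eq_dotProduct (J : (ι → ℝ) → Matrix ι ι ℝ) (f g : (ι → ℝ) → ℝ) (z : ι → ℝ) :
    bracket J f g z
      = ∑ l, Matrix.vecMul (fun i => pd f i z) (J z) l * pd g l z := by
  simp only [bracket, Matrix.vecMul, dotProduct, Finset.sum_mul]
  exact Finset.sum_comm

/-- Differentiate the identity Ω⁻¹ Ω = 1, which holds near the point, and multiply by Ω⁻¹ on the
right. -/
theorem pd_inv {Ω : (ι → ℝ) → Matrix κ κ ℝ} {U : Set (ι → ℝ)} (hU : IsOpen U)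
    (hΩ : ∀ z ∈ U, ∀ i j, ContDiffAt ℝ ∞ (fun y => Ω y i j) z)
    (hdet : ∀ z ∈ U, IsUnit (Ω z).det) {z : ι → ℝ} (hz : z ∈ U) (l : ι) :
    (Matrix.of fun j k => pd (fun y => (Ω y)⁻¹ j k) l z)
      = -((Ω z)⁻¹ * (Matrix.of fun j k => pd (fun y => Ω y j k) l z) * (Ω z)⁻¹) := by
  have h : (Matrix.of fun j k => pd (fun y => (Ω y)⁻¹ j k) l z) * Ω z
      + (Ω z)⁻¹ * (Matrix.of fun j k => pd (fun y => Ω y j k) l z) = 0 := by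
    ext j k
    have hd := fun a => (contDiffAt_inv_apply (hΩ z hz) (hdet z hz) j a).diff
    have h1 : pd (fun y => ∑ a, (Ω y)⁻¹ j a * Ω y a k) l z = 0 := by
      rw [pd_congr (g := fun _ => (1 : Matrix κ κ ℝ) j k), pd_const]
      filter_upwards [hU.mem_nhds hz] with y hy
      rw [← Matrix.nonsing_inv_mul _ (hdet y hy), Matrix.mul_apply]
    rw [pd_sum _ (fun a _ => (hd a).fun_mul (hΩ z hz a k).diff)] at h1
    refine Eq.trans ?_ h1
    simp only [pd_mul (hd _) (hΩ z hz _ k).diff, Finset.sum_add_distrib, Matrix.add_apply,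
      Matrix.mul_apply, Matrix.of_apply]
  rw [eq_neg_iff_add_eq_zero]
  have := congrArg (· * (Ω z)⁻¹) h
  simpa [add_mul, Matrix.mul_assoc, Matrix.mul_nonsing_inv _ (hdet z hz)] using this

theorem sum_cyclic {ι : Type} [Fintype ι] (F : ι → ι → ι → ℝ) :
    ∑ a, ∑ b, ∑ c, F a b c = ∑ a, ∑ b, ∑ c, F b c a := by
  rw [Finset.sum_comm (f := fun a b => ∑ c, F b c a)]
  exact Finset.sum_congr rfl fun a _ => Finset.sum_comm.symm

/-- The inverse of a closed non-degenerate two-form is a Poisson tensor. -/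
theorem isPoissonOn_inv {Ω : (ι → ℝ) → Matrix ι ι ℝ} {U : Set (ι → ℝ)} (hU : IsOpen U)
    (hΩ : ∀ z ∈ U, ∀ i j, ContDiffAt ℝ ∞ (fun y => Ω y i j) z)
    (hdet : ∀ z ∈ U, IsUnit (Ω z).det) (hanti : ∀ z ∈ U, ∀ i j, Ω z i j = -Ω z j i)
    (hcl : ∀ z ∈ U, ∀ i j k, pd (fun y => Ω y j k) i z + pd (fun y => Ω y k i) j z
      + pd (fun y => Ω y i j) k z = 0) :
    IsPoissonOn (fun z => (Ω z)⁻¹) U := by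
  have hJsm : ∀ z ∈ U, ∀ i j, ContDiffAt ℝ ∞ (fun y => (Ω y)⁻¹ i j) z := fun z hz =>
    contDiffAt_inv_apply (hΩ z hz) (hdet z hz)
  have hT : ∀ z ∈ U, ((Ω z)⁻¹).transpose = -(Ω z)⁻¹ := by
    intro z hz
    have h1 : (Ω z).transpose = -Ω z := by
      ext i j; exact hanti z hz j i
    rw [Matrix.transpose_nonsing_inv, h1]
    refine Matrix.inv_eq_left_inv ?_
    simp [Matrix.nonsing_inv_mul _ (hdet z hz)]
  have hanti' : ∀ z ∈ U, ∀ i j, (Ω z)⁻¹ i j = -(Ω z)⁻¹ j i := fun z hz i j =>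
    congrFun (congrFun (hT z hz) j) i
  refine ⟨hU, fun i j z hz => (hJsm z hz i j).contDiffWithinAt, hanti', ?_⟩
  intro z hz f g h hf hg hh
  have sm : ∀ {f : (ι → ℝ) → ℝ}, ContDiffOn ℝ ∞ f U → ContDiffAt ℝ ∞ f z :=
    fun hf => hf.contDiffAt (hU.mem_nhds hz)
  set J : (ι → ℝ) → Matrix ι ι ℝ := fun z => (Ω z)⁻¹ with hJ
  -- `X f` is the Hamiltonian vector of `f`, with the differential contracted on the left index of
  -- `J`; contraction on the right index gives its negative, by antisymmetry.
  set X : ((ι → ℝ) → ℝ) → ι → ℝ := fun f => Matrix.vecMul (fun i => pd f i z) (J z) with hX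
  have hXr : ∀ f, Matrix.mulVec (J z) (fun i => pd f i z) = -X f := by
    intro f
    rw [hX]
    simp only
    rw [← Matrix.mulVec_transpose, hT z hz, Matrix.neg_mulVec, neg_neg]
  have key : ∀ {g h : (ι → ℝ) → ℝ}, ContDiffOn ℝ ∞ g U → ContDiffOn ℝ ∞ h U → ∀ l,
      pd (bracket J g h) l z = -(∑ j, pd (fun y => pd g j y) l z * X h j)
        + (∑ j, pd (fun y => pd h j y) l z * X g j)
        + ∑ a, ∑ b, X g a * pd (fun y => Ω y a b) l z * X h b := by
    intro g h hg hh l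
    have dg := fun j => (contDiffAt_pd (sm hg) j).diff
    have dh := fun j => (contDiffAt_pd (sm hh) j).diff
    have dJ := fun i j => (hJsm z hz i j).diff
    have e1 : pd (bracket J g h) l z = ∑ j, ∑ k,
        ((pd (fun y => pd g j y) l z * J z j k + pd g j z * pd (fun y => J y j k) l z) * pd h k z
          + pd g j z * J z j k * pd (fun y => pd h k y) l z) := by
      unfold bracket
      rw [pd_sum _ fun j _ => DifferentiableAt.fun_sum fun k _ =>
        ((dg j).fun_mul (dJ j k)).fun_mul (dh k)]
      refine Finset.sum_congr rfl fun j _ => ?_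
      rw [pd_sum _ fun k _ => ((dg j).fun_mul (dJ j k)).fun_mul (dh k)]
      refine Finset.sum_congr rfl fun k _ => ?_
      rw [pd_mul ((dg j).fun_mul (dJ j k)) (dh k), pd_mul (dg j) (dJ j k)]
    -- The derivative of `J` is −J (∂Ω) J. Its sign is cancelled by the one from contracting `h` on
    -- the right, so ∂Ω is evaluated on the two Hamiltonian vectors with a plus sign.
    have e2 : ∑ j, ∑ k, pd g j z * pd (fun y => J y j k) l z * pd h k z
        = ∑ a, ∑ b, X g a * pd (fun y => Ω y a b) l z * X h b := by
      have h1 : ∀ (u v : ι → ℝ) (M : Matrix ι ι ℝ),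
          ∑ j, ∑ k, u j * M j k * v k = dotProduct u (M.mulVec v) := by
        intro u v M
        simp only [dotProduct, Matrix.mulVec, Finset.mul_sum, mul_assoc]
      have h2 := h1 (fun j => pd g j z) (fun k => pd h k z)
        (Matrix.of fun j k => pd (fun y => J y j k) l z)
      have h3 := h1 (X g) (X h) (Matrix.of fun j k => pd (fun y => Ω y j k) l z)
      simp only [Matrix.of_apply] at h2 h3
      rw [h2, h3, hJ, pd_inv hU hΩ hdet hz l, Matrix.neg_mulVec, ← Matrix.mulVec_mulVec,
        ← Matrix.mulVec_mulVec, hXr, Matrix.mulVec_neg, Matrix.mulVec_neg, dotProduct_neg,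
        dotProduct_neg, neg_neg, Matrix.dotProduct_mulVec]
    have e3 : ∑ j, ∑ k, pd (fun y => pd g j y) l z * J z j k * pd h k z
        = -(∑ j, pd (fun y => pd g j y) l z * X h j) := by
      rw [← Finset.sum_neg_distrib]
      refine Finset.sum_congr rfl fun j _ => ?_
      have := congrFun (hXr h) j
      simp only [Matrix.mulVec, dotProduct, Pi.neg_apply] at this
      simp only [mul_assoc, ← Finset.mul_sum, this, mul_neg]
    have e4 : ∑ j, ∑ k, pd g j z * J z j k * pd (fun y => pd h k y) l z
        = ∑ j, pd (fun y => pd h j y) l z * X g j := by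
      rw [Finset.sum_comm]
      refine Finset.sum_congr rfl fun j _ => ?_
      rw [← Finset.sum_mul, mul_comm]
      rfl
    rw [e1, ← e2, ← e3, ← e4]
    simp only [← Finset.sum_add_distrib]
    refine Finset.sum_congr rfl fun j _ => Finset.sum_congr rfl fun k _ => by ring
  have main : ∀ {f g h : (ι → ℝ) → ℝ}, ContDiffOn ℝ ∞ f U → ContDiffOn ℝ ∞ g U →
      ContDiffOn ℝ ∞ h U → bracket J f (bracket J g h) z
        = -(∑ l, ∑ j, X f l * pd (fun y => pd g j y) l z * X h j)
        + (∑ l, ∑ j, X f l * pd (fun y => pd h j y) l z * X g j)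
        + ∑ l, ∑ a, ∑ b, X f l * X g a * X h b * pd (fun y => Ω y a b) l z := by
    intro f g h hf hg hh
    rw [bracket_eq_dotProduct]
    simp only [key hg hh, mul_add, Finset.sum_add_distrib, mul_neg, Finset.sum_neg_distrib,
      Finset.mul_sum]
    refine congrArg₂ _ (congrArg₂ _ (congrArg _ ?_) ?_) ?_
    · exact Finset.sum_congr rfl fun j _ => Finset.sum_congr rfl fun k _ => by ring
    · exact Finset.sum_congr rfl fun j _ => Finset.sum_congr rfl fun k _ => by ring
    · exact Finset.sum_congr rfl fun j _ => Finset.sum_congr rfl fun k _ =>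
        Finset.sum_congr rfl fun k _ => by ring
  -- Each Hessian occurs twice in the cyclic sum, with opposite signs and its two vector arguments
  -- exchanged; symmetry of the Hessian makes the pairs cancel.
  have symm : ∀ {g : (ι → ℝ) → ℝ}, ContDiffOn ℝ ∞ g U → ∀ f h : (ι → ℝ) → ℝ,
      ∑ l, ∑ j, X f l * pd (fun y => pd g j y) l z * X h j
        = ∑ l, ∑ j, X h l * pd (fun y => pd g j y) l z * X f j := by
    intro g hg f h
    rw [Finset.sum_comm]
    refine Finset.sum_congr rfl fun j _ => Finset.sum_congr rfl fun k _ => ?_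
    rw [pd_pd_comm (sm hg) j k]
    ring
  -- After cyclic relabelling, the three terms have the common factor X_f X_g X_h, multiplied by the
  -- closedness expression.
  have cyc : (∑ l, ∑ a, ∑ b, X f l * X g a * X h b * pd (fun y => Ω y a b) l z)
      + (∑ l, ∑ a, ∑ b, X g l * X h a * X f b * pd (fun y => Ω y a b) l z)
      + (∑ l, ∑ a, ∑ b, X h l * X f a * X g b * pd (fun y => Ω y a b) l z) = 0 := by
    rw [sum_cyclic (fun l a b => X g l * X h a * X f b * pd (fun y => Ω y a b) l z),
      sum_cyclic (fun l a b => X h l * X f a * X g b * pd (fun y => Ω y a b) l z),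
      sum_cyclic (fun a b c => X h b * X f c * X g a * pd (fun y => Ω y c a) b z)]
    simp only [← Finset.sum_add_distrib]
    refine Finset.sum_eq_zero fun l _ => Finset.sum_eq_zero fun a _ =>
      Finset.sum_eq_zero fun b _ => ?_
    linear_combination X f l * X g a * X h b * hcl z hz l a b
  rw [main hf hg hh, main hg hh hf, main hh hf hg, symm hg h f, symm hh g f, symm hf h g]
  linarith [cyc]

end Poisson
end GuidingCenter

namespace GuidingCenter

/-! ### Tensor algebra in an orthonormal frame -/

section Frame

theorem eta_mul_eta : eta * eta = 1 := by
  ext i j; fin_cases i <;> fin_cases j <;> simp [eta]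

theorem eta_transpose : eta.transpose = eta := Matrix.diagonal_transpose _

/-- Transformation of the components of a second-rank tensor from the frame `E`. -/
def conj (E A : Ten) : Ten := E * A * E.transpose

variable {E : Ten}

/-- The hypothesis is orthonormality of the columns of `E`, the conclusion their completeness. They
agree because η Eᵀ η is a left inverse of the square matrix `E`, hence also a right inverse. -/
theorem mul_eta_mul_transpose (hE : E.transpose * eta * E = eta) :
    E * eta * E.transpose = eta := by
  have h1 : (eta * E.transpose * eta) * E = 1 := by
    rw [Matrix.mul_assoc, Matrix.mul_assoc, ← Matrix.mul_assoc E.transpose, hE, eta_mul_eta]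
  have h2 : E * (eta * E.transpose * eta) = 1 := mul_eq_one_comm.1 h1
  calc E * eta * E.transpose = E * (eta * E.transpose * eta) * eta := by
        simp only [Matrix.mul_assoc, eta_mul_eta, Matrix.mul_one]
    _ = eta := by rw [h2, Matrix.one_mul]

theorem eta_eq_conj (hE : E.transpose * eta * E = eta) : eta = conj E eta :=
  (mul_eta_mul_transpose hE).symm

/-- The metric between the two factors meets Eᵀ on one side and E on the other, and orthonormality
collapses the product to η. The companion lemmas for vectors, traces and dyads have the same
purpose: a tensor equation need only be checked on frame components. -/
theorem tdot_conj (hE : E.transpose * eta * E = eta) (A B : Ten) :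
    tdot (conj E A) (conj E B) = conj E (tdot A B) := by
  have : conj E A * eta * conj E B = E * A * (E.transpose * eta * E) * B * E.transpose := by
    simp only [conj, Matrix.mul_assoc]
  rw [tdot, this, hE]
  simp only [conj, tdot, Matrix.mul_assoc]

theorem transpose_conj (A : Ten) : (conj E A).transpose = conj E A.transpose := by
  simp [conj, Matrix.mul_assoc]

theorem conj_add (A B : Ten) : conj E A + conj E B = conj E (A + B) := by
  simp [conj, Matrix.mul_add, Matrix.add_mul]

theorem conj_sub (A B : Ten) : conj E A - conj E B = conj E (A - B) := by
  simp [conj, Matrix.mul_sub, Matrix.sub_mul]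

theorem conj_smul (r : ℝ) (A : Ten) : r • conj E A = conj E (r • A) := by
  simp [conj]

theorem conj_neg (A : Ten) : -conj E A = conj E (-A) := by
  simp [conj]

theorem dyad_conj (u v : Vec) : dyad (E.mulVec u) (E.mulVec v) = conj E (dyad u v) := by
  have h : ∀ u v : Vec, dyad u v = Matrix.vecMulVec u v := fun _ _ => rfl
  rw [h, h, conj, Matrix.mul_vecMulVec, Matrix.vecMulVec_mul, Matrix.vecMul_transpose]

theorem tvec_conj (hE : E.transpose * eta * E = eta) (A : Ten) (v : Vec) :
    tvec (conj E A) (E.mulVec v) = E.mulVec (tvec A v) := by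
  simp only [tvec, conj, Matrix.mulVec_mulVec]
  rw [show E * A * E.transpose * (eta * E) = E * A * (E.transpose * eta * E) by
    simp only [Matrix.mul_assoc], hE, Matrix.mul_assoc]

theorem vten_conj (hE : E.transpose * eta * E = eta) (A : Ten) (v : Vec) :
    vten (E.mulVec v) (conj E A) = E.mulVec (vten v A) := by
  rw [vten, transpose_conj]
  exact tvec_conj hE _ _

theorem vdot_eq (u v : Vec) : vdot u v = dotProduct u (eta.mulVec v) := by
  simp only [vdot, dotProduct, Matrix.mulVec, Finset.mul_sum, mul_assoc]

theorem vdot_conj (hE : E.transpose * eta * E = eta) (u v : Vec) :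
    vdot (E.mulVec u) (E.mulVec v) = vdot u v := by
  rw [vdot_eq, vdot_eq, Matrix.mulVec_mulVec, ← Matrix.vecMul_transpose,
    ← Matrix.dotProduct_mulVec, Matrix.mulVec_mulVec, ← Matrix.mul_assoc, hE]

theorem ddot_eq (A B : Ten) : ddot A B = (eta * A * eta * B.transpose).trace := by
  simp only [ddot, Matrix.trace, Matrix.diag, Matrix.mul_apply (N := B.transpose),
    Matrix.transpose_apply]

theorem ddot_conj (hE : E.transpose * eta * E = eta) (A B : Ten) :
    ddot (conj E A) (conj E B) = ddot A B := by
  rw [ddot_eq, ddot_eq, transpose_conj]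
  have : eta * conj E A * eta * conj E B.transpose
      = (eta * E) * (A * (E.transpose * eta * E) * B.transpose * E.transpose) := by
    simp only [conj, Matrix.mul_assoc]
  rw [this, hE, Matrix.trace_mul_comm]
  have : A * eta * B.transpose * E.transpose * (eta * E)
      = A * eta * B.transpose * (E.transpose * eta * E) := by
    simp only [Matrix.mul_assoc]
  rw [this, hE, Matrix.trace_mul_comm]
  simp only [Matrix.mul_assoc]

/-- The components of a tensor are found with the inverse frame η Eᵀ η. -/
theorem exists_eq_conj (hE : E.transpose * eta * E = eta) (A : Ten) : ∃ B, A = conj E B := by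
  refine ⟨conj (eta * E.transpose * eta) A, ?_⟩
  have h2 : E * (eta * E.transpose * eta) = 1 := by
    rw [← Matrix.mul_assoc, ← Matrix.mul_assoc, mul_eta_mul_transpose hE, eta_mul_eta]
  have h3 : (eta * E.transpose * eta).transpose * E.transpose = 1 := by
    rw [← Matrix.transpose_mul, h2, Matrix.transpose_one]
  rw [conj, conj, Matrix.mul_assoc, Matrix.mul_assoc, h3, Matrix.mul_one, ← Matrix.mul_assoc, h2,
    Matrix.one_mul]

theorem exists_eq_mulVec (hE : E.transpose * eta * E = eta) (v : Vec) :
    ∃ w, v = E.mulVec w := by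
  refine ⟨(eta * E.transpose * eta).mulVec v, ?_⟩
  rw [Matrix.mulVec_mulVec, ← Matrix.mul_assoc, ← Matrix.mul_assoc, mul_eta_mul_transpose hE,
    eta_mul_eta, Matrix.one_mulVec]

theorem conj_injective (hE : E.transpose * eta * E = eta) : Function.Injective (conj E) := by
  intro A B h
  have h1 : (eta * E.transpose * eta) * E = 1 := by
    rw [Matrix.mul_assoc, Matrix.mul_assoc, ← Matrix.mul_assoc E.transpose, hE, eta_mul_eta]
  have h3 : E.transpose * (eta * E.transpose * eta).transpose = 1 := by
    rw [← Matrix.transpose_mul, h1, Matrix.transpose_one]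
  have key : ∀ C, (eta * E.transpose * eta) * conj E C * (eta * E.transpose * eta).transpose
      = C := by
    intro C
    rw [conj, ← Matrix.mul_assoc, ← Matrix.mul_assoc, h1, Matrix.mul_assoc, h3, Matrix.one_mul,
      Matrix.mul_one]
  rw [← key A, h, key]

theorem mulVec_injective (hE : E.transpose * eta * E = eta) : Function.Injective E.mulVec := by
  intro u v h
  have h1 : (eta * E.transpose * eta) * E = 1 := by
    rw [Matrix.mul_assoc, Matrix.mul_assoc, ← Matrix.mul_assoc E.transpose, hE, eta_mul_eta]
  have := congrArg ((eta * E.transpose * eta).mulVec) h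
  simpa only [Matrix.mulVec_mulVec, h1, Matrix.one_mulVec] using this

theorem eq_of_antisymm {A : Ten} (hA : A.transpose = -A) :
    A = !![0, A 0 1, A 0 2, A 0 3; -A 0 1, 0, A 1 2, A 1 3;
      -A 0 2, -A 1 2, 0, A 2 3; -A 0 3, -A 1 3, -A 2 3, 0] := by
  have h : ∀ i j, A j i = -A i j := fun i j => congrFun (congrFun hA i) j
  ext i j
  fin_cases i <;> fin_cases j <;> simp <;>
    first | exact h _ _ | exact self_eq_neg.1 (h _ _)

/-- Components of `F₀` in the frame `t̂, b̂, ĉ, â`. -/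
def frameF (l : ℝ) : Ten := !![0, 0, 0, 0; 0, 0, 0, 0; 0, 0, 0, l; 0, 0, -l, 0]

/-- Components of `𝓕₀` in the frame `t̂, b̂, ĉ, â`. -/
def frameDual (l : ℝ) : Ten := !![0, -l, 0, 0; l, 0, 0, 0; 0, 0, 0, 0; 0, 0, 0, 0]

section Explicit

theorem eta_explicit : eta = !![-1, 0, 0, 0; 0, 1, 0, 0; 0, 0, 1, 0; 0, 0, 0, 1] := by
  ext i j; fin_cases i <;> fin_cases j <;> simp [eta]

variable (m q c ε l K Y a₀₁ a₀₂ a₀₃ a₁₂ a₁₃ : ℝ)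

/-- Components of an antisymmetric tensor `A` with `Y = 1 + ε F₀ : A / (2 λ²)`. -/
noncomputable def frameA : Ten := !![0, a₀₁, a₀₂, a₀₃; -a₀₁, 0, a₁₂, a₁₃;
  -a₀₂, -a₁₂, 0, l * (Y - 1) / ε; -a₀₃, -a₁₃, -(l * (Y - 1) / ε), 0]

end Explicit
end Frame

/-! ### Arithmetic of 4 × 4 tensors with literal entries -/

section Components

/-- This and the following formulas are rewriting rules that keep literal matrices literal. A
compound tensor expression is thereby evaluated to one literal matrix, after which `explicit_ext`
leaves sixteen scalar goals. -/
theorem tdot_explicit (a00 a01 a02 a03 a10 a11 a12 a13 a20 a21 a22 a23 a30 a31 a32 a33 b00 b01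
      b02 b03 b10 b11 b12 b13 b20 b21 b22 b23 b30 b31 b32 b33 : ℝ) :
    tdot !![a00, a01, a02, a03; a10, a11, a12, a13; a20, a21, a22, a23; a30, a31, a32, a33]
      !![b00, b01, b02, b03; b10, b11, b12, b13; b20, b21, b22, b23; b30, b31, b32, b33] =
      !![-a00 * b00 + a01 * b10 + a02 * b20 + a03 * b30, -a00 * b01 + a01 * b11 + a02 * b21 +
      a03 * b31, -a00 * b02 + a01 * b12 + a02 * b22 + a03 * b32, -a00 * b03 + a01 * b13 + a02 *
      b23 + a03 * b33; -a10 * b00 + a11 * b10 + a12 * b20 + a13 * b30, -a10 * b01 + a11 * b11 +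
      a12 * b21 + a13 * b31, -a10 * b02 + a11 * b12 + a12 * b22 + a13 * b32, -a10 * b03 + a11 *
      b13 + a12 * b23 + a13 * b33; -a20 * b00 + a21 * b10 + a22 * b20 + a23 * b30, -a20 * b01 +
      a21 * b11 + a22 * b21 + a23 * b31, -a20 * b02 + a21 * b12 + a22 * b22 + a23 * b32, -a20 *
      b03 + a21 * b13 + a22 * b23 + a23 * b33; -a30 * b00 + a31 * b10 + a32 * b20 + a33 * b30,
      -a30 * b01 + a31 * b11 + a32 * b21 + a33 * b31, -a30 * b02 + a31 * b12 + a32 * b22 + a33 *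
      b32, -a30 * b03 + a31 * b13 + a32 * b23 + a33 * b33] := by
  ext i j
  fin_cases i <;> fin_cases j <;> simp [tdot, eta_explicit] <;> ring

theorem add_explicit (a00 a01 a02 a03 a10 a11 a12 a13 a20 a21 a22 a23 a30 a31 a32 a33 b00 b01
      b02 b03 b10 b11 b12 b13 b20 b21 b22 b23 b30 b31 b32 b33 : ℝ) :
    !![a00, a01, a02, a03; a10, a11, a12, a13; a20, a21, a22, a23; a30, a31, a32, a33]
      + !![b00, b01, b02, b03; b10, b11, b12, b13; b20, b21, b22, b23; b30, b31, b32, b33] =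
      !![a00 + b00, a01 + b01, a02 + b02, a03 + b03; a10 + b10, a11 + b11, a12 + b12, a13 + b13;
      a20 + b20, a21 + b21, a22 + b22, a23 + b23; a30 + b30, a31 + b31, a32 + b32, a33 + b33] :=
      by
  ext i j
  fin_cases i <;> fin_cases j <;> simp

theorem sub_explicit (a00 a01 a02 a03 a10 a11 a12 a13 a20 a21 a22 a23 a30 a31 a32 a33 b00 b01
      b02 b03 b10 b11 b12 b13 b20 b21 b22 b23 b30 b31 b32 b33 : ℝ) :
    !![a00, a01, a02, a03; a10, a11, a12, a13; a20, a21, a22, a23; a30, a31, a32, a33]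
      - !![b00, b01, b02, b03; b10, b11, b12, b13; b20, b21, b22, b23; b30, b31, b32, b33] =
      !![a00 - b00, a01 - b01, a02 - b02, a03 - b03; a10 - b10, a11 - b11, a12 - b12, a13 - b13;
      a20 - b20, a21 - b21, a22 - b22, a23 - b23; a30 - b30, a31 - b31, a32 - b32, a33 - b33] :=
      by
  ext i j
  fin_cases i <;> fin_cases j <;> simp

theorem smul_explicit (r a00 a01 a02 a03 a10 a11 a12 a13 a20 a21 a22 a23 a30 a31 a32 a33 : ℝ) :
    r • !![a00, a01, a02, a03; a10, a11, a12, a13; a20, a21, a22, a23; a30, a31, a32, a33] =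
      !![r * a00, r * a01, r * a02, r * a03; r * a10, r * a11, r * a12, r * a13; r * a20, r *
      a21, r * a22, r * a23; r * a30, r * a31, r * a32, r * a33] := by
  ext i j
  fin_cases i <;> fin_cases j <;> simp

theorem neg_explicit (a00 a01 a02 a03 a10 a11 a12 a13 a20 a21 a22 a23 a30 a31 a32 a33 : ℝ) :
    -!![a00, a01, a02, a03; a10, a11, a12, a13; a20, a21, a22, a23; a30, a31, a32, a33] =
      !![-a00, -a01, -a02, -a03; -a10, -a11, -a12, -a13; -a20, -a21, -a22, -a23; -a30, -a31,
      -a32, -a33] := by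
  ext i j
  fin_cases i <;> fin_cases j <;> simp

theorem transpose_explicit (a00 a01 a02 a03 a10 a11 a12 a13 a20 a21 a22 a23 a30 a31 a32 a33 : ℝ) :
    Matrix.transpose !![a00, a01, a02, a03; a10, a11, a12, a13; a20, a21, a22, a23; a30, a31,
      a32, a33] =
      !![a00, a10, a20, a30; a01, a11, a21, a31; a02, a12, a22, a32; a03, a13, a23, a33] := by
  ext i j
  fin_cases i <;> fin_cases j <;> simp

theorem dyad_explicit (u0 u1 u2 u3 v0 v1 v2 v3 : ℝ) :
    dyad ![u0, u1, u2, u3] ![v0, v1, v2, v3] =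
      !![u0 * v0, u0 * v1, u0 * v2, u0 * v3; u1 * v0, u1 * v1, u1 * v2, u1 * v3; u2 * v0, u2 *
      v1, u2 * v2, u2 * v3; u3 * v0, u3 * v1, u3 * v2, u3 * v3] := by
  ext i j
  fin_cases i <;> fin_cases j <;> simp [dyad]

theorem tvec_explicit (a00 a01 a02 a03 a10 a11 a12 a13 a20 a21 a22 a23 a30 a31 a32 a33 v0 v1 v2
      v3 : ℝ) :
    tvec !![a00, a01, a02, a03; a10, a11, a12, a13; a20, a21, a22, a23; a30, a31, a32, a33]
      ![v0, v1, v2, v3] =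
      ![-a00 * v0 + a01 * v1 + a02 * v2 + a03 * v3, -a10 * v0 + a11 * v1 + a12 * v2 + a13 * v3,
      -a20 * v0 + a21 * v1 + a22 * v2 + a23 * v3, -a30 * v0 + a31 * v1 + a32 * v2 + a33 * v3] :=
      by
  ext i
  fin_cases i <;> simp [tvec, Matrix.mulVec, dotProduct, Fin.sum_univ_four, eta_explicit]

theorem vten_explicit (a00 a01 a02 a03 a10 a11 a12 a13 a20 a21 a22 a23 a30 a31 a32 a33 v0 v1 v2
      v3 : ℝ) :
    vten ![v0, v1, v2, v3] !![a00, a01, a02, a03; a10, a11, a12, a13; a20, a21, a22, a23; a30,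
      a31, a32, a33] =
      ![-v0 * a00 + v1 * a10 + v2 * a20 + v3 * a30, -v0 * a01 + v1 * a11 + v2 * a21 + v3 * a31,
      -v0 * a02 + v1 * a12 + v2 * a22 + v3 * a32, -v0 * a03 + v1 * a13 + v2 * a23 + v3 * a33] :=
      by
  ext i
  fin_cases i <;> simp [vten, Matrix.mulVec, dotProduct, Fin.sum_univ_four, eta_explicit] <;> ring

theorem vdot_explicit (u0 u1 u2 u3 v0 v1 v2 v3 : ℝ) :
    vdot ![u0, u1, u2, u3] ![v0, v1, v2, v3] =
      -u0 * v0 + u1 * v1 + u2 * v2 + u3 * v3 := by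
  simp [vdot, eta_explicit, Fin.sum_univ_four]

theorem ddot_explicit (a00 a01 a02 a03 a10 a11 a12 a13 a20 a21 a22 a23 a30 a31 a32 a33 b00 b01
      b02 b03 b10 b11 b12 b13 b20 b21 b22 b23 b30 b31 b32 b33 : ℝ) :
    ddot !![a00, a01, a02, a03; a10, a11, a12, a13; a20, a21, a22, a23; a30, a31, a32, a33]
      !![b00, b01, b02, b03; b10, b11, b12, b13; b20, b21, b22, b23; b30, b31, b32, b33] =
      a00 * b00 - a01 * b01 - a02 * b02 - a03 * b03 - a10 * b10 + a11 * b11 + a12 * b12 + a13 *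
      b13 - a20 * b20 + a21 * b21 + a22 * b22 + a23 * b23 - a30 * b30 + a31 * b31 + a32 * b32 +
      a33 * b33 := by
  simp [ddot, eta_explicit, Fin.sum_univ_four]
  ring

theorem smul_vec_explicit (r u0 u1 u2 u3 : ℝ) :
    (r • ![u0, u1, u2, u3] : Vec) = ![r * u0, r * u1, r * u2, r * u3] := by
  ext i; fin_cases i <;> simp

theorem add_vec_explicit (u0 u1 u2 u3 v0 v1 v2 v3 : ℝ) :
    (![u0, u1, u2, u3] + ![v0, v1, v2, v3] : Vec) = ![u0 + v0, u1 + v1, u2 + v2, u3 + v3] := by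
  ext i; fin_cases i <;> simp

theorem explicit_ext {a00 a01 a02 a03 a10 a11 a12 a13 a20 a21 a22 a23 a30 a31 a32 a33
    b00 b01 b02 b03 b10 b11 b12 b13 b20 b21 b22 b23 b30 b31 b32 b33 : ℝ}
    (h00 : a00 = b00) (h01 : a01 = b01) (h02 : a02 = b02) (h03 : a03 = b03)
    (h10 : a10 = b10) (h11 : a11 = b11) (h12 : a12 = b12) (h13 : a13 = b13)
    (h20 : a20 = b20) (h21 : a21 = b21) (h22 : a22 = b22) (h23 : a23 = b23)
    (h30 : a30 = b30) (h31 : a31 = b31) (h32 : a32 = b32) (h33 : a33 = b33) :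
    !![a00, a01, a02, a03; a10, a11, a12, a13; a20, a21, a22, a23; a30, a31, a32, a33]
      = !![b00, b01, b02, b03; b10, b11, b12, b13; b20, b21, b22, b23; b30, b31, b32, b33] := by
  simp only [h00, h01, h02, h03, h10, h11, h12, h13, h20, h21, h22, h23, h30, h31, h32, h33]

end Components

end GuidingCenter

/-! ### The bracket identities in frame components -/

namespace GuidingCenter
set_option linter.unusedSimpArgs false
set_option linter.unusedVariables false

/-- The block of ΩJ = 1 with both indices spacetime indices, where t̂ and b̂ are the first two basis
vectors. `A` stands for F'', `Y` for Υ, and q l/(m c) is the gyrofrequency written out. The next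
lemmas supply the columns of K and 𝓑 in the spacetime rows, and the contractions with t̂ and b̂ that
the rows of K and 𝓑 use. -/
theorem frame_RR (m q c ε l K Y a₀₁ a₀₂ a₀₃ a₁₂ a₁₃ : ℝ) (hm : m ≠ 0) (hq : q ≠ 0) (hc : c ≠ 0)
    (hε : ε ≠ 0) (hl : l ≠ 0) (hK : K ≠ 0) (hY : Y ≠ 0) (A Ξ : Ten)
    (hA : A = frameA ε l Y a₀₁ a₀₂ a₀₃ a₁₂ a₁₃)
    (hX : Ξ = eta + (ε / (l ^ 2 * Y)) • (A ⊡ frameF l)) :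
    ((q / (ε * c)) • (frameF l + ε • A)) ⊡ (-(ε / (m * l * (q * l / (m * c)) * Y)) • frameF l)
      + m • dyad ![1, 0, 0, 0] (-(1 / m) • vten ![1, 0, 0, 0] Ξ)
      + (m * K) • dyad ![0, 1, 0, 0] ((1 / (m * K)) • vten ![0, 1, 0, 0] Ξ) = eta := by
  subst hX hA
  simp only [frameA, frameF, frameDual, eta_explicit, tdot_explicit, add_explicit, sub_explicit,
    smul_explicit, neg_explicit, transpose_explicit, vten_explicit, tvec_explicit, vdot_explicit,
    ddot_explicit, dyad_explicit, smul_vec_explicit, add_vec_explicit, mul_zero,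
    zero_mul, add_zero, zero_add, sub_zero, neg_zero, mul_one, one_mul, zero_sub]
  apply explicit_ext <;> field_simp <;> ring

theorem frame_RK (m q c ε l K Y a₀₁ a₀₂ a₀₃ a₁₂ a₁₃ : ℝ) (hm : m ≠ 0) (hq : q ≠ 0) (hc : c ≠ 0)
    (hε : ε ≠ 0) (hl : l ≠ 0) (hK : K ≠ 0) (hY : Y ≠ 0) (A Ξ : Ten)
    (hA : A = frameA ε l Y a₀₁ a₀₂ a₀₃ a₁₂ a₁₃)
    (hX : Ξ = eta + (ε / (l ^ 2 * Y)) • (A ⊡ frameF l)) :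
    tvec ((q / (ε * c)) • (frameF l + ε • A)) (-(1 / m) • vten ![1, 0, 0, 0] Ξ)
      + (m * K * (-(q / (m ^ 2 * c * K)) * vdot (vten ![1, 0, 0, 0] (Ξ ⊡ A)) ![0, 1, 0, 0])) •
        (![0, 1, 0, 0] : Vec) = ![0, 0, 0, 0] := by
  subst hX hA
  simp only [frameA, frameF, frameDual, eta_explicit, tdot_explicit, add_explicit, sub_explicit,
    smul_explicit, neg_explicit, transpose_explicit, vten_explicit, tvec_explicit, vdot_explicit,
    ddot_explicit, dyad_explicit, smul_vec_explicit, add_vec_explicit, mul_zero,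
    zero_mul, add_zero, zero_add, sub_zero, neg_zero, mul_one, one_mul, zero_sub]
  congr! 1 <;> [skip; congr! 1 <;> [skip; congr! 1 <;> [skip; congr! 1]]] <;> field_simp <;> ring

theorem frame_RB (m q c ε l K Y a₀₁ a₀₂ a₀₃ a₁₂ a₁₃ : ℝ) (hm : m ≠ 0) (hq : q ≠ 0) (hc : c ≠ 0)
    (hε : ε ≠ 0) (hl : l ≠ 0) (hK : K ≠ 0) (hY : Y ≠ 0) (A Ξ : Ten)
    (hA : A = frameA ε l Y a₀₁ a₀₂ a₀₃ a₁₂ a₁₃)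
    (hX : Ξ = eta + (ε / (l ^ 2 * Y)) • (A ⊡ frameF l)) :
    tvec ((q / (ε * c)) • (frameF l + ε • A)) ((1 / (m * K)) • vten ![0, 1, 0, 0] Ξ)
      + (-(m * (-(q / (m ^ 2 * c * K)) * vdot (vten ![1, 0, 0, 0] (Ξ ⊡ A)) ![0, 1, 0, 0]))) •
        (![1, 0, 0, 0] : Vec) = ![0, 0, 0, 0] := by
  subst hX hA
  simp only [frameA, frameF, frameDual, eta_explicit, tdot_explicit, add_explicit, sub_explicit,
    smul_explicit, neg_explicit, transpose_explicit, vten_explicit, tvec_explicit, vdot_explicit,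
    ddot_explicit, dyad_explicit, smul_vec_explicit, add_vec_explicit, mul_zero,
    zero_mul, add_zero, zero_add, sub_zero, neg_zero, mul_one, one_mul, zero_sub]
  congr! 1 <;> [skip; congr! 1 <;> [skip; congr! 1 <;> [skip; congr! 1]]] <;> field_simp <;> ring

theorem frame_vdot (m q c ε l K Y a₀₁ a₀₂ a₀₃ a₁₂ a₁₃ : ℝ) (hm : m ≠ 0) (hq : q ≠ 0) (hc : c ≠ 0)
    (hε : ε ≠ 0) (hl : l ≠ 0) (hK : K ≠ 0) (hY : Y ≠ 0) (A Ξ : Ten)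
    (hA : A = frameA ε l Y a₀₁ a₀₂ a₀₃ a₁₂ a₁₃)
    (hX : Ξ = eta + (ε / (l ^ 2 * Y)) • (A ⊡ frameF l)) :
    vdot ![1, 0, 0, 0] (-(1 / m) • vten ![1, 0, 0, 0] Ξ) = 1 / m
      ∧ vdot ![1, 0, 0, 0] ((1 / (m * K)) • vten ![0, 1, 0, 0] Ξ) = 0
      ∧ vdot ![0, 1, 0, 0] (-(1 / m) • vten ![1, 0, 0, 0] Ξ) = 0
      ∧ vdot ![0, 1, 0, 0] ((1 / (m * K)) • vten ![0, 1, 0, 0] Ξ) = 1 / (m * K) := by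
  subst hX hA
  simp only [frameA, frameF, frameDual, eta_explicit, tdot_explicit, add_explicit, sub_explicit,
    smul_explicit, neg_explicit, transpose_explicit, vten_explicit, tvec_explicit, vdot_explicit,
    ddot_explicit, dyad_explicit, smul_vec_explicit, add_vec_explicit, mul_zero,
    zero_mul, add_zero, zero_add, sub_zero, neg_zero, mul_one, one_mul, zero_sub]
  refine ⟨?_, ?_, ?_, ?_⟩ <;> simp

theorem frame_vten (m q c ε l K Y a₀₁ a₀₂ a₀₃ a₁₂ a₁₃ : ℝ) (hm : m ≠ 0) (hq : q ≠ 0) (hc : c ≠ 0)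
    (hε : ε ≠ 0) (hl : l ≠ 0) (hK : K ≠ 0) (hY : Y ≠ 0) (A Ξ : Ten)
    (hA : A = frameA ε l Y a₀₁ a₀₂ a₀₃ a₁₂ a₁₃)
    (hX : Ξ = eta + (ε / (l ^ 2 * Y)) • (A ⊡ frameF l)) :
    vten ![1, 0, 0, 0] (-(ε / (m * l * (q * l / (m * c)) * Y)) • frameF l) = ![0, 0, 0, 0]
      ∧ vten ![0, 1, 0, 0] (-(ε / (m * l * (q * l / (m * c)) * Y)) • frameF l) = ![0, 0, 0, 0] := by
  subst hX hA
  simp only [frameA, frameF, frameDual, eta_explicit, tdot_explicit, add_explicit, sub_explicit,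
    smul_explicit, neg_explicit, transpose_explicit, vten_explicit, tvec_explicit, vdot_explicit,
    ddot_explicit, dyad_explicit, smul_vec_explicit, add_vec_explicit, mul_zero,
    zero_mul, add_zero, zero_add, sub_zero, neg_zero, mul_one, one_mul, zero_sub]
  refine ⟨?_, ?_⟩ <;> trivial

-- The left side is the chain-rule value of {R, U} for U = K t̂, the right side the invariant
-- formula. `T` is ∇t̂, whose t̂-column vanishes because t̂ is a unit vector; `D` is ∇P_∥ · U, which
-- is K T without its b̂-column x; and `A'` is F''', from which x has likewise been removed. The
-- content is that the gauge-dependent x cancels.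
set_option maxHeartbeats 2000000 in
theorem frame_RU (m q c ε l K Y a₀₁ a₀₂ a₀₃ a₁₂ a₁₃ : ℝ) (hm : m ≠ 0) (hq : q ≠ 0) (hc : c ≠ 0)
    (hε : ε ≠ 0) (hl : l ≠ 0) (hK : K ≠ 0) (hY : Y ≠ 0) (A Ξ : Ten)
    (hA : A = frameA ε l Y a₀₁ a₀₂ a₀₃ a₁₂ a₁₃)
    (hX : Ξ = eta + (ε / (l ^ 2 * Y)) • (A ⊡ frameF l))
    (x₀ x₁ x₂ x₃ y₀ y₁ y₂ y₃ w₀ w₁ w₂ w₃ : ℝ) (T D A' Ξ' P : Ten)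
    (hT : T = !![0, x₀, y₀, w₀; 0, x₁, y₁, w₁; 0, x₂, y₂, w₂; 0, x₃, y₃, w₃])
    (hD : D = K • !![0, 0, y₀, w₀; 0, 0, y₁, w₁; 0, 0, y₂, w₂; 0, 0, y₃, w₃])
    (hA' : A' = A - (m * c * K / q) • (dyad ![x₀, x₁, x₂, x₃] ![0, 1, 0, 0]
      - dyad ![0, 1, 0, 0] ![x₀, x₁, x₂, x₃]))
    (hX' : Ξ' = eta + (ε / (l ^ 2 * Y)) • (A' ⊡ frameF l))
    (hP : P = eta + (l ^ 2)⁻¹ • (frameF l ⊡ frameF l)) :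
    (-(ε / (m * l * (q * l / (m * c)) * Y)) • frameF l) ⊡ (K • T)
      + (dyad (-(1 / m) • vten ![1, 0, 0, 0] Ξ) ![1, 0, 0, 0]
        + K • dyad ((1 / (m * K)) • vten ![0, 1, 0, 0] Ξ) ![0, 1, 0, 0])
      = (1 / m) • P + (ε / (m * l ^ 2 * Y)) • (frameF l ⊡ (A' ⊡ P - (m * c / q) • D)) := by
  subst hX' hP hA' hX hA hT hD
  simp only [frameA, frameF, frameDual, eta_explicit, tdot_explicit, add_explicit, sub_explicit,
    smul_explicit, neg_explicit, transpose_explicit, vten_explicit, tvec_explicit, vdot_explicit,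
    ddot_explicit, dyad_explicit, smul_vec_explicit, add_vec_explicit, mul_zero,
    zero_mul, add_zero, zero_add, sub_zero, neg_zero, mul_one, one_mul, zero_sub]
  apply explicit_ext <;> field_simp <;> ring

-- The analogue for {U, U}. The bracket {K, 𝓑} contributes a multiple of t̂b̂ − b̂t̂, which is
-- proportional to 𝓕₀; the terms in x combine with it to replace F'' by F''' in its coefficient.
set_option maxHeartbeats 2000000 in
theorem frame_UU (m q c ε l K Y a₀₁ a₀₂ a₀₃ a₁₂ a₁₃ : ℝ) (hm : m ≠ 0) (hq : q ≠ 0) (hc : c ≠ 0)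
    (hε : ε ≠ 0) (hl : l ≠ 0) (hK : K ≠ 0) (hY : Y ≠ 0) (A Ξ : Ten)
    (hA : A = frameA ε l Y a₀₁ a₀₂ a₀₃ a₁₂ a₁₃)
    (hX : Ξ = eta + (ε / (l ^ 2 * Y)) • (A ⊡ frameF l))
    (x₀ x₁ x₂ x₃ y₀ y₁ y₂ y₃ w₀ w₁ w₂ w₃ : ℝ) (T D A' Ξ' P : Ten)
    (hT : T = !![0, x₀, y₀, w₀; 0, x₁, y₁, w₁; 0, x₂, y₂, w₂; 0, x₃, y₃, w₃])
    (hD : D = K • !![0, 0, y₀, w₀; 0, 0, y₁, w₁; 0, 0, y₂, w₂; 0, 0, y₃, w₃])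
    (hA' : A' = A - (m * c * K / q) • (dyad ![x₀, x₁, x₂, x₃] ![0, 1, 0, 0]
      - dyad ![0, 1, 0, 0] ![x₀, x₁, x₂, x₃]))
    (hX' : Ξ' = eta + (ε / (l ^ 2 * Y)) • (A' ⊡ frameF l))
    (hP : P = eta + (l ^ 2)⁻¹ • (frameF l ⊡ frameF l)) :
    (K • T).transpose ⊡ (-(ε / (m * l * (q * l / (m * c)) * Y)) • frameF l) ⊡ (K • T)
      + ((K • T).transpose ⊡ (dyad (-(1 / m) • vten ![1, 0, 0, 0] Ξ) ![1, 0, 0, 0]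
        + K • dyad ((1 / (m * K)) • vten ![0, 1, 0, 0] Ξ) ![0, 1, 0, 0])
        - (dyad (-(1 / m) • vten ![1, 0, 0, 0] Ξ) ![1, 0, 0, 0]
        + K • dyad ((1 / (m * K)) • vten ![0, 1, 0, 0] Ξ) ![0, 1, 0, 0]).transpose ⊡ (K • T))
      + (K * (-(q / (m ^ 2 * c * K)) * vdot (vten ![1, 0, 0, 0] (Ξ ⊡ A)) ![0, 1, 0, 0])) •
        (dyad ![1, 0, 0, 0] ![0, 1, 0, 0] - dyad ![0, 1, 0, 0] ![1, 0, 0, 0])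
      = -(q * l / (m * c) / (2 * m * l ^ 3) * ddot (frameDual l) (A' ⊡ Ξ'.transpose)) • frameDual l
        - (1 / m) • (P ⊡ Ξ' ⊡ D - D.transpose ⊡ Ξ'.transpose ⊡ P)
        - (ε / (m * l * (q * l / (m * c)) * Y)) • (D.transpose ⊡ frameF l ⊡ D) := by
  subst hX' hP hA' hX hA hT hD
  simp only [frameA, frameF, frameDual, eta_explicit, tdot_explicit, add_explicit, sub_explicit,
    smul_explicit, neg_explicit, transpose_explicit, vten_explicit, tvec_explicit, vdot_explicit,
    ddot_explicit, dyad_explicit, smul_vec_explicit, add_vec_explicit, mul_zero,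
    zero_mul, add_zero, zero_add, sub_zero, neg_zero, mul_one, one_mul, zero_sub]
  apply explicit_ext <;> field_simp <;> ring

end GuidingCenter

/-! ### Smoothness of component fields, and the adapted frame -/

namespace GuidingCenter

section Smooth

variable {ι κ : Type} [Fintype ι] [Fintype κ]

/-- All components of a vector field are smooth at a point. -/
def SmV (V : (ι → ℝ) → Vec) (z : ι → ℝ) : Prop := ∀ μ, ContDiffAt ℝ ∞ (fun y => V y μ) z

/-- All components of a tensor field are smooth at a point. -/
def SmT (M : (ι → ℝ) → Ten) (z : ι → ℝ) : Prop :=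
  ∀ μ ν, ContDiffAt ℝ ∞ (fun y => M y μ ν) z

variable {z : ι → ℝ} {M N : (ι → ℝ) → Ten} {V W : (ι → ℝ) → Vec} {r : (ι → ℝ) → ℝ}

theorem SmT.const (A : Ten) : SmT (fun _ => A) z := fun _ _ => contDiffAt_const

theorem SmT.add (hM : SmT M z) (hN : SmT N z) : SmT (fun y => M y + N y) z :=
  fun μ ν => (hM μ ν).add (hN μ ν)

theorem SmT.sub (hM : SmT M z) (hN : SmT N z) : SmT (fun y => M y - N y) z :=
  fun μ ν => (hM μ ν).sub (hN μ ν)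

theorem SmT.neg (hM : SmT M z) : SmT (fun y => -M y) z := fun μ ν => (hM μ ν).neg

theorem SmT.smul (hr : ContDiffAt ℝ ∞ r z) (hM : SmT M z) : SmT (fun y => r y • M y) z :=
  fun μ ν => hr.mul (hM μ ν)

theorem SmT.transpose (hM : SmT M z) : SmT (fun y => (M y).transpose) z := fun μ ν => hM ν μ

theorem SmT.mul (hM : SmT M z) (hN : SmT N z) : SmT (fun y => M y * N y) z := by
  intro μ ν
  simp only [Matrix.mul_apply]
  exact ContDiffAt.sum fun σ _ => (hM μ σ).mul (hN σ ν)

theorem SmT.tdot (hM : SmT M z) (hN : SmT N z) : SmT (fun y => M y ⊡ N y) z :=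
  (hM.mul (SmT.const eta)).mul hN

theorem SmV.mulVec (hM : SmT M z) (hV : SmV V z) : SmV (fun y => (M y).mulVec (V y)) z :=
  fun μ => by
    simp only [Matrix.mulVec, dotProduct]
    exact ContDiffAt.sum fun σ _ => (hM μ σ).mul (hV σ)

theorem SmV.tvec (hM : SmT M z) (hV : SmV V z) : SmV (fun y => tvec (M y) (V y)) z :=
  SmV.mulVec hM (SmV.mulVec (SmT.const eta) hV)

theorem SmV.smul (hr : ContDiffAt ℝ ∞ r z) (hV : SmV V z) : SmV (fun y => r y • V y) z :=
  fun μ => hr.mul (hV μ)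

theorem SmV.add (hV : SmV V z) (hW : SmV W z) : SmV (fun y => V y + W y) z :=
  fun μ => (hV μ).add (hW μ)

theorem SmV.sub (hV : SmV V z) (hW : SmV W z) : SmV (fun y => V y - W y) z :=
  fun μ => (hV μ).sub (hW μ)

theorem SmT.dyad (hV : SmV V z) (hW : SmV W z) : SmT (fun y => dyad (V y) (W y)) z :=
  fun μ ν => (hV μ).mul (hW ν)

theorem contDiffAt_vdot (hV : SmV V z) (hW : SmV W z) :
    ContDiffAt ℝ ∞ (fun y => vdot (V y) (W y)) z :=
  ContDiffAt.sum fun μ _ => ContDiffAt.sum fun ν _ =>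
    ((hV μ).mul contDiffAt_const).mul (hW ν)

theorem contDiffAt_ddot (hM : SmT M z) (hN : SmT N z) :
    ContDiffAt ℝ ∞ (fun y => ddot (M y) (N y)) z := by
  have h := ((SmT.const (z := z) eta).mul hM).mul (SmT.const eta)
  exact ContDiffAt.sum fun μ _ => ContDiffAt.sum fun ν _ => (h μ ν).mul (hN μ ν)

theorem SmT.comp {φ : (κ → ℝ) → ι → ℝ} {y : κ → ℝ} (hM : SmT M (φ y))
    (hφ : ContDiffAt ℝ ∞ φ y) : SmT (fun w => M (φ w)) y :=
  fun μ ν => ContDiffAt.comp y (hM μ ν) hφ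

theorem SmV.comp {φ : (κ → ℝ) → ι → ℝ} {y : κ → ℝ} (hV : SmV V (φ y))
    (hφ : ContDiffAt ℝ ∞ φ y) : SmV (fun w => V (φ w)) y :=
  fun μ => ContDiffAt.comp y (hV μ) hφ

theorem SmT.congr (hM : SmT M z) (h : ∀ᶠ y in nhds z, N y = M y) : SmT N z :=
  fun μ ν => (hM μ ν).congr_of_eventuallyEq (h.mono fun y hy => by simp only [hy])

theorem SmT.grad {V : Vec → Vec} {x : Vec} (hV : SmV V x) : SmT (grad V) x :=
  (SmT.const eta).mul (M := fun _ => eta) fun σ ν => contDiffAt_pd (hV ν) σ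

end Smooth

section Vector

theorem vdot_add_left (u v w : Vec) : vdot (u + v) w = vdot u w + vdot v w := by
  simp [vdot_eq]

theorem vdot_smul_left (r : ℝ) (u w : Vec) : vdot (r • u) w = r * vdot u w := by
  simp [vdot_eq]

theorem vdot_sub_left (u v w : Vec) : vdot (u - v) w = vdot u w - vdot v w := by
  simp [vdot_eq]

theorem vdot_comm (u v : Vec) : vdot u v = vdot v u := by
  rw [vdot_eq, vdot_eq, Matrix.dotProduct_mulVec, ← Matrix.mulVec_transpose, eta_transpose,
    dotProduct_comm]

theorem vdot_add_right (u v w : Vec) : vdot w (u + v) = vdot w u + vdot w v := by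
  rw [vdot_comm, vdot_add_left, vdot_comm u, vdot_comm v]

theorem vdot_smul_right (r : ℝ) (u w : Vec) : vdot w (r • u) = r * vdot w u := by
  rw [vdot_comm, vdot_smul_left, vdot_comm u]

theorem vdot_sub_right (u v w : Vec) : vdot w (u - v) = vdot w u - vdot w v := by
  rw [vdot_comm, vdot_sub_left, vdot_comm u, vdot_comm v]

/-- The vector is frozen under the gradient, so the result is linear in it, with the partial
derivatives of `P` as coefficients. -/
theorem gradDot_apply {P : Vec → Ten} {x : Vec} (hP : SmT P x) (v : Vec) (μ ν : Fin 4) :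
    gradDot P v x μ ν = ∑ σ, eta μ σ * ∑ τ, pd (fun y => P y ν τ) σ x * eta.mulVec v τ := by
  simp only [gradDot, grad, Matrix.mul_apply, Matrix.of_apply]
  refine Finset.sum_congr rfl fun σ _ => congrArg _ ?_
  have h : ∀ y, tvec (P y) v ν = ∑ τ, P y ν τ * eta.mulVec v τ := fun _ => rfl
  simp only [h]
  rw [pd_sum _ fun τ _ => (hP ν τ).diff.mul_const _]
  exact Finset.sum_congr rfl fun τ _ => pd_mul_const _ (hP ν τ).diff σ

end Vector

namespace Data

variable {S : Data} {O : Set Vec}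

/-- The tetrad as a matrix whose columns are `ê₀, ê₁, ê₂, ê₃`. -/
def tetrad (S : Data) (x : Vec) : Ten := Matrix.of fun μ i => S.e i x μ

/-- The matrix of a boost in the parallel and a rotation in the perpendicular two-flat. -/
noncomputable def boostRot (β θ : ℝ) : Ten :=
  !![Real.cosh β, Real.sinh β, 0, 0; Real.sinh β, Real.cosh β, 0, 0;
    0, 0, -Real.sin θ, Real.cos θ; 0, 0, -Real.cos θ, -Real.sin θ]

/-- The matrix whose columns are `t̂, b̂, ĉ, â`. -/
noncomputable def frame (S : Data) (x : Vec) (β θ : ℝ) : Ten := S.tetrad x * boostRot β θ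

theorem frame_mulVec_that (S : Data) (x : Vec) (β θ : ℝ) :
    S.that x β = (S.frame x β θ).mulVec ![1, 0, 0, 0] := by
  ext μ
  simp [frame, tetrad, boostRot, that, Matrix.mulVec, dotProduct, Fin.sum_univ_four,
    Matrix.mul_apply]; ring

theorem frame_mulVec_bhat (S : Data) (x : Vec) (β θ : ℝ) :
    S.bhat x β = (S.frame x β θ).mulVec ![0, 1, 0, 0] := by
  ext μ
  simp [frame, tetrad, boostRot, bhat, Matrix.mulVec, dotProduct, Fin.sum_univ_four,
    Matrix.mul_apply]; ring

theorem frame_mulVec_chat (S : Data) (x : Vec) (β θ : ℝ) :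
    S.chat x θ = (S.frame x β θ).mulVec ![0, 0, 1, 0] := by
  ext μ
  simp [frame, tetrad, boostRot, chat, Matrix.mulVec, dotProduct, Fin.sum_univ_four,
    Matrix.mul_apply]; ring

theorem frame_mulVec_ahat (S : Data) (x : Vec) (β θ : ℝ) :
    S.ahat x θ = (S.frame x β θ).mulVec ![0, 0, 0, 1] := by
  ext μ
  simp [frame, tetrad, boostRot, ahat, Matrix.mulVec, dotProduct, Fin.sum_univ_four,
    Matrix.mul_apply]; ring

theorem boostRot_orthonormal (β θ : ℝ) :
    (boostRot β θ).transpose * eta * boostRot β θ = eta := by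
  have h1 := Real.cosh_sq β
  have h2 := Real.sin_sq_add_cos_sq θ
  rw [show (boostRot β θ).transpose * eta * boostRot β θ
    = tdot (boostRot β θ).transpose (boostRot β θ) from rfl]
  simp only [boostRot, eta_explicit, tdot_explicit, transpose_explicit]
  apply explicit_ext <;> 
    first | ring1 | linear_combination h1 | linear_combination h2 | linear_combination -h1

/-- Two factors η cancel on each side. This form can be evaluated by the literal-entry rules for the
metric contraction. -/
theorem conj_eq_tdot (L A : Ten) : conj L A = L ⊡ raise A ⊡ L.transpose := by
  have h : L * eta * (eta * A * eta) * eta * L.transpose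
      = L * (eta * eta) * A * (eta * eta) * L.transpose := by
    simp only [Matrix.mul_assoc]
  rw [tdot, tdot, raise, h, eta_mul_eta, Matrix.mul_one, Matrix.mul_one, conj]

theorem raise_frameF (l : ℝ) : raise (frameF l) = frameF l := by
  ext i j; fin_cases i <;> fin_cases j <;> simp [raise, frameF, eta]

theorem raise_frameDual (l : ℝ) : raise (frameDual l) = -frameDual l := by
  ext i j; fin_cases i <;> fin_cases j <;> simp [raise, frameDual, eta]

/-- F₀ is a multiple of the area form of the perpendicular two-flat: rotations there have
determinant one, and boosts act on the other two-flat. Hence its components do not depend on 𝓑 or Θ.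
For the dual tensor the roles of the two flats are exchanged. -/
theorem conj_boostRot_frameF (β θ l : ℝ) : conj (boostRot β θ) (frameF l) = frameF l := by
  have h2 := Real.sin_sq_add_cos_sq θ
  rw [conj_eq_tdot, raise_frameF]
  simp only [boostRot, frameF, tdot_explicit, transpose_explicit]
  apply explicit_ext <;>
    first | ring1 | linear_combination l * h2 | linear_combination -l * h2

theorem conj_boostRot_frameDual (β θ l : ℝ) :
    conj (boostRot β θ) (frameDual l) = frameDual l := by
  have h1 := Real.cosh_sq β
  rw [conj_eq_tdot, raise_frameDual]
  simp only [boostRot, frameDual, neg_explicit, tdot_explicit, transpose_explicit]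
  apply explicit_ext <;>
    first | ring1 | linear_combination l * h1 | linear_combination -l * h1

theorem conj_mul (E L A : Ten) : conj (E * L) A = conj E (conj L A) := by
  simp only [conj, Matrix.transpose_mul, Matrix.mul_assoc]

end Data

namespace Data.Admissible

variable {S : Data} {O : Set Vec} {x : Vec}

theorem tetrad_orthonormal (hS : S.Admissible O) (hx : x ∈ O) : (S.tetrad x).transpose * eta * S.tetrad x = eta := by
  ext i j
  rw [← hS.orthonormal x hx i j, vdot, Matrix.mul_assoc, Matrix.mul_apply]
  refine Finset.sum_congr rfl fun μ _ => ?_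
  rw [Matrix.mul_apply, Finset.mul_sum]
  exact Finset.sum_congr rfl fun ν _ => (mul_assoc _ _ _).symm

theorem frame_orthonormal (hS : S.Admissible O) (hx : x ∈ O) (β θ : ℝ) :
    (S.frame x β θ).transpose * eta * S.frame x β θ = eta := by
  have : (S.frame x β θ).transpose * eta * S.frame x β θ
      = (boostRot β θ).transpose * ((S.tetrad x).transpose * eta * S.tetrad x)
        * boostRot β θ := by
    simp only [frame, Matrix.transpose_mul, Matrix.mul_assoc]
  rw [this, hS.tetrad_orthonormal hx, boostRot_orthonormal]

/-- A tensor is determined by its action on a basis; the completeness relation of the tetrad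
reassembles it. -/
theorem eq_conj_tetrad (hS : S.Admissible O) (hx : x ∈ O) {A N : Ten} (h : ∀ i, tvec A (S.e i x) = (S.tetrad x).mulVec (N.col i)) :
    A = conj (S.tetrad x) (N * eta) := by
  have h1 : A * eta * S.tetrad x = S.tetrad x * N := by
    ext μ i
    have := congrFun (h i) μ
    rw [tvec, Matrix.mulVec_mulVec] at this
    exact this
  have h2 := mul_eta_mul_transpose (hS.tetrad_orthonormal hx)
  calc A = A * eta * (S.tetrad x * eta * (S.tetrad x).transpose) := by
        rw [h2, Matrix.mul_assoc, eta_mul_eta, Matrix.mul_one]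
    _ = (A * eta * S.tetrad x) * eta * (S.tetrad x).transpose := by
        simp only [Matrix.mul_assoc]
    _ = _ := by rw [h1]; simp only [conj, Matrix.mul_assoc]

theorem F0_eq (hS : S.Admissible O) (hx : x ∈ O) (β θ : ℝ) :
    S.F0 x = conj (S.frame x β θ) (frameF (S.lamB x)) := by
  have h : S.F0 x = conj (S.tetrad x) (frameF (S.lamB x) * eta * eta) := by
    refine hS.eq_conj_tetrad hx fun i => ?_
    have hN : frameF (S.lamB x) * eta = frameF (S.lamB x) := by
      ext i j; fin_cases i <;> fin_cases j <;> simp [frameF, eta]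
    rw [hN]
    fin_cases i
    · refine (hS.F_e0 x hx).trans ?_
      ext μ; simp [frameF, Matrix.mulVec, dotProduct, Fin.sum_univ_four]
    · refine (hS.F_e1 x hx).trans ?_
      ext μ; simp [frameF, Matrix.mulVec, dotProduct, Fin.sum_univ_four]
    · refine (hS.F_e2 x hx).trans ?_
      ext μ; simp [frameF, tetrad, Matrix.mulVec, dotProduct, Fin.sum_univ_four, mul_comm]
    · refine (hS.F_e3 x hx).trans ?_
      ext μ; simp [frameF, tetrad, Matrix.mulVec, dotProduct, Fin.sum_univ_four, mul_comm]
  rw [h, Matrix.mul_assoc, eta_mul_eta, Matrix.mul_one, frame, conj_mul, conj_boostRot_frameF]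

theorem dualF0_eq (hS : S.Admissible O) (hx : x ∈ O) (β θ : ℝ) :
    S.dualF0 x = conj (S.frame x β θ) (frameDual (S.lamB x)) := by
  have h : S.dualF0 x = conj (S.tetrad x) (frameDual (S.lamB x) * eta * eta) := by
    refine hS.eq_conj_tetrad hx fun i => ?_
    have hN : frameDual (S.lamB x) * eta = !![0, -S.lamB x, 0, 0; -S.lamB x, 0, 0, 0;
        0, 0, 0, 0; 0, 0, 0, 0] := by
      ext i j; fin_cases i <;> fin_cases j <;> simp [frameDual, eta]
    rw [hN]
    fin_cases i
    · refine (hS.dualF_e0 x hx).trans ?_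
      ext μ; simp [tetrad, Matrix.mulVec, dotProduct, Fin.sum_univ_four, mul_comm]
    · refine (hS.dualF_e1 x hx).trans ?_
      ext μ; simp [tetrad, Matrix.mulVec, dotProduct, Fin.sum_univ_four, mul_comm]
    · refine (hS.dualF_e2 x hx).trans ?_
      ext μ; simp [Matrix.mulVec, dotProduct, Fin.sum_univ_four]
    · refine (hS.dualF_e3 x hx).trans ?_
      ext μ; simp [Matrix.mulVec, dotProduct, Fin.sum_univ_four]
  rw [h, Matrix.mul_assoc, eta_mul_eta, Matrix.mul_one, frame, conj_mul,
    conj_boostRot_frameDual]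

/-- `P_⊥ = ĉ ĉ + â â`. -/
theorem Pperp_eq (hS : S.Admissible O) (hx : x ∈ O) (β θ : ℝ) :
    S.Pperp x = conj (S.frame x β θ) !![0, 0, 0, 0; 0, 0, 0, 0; 0, 0, 1, 0; 0, 0, 0, 1] := by
  have hl := (hS.lamB_pos x hx).ne'
  rw [Pperp, hS.F0_eq hx β θ, tdot_conj (hS.frame_orthonormal hx β θ), conj_smul]
  congr 1
  simp only [frameF, tdot_explicit, smul_explicit]
  apply explicit_ext <;> field_simp <;> ring

theorem Ppar_add_Pperp (S : Data) (x : Vec) : S.Ppar x + S.Pperp x = eta := by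
  simp [Ppar, Pperp]

/-- `P_∥ = -t̂ t̂ + b̂ b̂`. -/
theorem Ppar_eq (hS : S.Admissible O) (hx : x ∈ O) (β θ : ℝ) :
    S.Ppar x = conj (S.frame x β θ) !![-1, 0, 0, 0; 0, 1, 0, 0; 0, 0, 0, 0; 0, 0, 0, 0] := by
  rw [eq_sub_of_add_eq (Ppar_add_Pperp S x), hS.Pperp_eq hx β θ,
    eta_eq_conj (hS.frame_orthonormal hx β θ), conj_sub]
  congr 1
  simp only [eta_explicit, sub_explicit]
  apply explicit_ext <;> norm_num

theorem smV_e (hS : S.Admissible O) (hx : x ∈ O) (i : Fin 4) : SmV (S.e i) x :=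
  contDiffAt_pi.1 ((hS.smooth_e i).contDiffAt (hS.isOpen.mem_nhds hx))

theorem smV_A0 (hS : S.Admissible O) (hx : x ∈ O) : SmV S.A0 x :=
  contDiffAt_pi.1 (hS.smooth_A0.contDiffAt (hS.isOpen.mem_nhds hx))

theorem smV_A1 (hS : S.Admissible O) (hx : x ∈ O) : SmV S.A1 x :=
  contDiffAt_pi.1 (hS.smooth_A1.contDiffAt (hS.isOpen.mem_nhds hx))

theorem smV_A2 (hS : S.Admissible O) (hx : x ∈ O) : SmV S.A2 x :=
  contDiffAt_pi.1 (hS.smooth_A2.contDiffAt (hS.isOpen.mem_nhds hx))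

theorem smT_raise_extD {A : Vec → Vec} (hA : SmV A x) : SmT (fun y => raise (extD A y)) x :=
  ((SmT.const eta).mul (M := fun _ => eta) (contDiffAt_extD hA)).mul (SmT.const eta)

theorem smT_F0 (hS : S.Admissible O) (hx : x ∈ O) : SmT S.F0 x := smT_raise_extD (hS.smV_A0 hx)

theorem smT_F1 (hS : S.Admissible O) (hx : x ∈ O) : SmT S.F1 x := smT_raise_extD (hS.smV_A1 hx)

theorem smT_F2 (hS : S.Admissible O) (hx : x ∈ O) : SmT S.F2 x := smT_raise_extD (hS.smV_A2 hx)

theorem smV_Rcov (hS : S.Admissible O) (hx : x ∈ O) : SmV S.Rcov x := fun σ =>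
  contDiffAt_vdot (V := fun x ν => pd (fun y => S.e 2 y ν) σ x)
    (fun ν => contDiffAt_pd (hS.smV_e hx 2 ν) σ) (hS.smV_e hx 3)

theorem smV_Rvec (hS : S.Admissible O) (hx : x ∈ O) : SmV S.Rvec x :=
  SmV.mulVec (SmT.const eta) (hS.smV_Rcov hx)

theorem smT_Ncurv (hS : S.Admissible O) (hx : x ∈ O) : SmT S.Ncurv x :=
  smT_raise_extD (hS.smV_Rcov hx)

theorem smT_dualF0 (hS : S.Admissible O) (hx : x ∈ O) : SmT S.dualF0 x := by
  have h := contDiffAt_extD (hS.smV_A0 hx)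
  intro μ ν
  fin_cases μ <;> fin_cases ν <;>
    first | exact contDiffAt_const | exact h _ _ | exact (h _ _).neg

/-- This expresses λ_B without the nested square roots of its definition, so that smoothness is
inherited from F₀ and the tetrad. -/
theorem lamB_eq_vdot (hS : S.Admissible O) (hx : x ∈ O) :
    S.lamB x = vdot (S.e 2 x) (tvec (S.F0 x) (S.e 3 x)) := by
  rw [hS.F_e3 x hx, vdot_smul_right, hS.orthonormal x hx]
  simp [eta]

theorem contDiffAt_lamB (hS : S.Admissible O) (hx : x ∈ O) : ContDiffAt ℝ ∞ S.lamB x := by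
  refine (contDiffAt_vdot (hS.smV_e hx 2)
    (SmV.tvec (hS.smT_F0 hx) (hS.smV_e hx 3))).congr_of_eventuallyEq ?_
  filter_upwards [hS.isOpen.mem_nhds hx] with y hy
  exact hS.lamB_eq_vdot hy

theorem contDiffAt_OmegaB (hS : S.Admissible O) (hx : x ∈ O) : ContDiffAt ℝ ∞ S.OmegaB x :=
  (contDiffAt_const.mul (hS.contDiffAt_lamB hx)).div_const _

theorem smT_Pperp (hS : S.Admissible O) (hx : x ∈ O) : SmT S.Pperp x :=
  SmT.smul ((((hS.contDiffAt_lamB hx).pow 2).inv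
    (pow_ne_zero 2 (hS.lamB_pos x hx).ne')).neg) ((hS.smT_F0 hx).tdot (hS.smT_F0 hx))

theorem smT_Ppar (hS : S.Admissible O) (hx : x ∈ O) : SmT S.Ppar x :=
  (SmT.const eta).add (SmT.smul (((hS.contDiffAt_lamB hx).pow 2).inv
    (pow_ne_zero 2 (hS.lamB_pos x hx).ne')) ((hS.smT_F0 hx).tdot (hS.smT_F0 hx)))

end Data.Admissible

end GuidingCenter

/-! ### Components of the Lagrangian two-form -/

namespace GuidingCenter

section Slice

variable {ι α : Type} [Fintype ι] [DecidableEq ι] [Fintype α] [DecidableEq α]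

/-- Freezing the second block of variables reduces a derivative in R to one of fields on spacetime.
`pd_eq_deriv` does the same for a single remaining coordinate, where the functions are elementary.
-/
theorem pd_slice_left {f : (ι ⊕ α → ℝ) → ℝ} {y : ι ⊕ α → ℝ} (hf : DifferentiableAt ℝ f y)
    (i : ι) : pd f (.inl i) y
      = pd (fun x : ι → ℝ => f (Sum.elim x fun k => y (.inr k))) i fun j => y (.inl j) := by
  have hy : (Sum.elim (fun j => y (.inl j)) fun k => y (.inr k)) = y := by
    ext (j | j) <;> rfl
  have hφ : DifferentiableAt ℝ (fun x : ι → ℝ => (Sum.elim x fun k => y (.inr k) : ι ⊕ α → ℝ))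
      (fun j => y (.inl j)) := by
    refine differentiableAt_pi.2 ?_
    rintro (j | k)
    · exact differentiableAt_apply (𝕜 := ℝ) j _
    · exact differentiableAt_const _
  rw [pd_comp (by rwa [hy]) hφ]
  simp [pd_proj, pd_const, hy]

theorem pd_eq_deriv {f : (ι → ℝ) → ℝ} {y : ι → ℝ} (hf : DifferentiableAt ℝ f y) (i : ι) :
    pd f i y = deriv (fun s => f (Function.update y i s)) (y i) := by
  have h := hasDerivAt_update y i (y i)
  have hf' : HasFDerivAt f (fderiv ℝ f y) (Function.update y i (y i)) := by
    rw [Function.update_eq_self]; exact hf.hasFDerivAt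
  exact (hf'.comp_hasDerivAt _ h).deriv.symm

end Slice

theorem eta_mulVec_apply (v : Vec) (μ : Fin 4) : eta.mulVec v μ = eta μ μ * v μ := by
  fin_cases μ <;> simp [eta, Matrix.mulVec_diagonal]

theorem eta_mulVec_eta_mulVec (v : Vec) : eta.mulVec (eta.mulVec v) = v := by
  rw [Matrix.mulVec_mulVec, eta_mul_eta, Matrix.one_mulVec]

theorem raise_raise (A : Ten) : raise (raise A) = A := by
  have : raise (raise A) = (eta * eta) * A * (eta * eta) := by
    simp only [raise, Matrix.mul_assoc]
  rw [this, eta_mul_eta, Matrix.one_mul, Matrix.mul_one]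

theorem contDiffAt_zR (z : GCIdx → ℝ) : ContDiffAt ℝ ∞ zR z :=
  contDiffAt_pi.2 fun μ => contDiffAt_apply ℝ ℝ (Sum.inl μ) z

theorem contDiffAt_zK (z : GCIdx → ℝ) : ContDiffAt ℝ ∞ zK z := contDiffAt_apply ℝ ℝ _ z
theorem contDiffAt_zB (z : GCIdx → ℝ) : ContDiffAt ℝ ∞ zB z := contDiffAt_apply ℝ ℝ _ z
theorem contDiffAt_zMu (z : GCIdx → ℝ) : ContDiffAt ℝ ∞ zMu z := contDiffAt_apply ℝ ℝ _ z
theorem contDiffAt_zTheta (z : GCIdx → ℝ) : ContDiffAt ℝ ∞ zTheta z := contDiffAt_apply ℝ ℝ _ z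

namespace Data

/-- The total four-potential that enters the Lagrangian. -/
def potential (S : Data) (ord : GCOrder) (x : Vec) : Vec :=
  match ord with
  | .classical => fun μ => S.A0 x μ + S.ε * S.A1 x μ
  | .higher => fun μ => S.A0 x μ + S.ε * S.A1 x μ + S.ε ^ 2 * S.A2 x μ

/-- The gyrogauge one-form as it enters the Lagrangian. -/
noncomputable def gyroForm (S : Data) (ord : GCOrder) (x : Vec) : Vec :=
  match ord with
  | .classical => 0
  | .higher => S.Rcov x

/-- One formula for both orders: at the classical order the gyrogauge form is zero and the
second-order potential is absent. Later arguments need no case distinction wherever 𝓡 occurs through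
`gyroForm`. -/
theorem action_inl (S : Data) (ord : GCOrder) (z : GCIdx → ℝ) (μ : Fin 4) :
    S.action ord z (.inl μ) = S.q / (S.ε * S.c) * S.potential ord (zR z) μ
      + S.m * zK z * (eta μ μ * S.that (zR z) (zB z) μ)
      - S.ε * zMu z * S.gyroForm ord (zR z) μ := by
  cases ord <;> simp [action, potential, gyroForm, eta_mulVec_apply]

/-- The two-form `F₀ + ε F''`, up to the factor `e/εc`. -/
noncomputable def field (S : Data) (ord : GCOrder) (z : GCIdx → ℝ) : Ten :=
  (S.q / (S.ε * S.c)) • (S.F0 (zR z) + S.ε • S.Fpp ord z)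

theorem smV_that_param {S : Data} {ι : Type} [Fintype ι] {z : ι → ℝ} {X : (ι → ℝ) → Vec}
    {β : (ι → ℝ) → ℝ} (h0 : SmV (S.e 0) (X z)) (h1 : SmV (S.e 1) (X z))
    (hX : ContDiffAt ℝ ∞ X z) (hβ : ContDiffAt ℝ ∞ β z) :
    SmV (fun y => S.that (X y) (β y)) z :=
  (SmV.smul (Real.contDiff_cosh.contDiffAt.comp z hβ) (h0.comp hX)).add
    (SmV.smul (Real.contDiff_sinh.contDiffAt.comp z hβ) (h1.comp hX))

theorem smV_bhat_param {S : Data} {ι : Type} [Fintype ι] {z : ι → ℝ} {X : (ι → ℝ) → Vec}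
    {β : (ι → ℝ) → ℝ} (h0 : SmV (S.e 0) (X z)) (h1 : SmV (S.e 1) (X z))
    (hX : ContDiffAt ℝ ∞ X z) (hβ : ContDiffAt ℝ ∞ β z) :
    SmV (fun y => S.bhat (X y) (β y)) z :=
  (SmV.smul (Real.contDiff_sinh.contDiffAt.comp z hβ) (h0.comp hX)).add
    (SmV.smul (Real.contDiff_cosh.contDiffAt.comp z hβ) (h1.comp hX))

theorem smV_ahat_param {S : Data} {ι : Type} [Fintype ι] {z : ι → ℝ} {X : (ι → ℝ) → Vec}
    {θ : (ι → ℝ) → ℝ} (h2 : SmV (S.e 2) (X z)) (h3 : SmV (S.e 3) (X z))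
    (hX : ContDiffAt ℝ ∞ X z) (hθ : ContDiffAt ℝ ∞ θ z) :
    SmV (fun y => S.ahat (X y) (θ y)) z :=
  (SmV.smul (Real.contDiff_cos.contDiffAt.comp z hθ) (h2.comp hX)).sub
    (SmV.smul (Real.contDiff_sin.contDiffAt.comp z hθ) (h3.comp hX))

theorem smV_chat_param {S : Data} {ι : Type} [Fintype ι] {z : ι → ℝ} {X : (ι → ℝ) → Vec}
    {θ : (ι → ℝ) → ℝ} (h2 : SmV (S.e 2) (X z)) (h3 : SmV (S.e 3) (X z))
    (hX : ContDiffAt ℝ ∞ X z) (hθ : ContDiffAt ℝ ∞ θ z) :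
    SmV (fun y => S.chat (X y) (θ y)) z :=
  (SmV.smul (Real.contDiff_sin.contDiffAt.comp z hθ).neg (h2.comp hX)).sub
    (SmV.smul (Real.contDiff_cos.contDiffAt.comp z hθ) (h3.comp hX))

end Data

namespace Data.Admissible

variable {S : Data} {O : Set Vec}

theorem smV_that (hS : S.Admissible O) {x : Vec} (hx : x ∈ O) (β : ℝ) :
    SmV (fun y => S.that y β) x :=
  smV_that_param (X := fun y => y) (hS.smV_e hx 0) (hS.smV_e hx 1) contDiffAt_id
    contDiffAt_const

theorem smV_bhat (hS : S.Admissible O) {x : Vec} (hx : x ∈ O) (β : ℝ) :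
    SmV (fun y => S.bhat y β) x :=
  smV_bhat_param (X := fun y => y) (hS.smV_e hx 0) (hS.smV_e hx 1) contDiffAt_id
    contDiffAt_const

theorem smV_potential (hS : S.Admissible O) {x : Vec} (hx : x ∈ O) (ord : GCOrder) :
    SmV (S.potential ord) x := by
  have h1 := ((hS.smV_A0 hx).add (SmV.smul (contDiffAt_const (c := S.ε)) (hS.smV_A1 hx)))
  cases ord
  · exact h1
  · exact h1.add (SmV.smul (contDiffAt_const (c := S.ε ^ 2)) (hS.smV_A2 hx))

theorem smV_gyroForm (hS : S.Admissible O) {x : Vec} (hx : x ∈ O) (ord : GCOrder) :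
    SmV (S.gyroForm ord) x := by
  cases ord
  · exact fun μ => contDiffAt_const
  · exact hS.smV_Rcov hx

variable {z : GCIdx → ℝ}

theorem contDiffAt_action (hS : S.Admissible O) (hz : zR z ∈ O) (ord : GCOrder) (i : GCIdx) :
    ContDiffAt ℝ ∞ (fun y => S.action ord y i) z := by
  obtain μ | k := i
  · simp only [action_inl]
    exact ((contDiffAt_const.mul ((hS.smV_potential hz ord).comp (contDiffAt_zR z) μ)).add
      ((contDiffAt_const.mul (contDiffAt_zK z)).mul (contDiffAt_const.mul
        (smV_that_param (hS.smV_e hz 0) (hS.smV_e hz 1) (contDiffAt_zR z) (contDiffAt_zB z) μ)))).sub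
      ((contDiffAt_const.mul (contDiffAt_zMu z)).mul
        ((hS.smV_gyroForm hz ord).comp (contDiffAt_zR z) μ))
  · fin_cases k
    · exact contDiffAt_const
    · exact contDiffAt_const
    · exact contDiffAt_const
    · exact contDiffAt_const.mul (contDiffAt_zMu z)

/-- The exterior derivative of the potentials, in terms of `F₀` and `F'`. -/
theorem extD_potential (hS : S.Admissible O) {x : Vec} (hx : x ∈ O) (ord : GCOrder) (u : ℝ)
    (μ ν : Fin 4) :
    S.q / (S.ε * S.c) * extD (S.potential ord) x μ ν - S.ε * u * extD (S.gyroForm ord) x μ ν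
      = raise ((S.q / (S.ε * S.c)) • (S.F0 x + S.ε • S.Fp ord x u)) μ ν := by
  have hq := hS.q_ne
  have hc := hS.c_pos.ne'
  have hε := hS.ε_ne
  have h : ∀ (r s : ℝ) (A B : Ten), raise (r • (A + s • B)) = r • (raise A + s • raise B) := by
    intro r s A B
    simp [raise, Matrix.mul_add, Matrix.add_mul]
  have h' : ∀ (r s : ℝ) (A B C : Ten), raise (A + r • B - s • C) = raise A + r • raise B - s • raise C := by
    intro r s A B C
    simp [raise, Matrix.mul_add, Matrix.add_mul, Matrix.mul_sub, Matrix.sub_mul]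
  have d0 := fun ν => (hS.smV_A0 hx ν).diff
  have d1 := fun ν => ((hS.smV_A1 hx ν).diff).const_mul S.ε
  have d2 := fun ν => ((hS.smV_A2 hx ν).diff).const_mul (S.ε ^ 2)
  rw [h]
  cases ord
  · simp only [Fp, F0, F1, raise_raise]
    simp only [extD, potential, gyroForm, Matrix.of_apply, Matrix.smul_apply, Matrix.add_apply,
      smul_eq_mul, pd_add (d0 _) (d1 _), pd_const_mul S.ε (hS.smV_A1 hx _).diff, Pi.zero_apply,
      pd_const]
    ring
  · simp only [Fp, F0, h', F1, F2, Ncurv, raise_raise]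
    simp only [extD, potential, gyroForm, Matrix.of_apply, Matrix.smul_apply, Matrix.add_apply,
      Matrix.sub_apply, smul_eq_mul]
    rw [pd_add ((d0 _).fun_add (d1 _)) (d2 _), pd_add ((d0 _).fun_add (d1 _)) (d2 _)]
    simp only [pd_add (d0 _) (d1 _),
      pd_const_mul S.ε (hS.smV_A1 hx _).diff, pd_const_mul (S.ε ^ 2) (hS.smV_A2 hx _).diff]
    field_simp
    ring

/-- The potentials and 𝓡 give F₀ + εF', and the term m K t̂ gives the antisymmetrized gradient that
completes F' to F''. -/
theorem omega_inl_inl (hS : S.Admissible O) (hz : zR z ∈ O) (ord : GCOrder) (μ ν : Fin 4) :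
    S.omega ord z (.inl μ) (.inl ν) = raise (S.field ord z) μ ν := by
  have hq := hS.q_ne
  have hc := hS.c_pos.ne'
  have hε := hS.ε_ne
  have key : ∀ μ ν : Fin 4, pd (fun y => S.action ord y (.inl ν)) (.inl μ) z
      = S.q / (S.ε * S.c) * pd (fun y => S.potential ord y ν) μ (zR z)
        + S.m * zK z * (eta ν ν * pd (fun y => S.that y (zB z) ν) μ (zR z))
        - S.ε * zMu z * pd (fun y => S.gyroForm ord y ν) μ (zR z) := by
    intro μ ν
    have d1 := (hS.smV_potential hz ord ν).diff
    have d2 := (hS.smV_that hz (zB z) ν).diff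
    have d3 := (hS.smV_gyroForm hz ord ν).diff
    rw [pd_slice_left (hS.contDiffAt_action hz ord _).diff]
    simp only [action_inl]
    have e : ∀ x : Vec, zR (Sum.elim x fun k => z (.inr k)) = x := fun _ => rfl
    have e2 : ∀ x : Vec, zK (Sum.elim x fun k => z (.inr k)) = zK z := fun _ => rfl
    have e3 : ∀ x : Vec, zB (Sum.elim x fun k => z (.inr k)) = zB z := fun _ => rfl
    have e4 : ∀ x : Vec, zMu (Sum.elim x fun k => z (.inr k)) = zMu z := fun _ => rfl
    simp only [e, e2, e3, e4]
    change pd _ μ (zR z) = _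
    rw [pd_sub ((d1.const_mul _).fun_add ((d2.const_mul _).const_mul _)) (d3.const_mul _),
      pd_add (d1.const_mul _) ((d2.const_mul _).const_mul _), pd_const_mul _ d1,
      pd_const_mul _ (d2.const_mul _), pd_const_mul _ d2, pd_const_mul _ d3]
  have hp := hS.extD_potential hz ord (zMu z) μ ν
  -- The prefactors multiply to (e/εc) · ε · (mcK/e) = mK, the coefficient of t̂ in the action.
  have hg : ∀ A : Ten, raise ((S.q / (S.ε * S.c)) • (S.F0 (zR z) + S.ε •
      (S.Fp ord (zR z) (zMu z) + (S.m * S.c * zK z / S.q) • (eta * A - (eta * A).transpose)))) μ ν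
      = raise ((S.q / (S.ε * S.c)) • (S.F0 (zR z) + S.ε • S.Fp ord (zR z) (zMu z))) μ ν
        + S.m * zK z * (A μ ν * eta ν ν - eta μ μ * A ν μ) := by
    intro A
    have : (S.q / (S.ε * S.c)) • (S.F0 (zR z) + S.ε •
      (S.Fp ord (zR z) (zMu z) + (S.m * S.c * zK z / S.q) • (eta * A - (eta * A).transpose)))
      = (S.q / (S.ε * S.c)) • (S.F0 (zR z) + S.ε • S.Fp ord (zR z) (zMu z))
        + (S.m * zK z) • (eta * A - A.transpose * eta) := by
      rw [Matrix.transpose_mul, eta_transpose]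
      simp only [smul_add, smul_smul, ← add_assoc]
      congr 2
      field_simp
    have h2 : raise (eta * A - A.transpose * eta) = A * eta - eta * A.transpose := by
      rw [raise, Matrix.mul_sub, Matrix.sub_mul, ← Matrix.mul_assoc eta eta, eta_mul_eta,
        Matrix.one_mul, Matrix.mul_assoc eta (A.transpose * eta), Matrix.mul_assoc A.transpose,
        eta_mul_eta, Matrix.mul_one]
    have h3 : ∀ (B C : Ten) (r : ℝ), raise (B + r • C) = raise B + r • raise C := by
      intro B C r
      simp [raise, Matrix.mul_add, Matrix.add_mul]
    rw [this, h3, h2]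
    simp [eta, Matrix.mul_diagonal, Matrix.diagonal_mul]
  rw [field, Fpp, grad, hg, ← hp, omega, extD, Matrix.of_apply, key, key]
  simp only [extD, Matrix.of_apply]
  ring

theorem omega_inl_inr (hS : S.Admissible O) (hz : zR z ∈ O) (ord : GCOrder) (μ k : Fin 4) :
    S.omega ord z (.inl μ) (.inr k)
      = ![-(S.m * eta.mulVec (S.that (zR z) (zB z)) μ),
          -(S.m * zK z * eta.mulVec (S.bhat (zR z) (zB z)) μ),
          S.ε * S.gyroForm ord (zR z) μ, 0] k := by
  have d := (hS.contDiffAt_action hz ord (.inl μ)).diff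
  -- The only internal component of the action is εμ, along Θ, and it does not depend on R.
  -- Therefore just −∂Γ_μ survives, with ∂t̂/∂𝓑 = b̂.
  have h0 : pd (fun y => S.action ord y (.inr k)) (.inl μ) z = 0 := by
    fin_cases k
    · exact pd_const _ _ _
    · exact pd_const _ _ _
    · exact pd_const _ _ _
    · change pd (fun y : GCIdx → ℝ => S.ε * y (Sum.inr 2)) _ _ = 0
      rw [pd_const_mul _ (differentiableAt_apply (𝕜 := ℝ) _ _), pd_proj]
      simp
  rw [omega, extD, Matrix.of_apply, h0, pd_eq_deriv d]
  simp only [action_inl]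
  have e : ∀ s, zR (Function.update z (.inr k) s) = zR z := fun s => by ext; simp [zR]
  simp only [e, eta_mulVec_apply]
  fin_cases k <;> simp [zK, zB, zMu, that, bhat]

theorem omega_inr_inr (S : Data) (ord : GCOrder) (z : GCIdx → ℝ) (k l : Fin 4) :
    S.omega ord z (.inr k) (.inr l)
      = !![0, 0, 0, 0; 0, 0, 0, 0; 0, 0, 0, S.ε; 0, 0, -S.ε, 0] k l := by
  have h : ∀ k l : Fin 4, pd (fun y => S.action ord y (.inr l)) (.inr k) z
      = if l = 3 ∧ k = 2 then S.ε else 0 := by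
    intro k l
    fin_cases l
    · exact pd_const _ _ _
    · exact pd_const _ _ _
    · exact pd_const _ _ _
    · change pd (fun y : GCIdx → ℝ => S.ε * y (Sum.inr 2)) _ _ = _
      rw [pd_const_mul _ (differentiableAt_apply (𝕜 := ℝ) _ _), pd_proj]
      simp [eq_comm]
  rw [omega, extD, Matrix.of_apply, h, h]
  fin_cases k <;> fin_cases l <;> simp

end Data.Admissible

end GuidingCenter

/-! ### Inversion of the Lagrangian two-form -/

namespace GuidingCenter
namespace Data.Admissible

variable {S : Data} {O : Set Vec} {z : GCIdx → ℝ}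

theorem smT_Fp_param (hS : S.Admissible O) (ord : GCOrder) {ι : Type} [Fintype ι] {y : ι → ℝ}
    {X : (ι → ℝ) → Vec} {u : (ι → ℝ) → ℝ} (hx : X y ∈ O) (hX : ContDiffAt ℝ ∞ X y)
    (hu : ContDiffAt ℝ ∞ u y) : SmT (fun w => S.Fp ord (X w) (u w)) y := by
  cases ord
  · exact (hS.smT_F1 hx).comp hX
  · exact (((hS.smT_F1 hx).comp hX).add
      (SmT.smul contDiffAt_const ((hS.smT_F2 hx).comp hX))).sub
      (SmT.smul (contDiffAt_const.mul hu) ((hS.smT_Ncurv hx).comp hX))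

theorem raise_antisymm {A : Ten} (hA : A.transpose = -A) : (raise A).transpose = -raise A := by
  simp [raise, Matrix.transpose_mul, eta_transpose, hA, Matrix.mul_assoc]

theorem raise_extD_antisymm (A : Vec → Vec) (x : Vec) :
    (raise (extD A x)).transpose = -raise (extD A x) :=
  raise_antisymm (by ext i j; exact extD_antisymm A x j i)

theorem F0_antisymm (S : Data) (x : Vec) : (S.F0 x).transpose = -S.F0 x :=
  raise_extD_antisymm _ _

theorem Fp_antisymm (S : Data) (ord : GCOrder) (x : Vec) (u : ℝ) :
    (S.Fp ord x u).transpose = -S.Fp ord x u := by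
  cases ord
  · exact raise_extD_antisymm _ _
  · simp only [Fp, Matrix.transpose_sub, Matrix.transpose_add, Matrix.transpose_smul, F1, F2,
      Ncurv, raise_extD_antisymm]
    simp only [smul_neg]
    abel

theorem Fpp_antisymm (S : Data) (ord : GCOrder) (z : GCIdx → ℝ) :
    (S.Fpp ord z).transpose = -S.Fpp ord z := by
  simp only [Fpp, Matrix.transpose_add, Matrix.transpose_smul, Matrix.transpose_sub,
    Matrix.transpose_transpose, Fp_antisymm, neg_add, ← smul_neg, neg_sub]

theorem grad_that (hS : S.Admissible O) {x : Vec} (hx : x ∈ O) (β : ℝ) :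
    grad (fun y => S.that y β) x
      = Real.cosh β • grad (S.e 0) x + Real.sinh β • grad (S.e 1) x := by
  have d0 := fun ν => (hS.smV_e hx 0 ν).diff
  have d1 := fun ν => (hS.smV_e hx 1 ν).diff
  simp only [grad, ← Matrix.mul_smul, ← Matrix.mul_add]
  congr 1
  ext σ ν
  simp only [Matrix.of_apply, that, Pi.add_apply, Pi.smul_apply, smul_eq_mul, Matrix.add_apply,
    Matrix.smul_apply]
  rw [pd_add ((d0 ν).const_mul _) ((d1 ν).const_mul _), pd_const_mul _ (d0 ν),
    pd_const_mul _ (d1 ν)]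

theorem smT_Fpp (hS : S.Admissible O) (ord : GCOrder) (hz : zR z ∈ O) : SmT (S.Fpp ord) z := by
  have h1 : SmT (fun y => Real.cosh (zB y) • grad (S.e 0) (zR y)
      + Real.sinh (zB y) • grad (S.e 1) (zR y)) z :=
    (SmT.smul (Real.contDiff_cosh.contDiffAt.comp z (contDiffAt_zB z))
      ((SmT.grad (hS.smV_e hz 0)).comp (contDiffAt_zR z))).add
    (SmT.smul (Real.contDiff_sinh.contDiffAt.comp z (contDiffAt_zB z))
      ((SmT.grad (hS.smV_e hz 1)).comp (contDiffAt_zR z)))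
  have h2 : SmT (fun y => grad (fun w => S.that w (zB y)) (zR y)) z := by
    refine h1.congr ?_
    filter_upwards [(contDiffAt_zR z).continuousAt.preimage_mem_nhds (hS.isOpen.mem_nhds hz)]
      with y hy
    exact hS.grad_that hy _
  exact (hS.smT_Fp_param ord hz (contDiffAt_zR z) (contDiffAt_zMu z)).add
    (SmT.smul ((contDiffAt_const.mul (contDiffAt_zK z)).div_const _) (h2.sub h2.transpose))

theorem contDiffAt_Ups (hS : S.Admissible O) (ord : GCOrder) (hz : zR z ∈ O) :
    ContDiffAt ℝ ∞ (S.Ups ord) z := by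
  have hl := (hS.lamB_pos _ hz).ne'
  have h := (hS.contDiffAt_lamB hz).comp z (contDiffAt_zR z)
  exact contDiffAt_const.add ((contDiffAt_const.mul
    (contDiffAt_ddot ((hS.smT_F0 hz).comp (contDiffAt_zR z)) (hS.smT_Fpp ord hz))).div
    (contDiffAt_const.mul (h.pow 2)) (mul_ne_zero two_ne_zero (pow_ne_zero 2 hl)))

theorem isOpen_domain (hS : S.Admissible O) (ord : GCOrder) : IsOpen (S.domain ord O) := by
  rw [isOpen_iff_mem_nhds]
  rintro z ⟨h1, h2, h3⟩
  filter_upwards [(contDiffAt_zR z).continuousAt.preimage_mem_nhds (hS.isOpen.mem_nhds h1),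
    (contDiffAt_zK z).continuousAt.preimage_mem_nhds (isOpen_Ioi.mem_nhds h2),
    (hS.contDiffAt_Ups ord h1).continuousAt.preimage_mem_nhds (isOpen_ne.mem_nhds h3)]
    with y a b c
  exact ⟨a, b, c⟩

/-- Every antisymmetric tensor has components `frameA` in the frame `t̂, b̂, ĉ, â`. -/
theorem exists_frameA (hS : S.Admissible O) {x : Vec} (hx : x ∈ O) (β θ : ℝ) {A : Ten}
    (hA : A.transpose = -A) {Y : ℝ}
    (hY : Y = 1 + S.ε * ddot (S.F0 x) A / (2 * S.lamB x ^ 2)) :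
    ∃ a b c d e : ℝ, A = conj (S.frame x β θ) (frameA S.ε (S.lamB x) Y a b c d e) := by
  have hE := hS.frame_orthonormal hx β θ
  have hl := (hS.lamB_pos x hx).ne'
  have hε := hS.ε_ne
  obtain ⟨B, rfl⟩ := exists_eq_conj hE A
  rw [transpose_conj, conj_neg] at hA
  have hB := eq_of_antisymm (conj_injective hE hA)
  rw [hS.F0_eq hx β θ, ddot_conj hE, hB] at hY
  simp only [frameF, ddot_explicit] at hY
  refine ⟨B 0 1, B 0 2, B 0 3, B 1 2, B 1 3, congrArg _ ?_⟩
  -- F₀ : A sees only the ĉâ-component of A, so the definition of `Y` can be solved for that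
  -- component. Using `Y` as the parameter makes the denominators of the frame identities monomials.
  have h23 : B 2 3 = S.lamB x * (Y - 1) / S.ε := by
    rw [hY]; field_simp; ring
  rw [frameA, ← h23, ← hB]

theorem Xi_eq_conj (hS : S.Admissible O) (hz : zR z ∈ O) (ord : GCOrder) (θ : ℝ) {A : Ten}
    (hA : S.Fpp ord z = conj (S.frame (zR z) (zB z) θ) A) :
    S.Xi ord z = conj (S.frame (zR z) (zB z) θ)
      (eta + (S.ε / (S.lamB (zR z) ^ 2 * S.Ups ord z)) • (A ⊡ frameF (S.lamB (zR z)))) := by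
  have hE := hS.frame_orthonormal hz (zB z) θ
  rw [Xi, hA, hS.F0_eq hz (zB z) θ, tdot_conj hE, conj_smul, eta_eq_conj hE, conj_add,
    ← eta_eq_conj hE]

/-- The algebraic relations that make the explicit table of brackets the inverse matrix. -/
theorem bracket_relations (hS : S.Admissible O) (ord : GCOrder) (hz : z ∈ S.domain ord O) :
    (S.field ord z ⊡ S.brRR ord z + S.m • dyad (S.that (zR z) (zB z)) (S.brRK ord z)
      + (S.m * zK z) • dyad (S.bhat (zR z) (zB z)) (S.brRB ord z) = eta) ∧
    (tvec (S.field ord z) (S.brRK ord z)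
      + (S.m * zK z * S.brKB ord z) • S.bhat (zR z) (zB z) = 0) ∧
    (tvec (S.field ord z) (S.brRB ord z)
      + (-(S.m * S.brKB ord z)) • S.that (zR z) (zB z) = 0) ∧
    (vdot (S.that (zR z) (zB z)) (S.brRK ord z) = 1 / S.m ∧
      vdot (S.that (zR z) (zB z)) (S.brRB ord z) = 0 ∧
      vdot (S.bhat (zR z) (zB z)) (S.brRK ord z) = 0 ∧
      vdot (S.bhat (zR z) (zB z)) (S.brRB ord z) = 1 / (S.m * zK z)) ∧
    vten (S.that (zR z) (zB z)) (S.brRR ord z) = 0 ∧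
    vten (S.bhat (zR z) (zB z)) (S.brRR ord z) = 0 := by
  obtain ⟨hz1, hz2, hz3⟩ := hz
  have hl := (hS.lamB_pos _ hz1).ne'
  -- The gyroangle of the frame may be chosen freely, here as zero: t̂ and b̂ do not involve it, and
  -- the components of F₀ do not depend on it.
  have hE := hS.frame_orthonormal hz1 (zB z) 0
  obtain ⟨a, b, c, d, e, hA⟩ := hS.exists_frameA hz1 (zB z) 0 (Fpp_antisymm S ord z)
    (Y := S.Ups ord z) rfl
  have hX := hS.Xi_eq_conj hz1 ord 0 hA
  have hF := hS.F0_eq hz1 (zB z) 0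
  have ht := frame_mulVec_that S (zR z) (zB z) 0
  have hb := frame_mulVec_bhat S (zR z) (zB z) 0
  have hzero : (S.frame (zR z) (zB z) 0).mulVec ![0, 0, 0, 0] = 0 := by
    rw [show (![0, 0, 0, 0] : Vec) = 0 by ext i; fin_cases i <;> rfl, Matrix.mulVec_zero]
  have args := fun {p : Prop} (h : S.m ≠ 0 → S.q ≠ 0 → S.c ≠ 0 → S.ε ≠ 0 →
      S.lamB (zR z) ≠ 0 → zK z ≠ 0 → S.Ups ord z ≠ 0 → p) =>
    h hS.m_pos.ne' hS.q_ne hS.c_pos.ne' hS.ε_ne hl hz2.ne' hz3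
  have hRR : S.brRR ord z = conj (S.frame (zR z) (zB z) 0) (-(S.ε / (S.m * S.lamB (zR z) *
      (S.q * S.lamB (zR z) / (S.m * S.c)) * S.Ups ord z)) • frameF (S.lamB (zR z))) := by
    rw [brRR, hF, conj_smul]; rfl
  refine ⟨?_, ?_, ?_, ⟨?_, ?_, ?_, ?_⟩, ?_, ?_⟩
  · rw [hRR, field, brRK, brRB, hX, hA, hF, ht, hb]
    simp only [vten_conj hE, ← Matrix.mulVec_smul, dyad_conj, conj_smul, conj_add, tdot_conj hE]
    rw [args fun h1 h2 h3 h4 h5 h6 h7 => frame_RR _ _ _ _ _ _ _ _ _ _ _ _ h1 h2 h3 h4 h5 h6 h7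
      _ _ rfl rfl]
    exact (eta_eq_conj hE).symm
  · rw [field, brKB, brRK, hX, hA, hF, ht, hb]
    simp only [vten_conj hE, ← Matrix.mulVec_smul, conj_smul, conj_add, tdot_conj hE,
      tvec_conj hE, vdot_conj hE, ← Matrix.mulVec_add]
    rw [(args fun h1 h2 h3 h4 h5 h6 h7 => frame_RK _ _ _ _ _ _ _
      a b c d e h1 h2 h3 h4 h5 h6 h7 _ _ rfl rfl), hzero]
  · rw [field, brKB, brRB, hX, hA, hF, ht, hb]
    simp only [vten_conj hE, ← Matrix.mulVec_smul, conj_smul, conj_add, tdot_conj hE,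
      tvec_conj hE, vdot_conj hE, ← Matrix.mulVec_add]
    rw [(args fun h1 h2 h3 h4 h5 h6 h7 => frame_RB _ _ _ _ _ _ _
      a b c d e h1 h2 h3 h4 h5 h6 h7 _ _ rfl rfl), hzero]
  · rw [brRK, hX, ht]
    simp only [vten_conj hE, ← Matrix.mulVec_smul, vdot_conj hE]
    exact (args fun h1 h2 h3 h4 h5 h6 h7 => frame_vdot _ _ _ _ _ _ _
      a b c d e h1 h2 h3 h4 h5 h6 h7 _ _ rfl rfl).1
  · rw [brRB, hX, ht, hb]
    simp only [vten_conj hE, ← Matrix.mulVec_smul, vdot_conj hE]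
    exact (args fun h1 h2 h3 h4 h5 h6 h7 => frame_vdot _ _ _ _ _ _ _
      a b c d e h1 h2 h3 h4 h5 h6 h7 _ _ rfl rfl).2.1
  · rw [brRK, hX, ht, hb]
    simp only [vten_conj hE, ← Matrix.mulVec_smul, vdot_conj hE]
    exact (args fun h1 h2 h3 h4 h5 h6 h7 => frame_vdot _ _ _ _ _ _ _
      a b c d e h1 h2 h3 h4 h5 h6 h7 _ _ rfl rfl).2.2.1
  · rw [brRB, hX, hb]
    simp only [vten_conj hE, ← Matrix.mulVec_smul, vdot_conj hE]
    exact (args fun h1 h2 h3 h4 h5 h6 h7 => frame_vdot _ _ _ _ _ _ _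
      a b c d e h1 h2 h3 h4 h5 h6 h7 _ _ rfl rfl).2.2.2
  · rw [hRR, ht, vten_conj hE, (args fun h1 h2 h3 h4 h5 h6 h7 => frame_vten _ _ _ _ _ _ _
      a b c d e h1 h2 h3 h4 h5 h6 h7 _ _ rfl rfl).1,
      hzero]
  · rw [hRR, hb, vten_conj hE, (args fun h1 h2 h3 h4 h5 h6 h7 => frame_vten _ _ _ _ _ _ _
      a b c d e h1 h2 h3 h4 h5 h6 h7 _ _ rfl rfl).2,
      hzero]

/-- In terms of the covariant `gyroForm`, the brackets with Θ have one expression at both orders; it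
vanishes when the form does. -/
theorem brRTheta_eq (S : Data) (ord : GCOrder) (z : GCIdx → ℝ) (μ : Fin 4) :
    S.brRTheta ord z μ = ∑ ν, S.brRR ord z μ ν * S.gyroForm ord (zR z) ν := by
  cases ord
  · simp [brRTheta, gyroForm]
  · simp only [brRTheta, gyroForm, tvec, Rvec, eta_mulVec_eta_mulVec]
    rfl

theorem vdot_eta_mulVec (u v : Vec) : vdot u (eta.mulVec v) = ∑ ν, u ν * v ν := by
  rw [vdot_eq, eta_mulVec_eta_mulVec]; rfl

theorem brKTheta_eq (S : Data) (ord : GCOrder) (z : GCIdx → ℝ) :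
    S.brKTheta ord z = -∑ ν, S.brRK ord z ν * S.gyroForm ord (zR z) ν := by
  cases ord
  · simp [brKTheta, gyroForm]
  · simp [brKTheta, gyroForm, Rvec, vdot_eta_mulVec]

theorem brBTheta_eq (S : Data) (ord : GCOrder) (z : GCIdx → ℝ) :
    S.brBTheta ord z = -∑ ν, S.brRB ord z ν * S.gyroForm ord (zR z) ν := by
  cases ord
  · simp [brBTheta, gyroForm]
  · simp [brBTheta, gyroForm, Rvec, vdot_eta_mulVec]

/-- For square matrices a one-sided inverse suffices. The blocks reduce to `bracket_relations`; the
entries in the Θ column repeat the relations for R contracted with the gyrogauge form, since {·, Θ}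
= {·, R} · 𝓡. -/
theorem omega_mul_gcTensor (hS : S.Admissible O) (ord : GCOrder) (hz : z ∈ S.domain ord O) :
    S.omega ord z * S.gcTensor ord z = 1 := by
  obtain ⟨h1, h2, h3, ⟨h4, h5, h6, h7⟩, h8, h9⟩ := hS.bracket_relations ord hz
  have hm := hS.m_pos.ne'
  have hK := hz.2.1.ne'
  have hε := hS.ε_ne
  set t := S.that (zR z) (zB z)
  set b := S.bhat (zR z) (zB z)
  have e1 : ∀ μ ν : Fin 4, ∑ σ, raise (S.field ord z) μ σ * S.brRR ord z σ ν
      + S.m * eta.mulVec t μ * S.brRK ord z ν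
      + S.m * zK z * eta.mulVec b μ * S.brRB ord z ν = (1 : Ten) μ ν := by
    intro μ ν
    have h := congrArg (eta * ·) h1
    simp only [Matrix.mul_add, Matrix.mul_smul, eta_mul_eta] at h
    have hd : ∀ u v : Vec, eta * dyad u v = dyad (eta.mulVec u) v := fun u v =>
      Matrix.mul_vecMulVec _ _ _
    rw [hd, hd, tdot, ← Matrix.mul_assoc, ← Matrix.mul_assoc] at h
    rw [← congrFun (congrFun h μ) ν]
    simp only [Matrix.add_apply, Matrix.smul_apply, dyad, Matrix.of_apply, smul_eq_mul, ← mul_assoc]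
    rfl
  have lower : ∀ (v w : Vec) (r : ℝ), tvec (S.field ord z) v + r • w = 0 → ∀ μ,
      ∑ σ, raise (S.field ord z) μ σ * v σ + r * eta.mulVec w μ = 0 := by
    intro v w r h μ
    have h := congrArg eta.mulVec h
    rw [Matrix.mulVec_add, Matrix.mulVec_smul, Matrix.mulVec_zero, tvec, Matrix.mulVec_mulVec,
      Matrix.mulVec_mulVec] at h
    exact congrFun h μ
  have e2 := lower _ _ _ h2
  have e3 := lower _ _ _ h3
  have dot : ∀ u v : Vec, vdot u v = ∑ σ, eta.mulVec u σ * v σ := by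
    intro u v
    rw [vdot_comm, vdot_eq]
    exact dotProduct_comm _ _
  rw [dot] at h4 h5 h6 h7
  have e8 : ∀ ν, ∑ σ, eta.mulVec t σ * S.brRR ord z σ ν = 0 := by
    intro ν
    have := congrFun h8 ν
    rw [vten, Matrix.mulVec_transpose] at this
    exact this
  have e9 : ∀ ν, ∑ σ, eta.mulVec b σ * S.brRR ord z σ ν = 0 := by
    intro ν
    have := congrFun h9 ν
    rw [vten, Matrix.mulVec_transpose] at this
    exact this
  have hanti : ∀ i j, S.brRR ord z i j = -S.brRR ord z j i := by
    intro i j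
    have h : S.F0 (zR z) i j = -S.F0 (zR z) j i :=
      congrFun (congrFun (F0_antisymm S (zR z)) j) i
    simp only [brRR, Matrix.smul_apply, h, smul_neg]
  have hd : ∀ i, S.brRR ord z i i = 0 := fun i => self_eq_neg.1 (hanti i i)
  have o21 : ∀ k ν : Fin 4, S.omega ord z (.inr k) (.inl ν) = -S.omega ord z (.inl ν) (.inr k) :=
    fun k ν => extD_antisymm _ _ _ _
  ext (μ | k) (ν | l)
  · have h := e1 μ ν
    rw [Matrix.mul_apply, Fintype.sum_sum_type]
    simp only [hS.omega_inl_inl hz.1, hS.omega_inl_inr hz.1, gcTensor, Matrix.of_apply,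
      Fin.sum_univ_four] at h ⊢
    rw [show (1 : Matrix GCIdx GCIdx ℝ) (.inl μ) (.inl ν) = (1 : Ten) μ ν by
      simp [Matrix.one_apply], ← h]
    simp
    ring
  · have g2 := e2 μ
    have g3 := e3 μ
    have g1 := e1 μ
    rw [Matrix.mul_apply, Fintype.sum_sum_type]
    simp only [hS.omega_inl_inl hz.1, hS.omega_inl_inr hz.1, gcTensor, Matrix.of_apply,
      Fin.sum_univ_four] at g1 g2 g3 ⊢
    rw [Matrix.one_apply_ne (by simp)]
    fin_cases l
    · simp
      linear_combination g2
    · simp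
      linear_combination g3
    · simp
    · simp only [brRTheta_eq, brKTheta_eq, brBTheta_eq, Fin.sum_univ_four]
      set ρ := S.gyroForm ord (zR z)
      -- Writing the form as the unit matrix times itself lets the R–R relation `e1` be contracted
      -- with it.
      have hρ : ρ μ = ∑ ν, (1 : Ten) μ ν * ρ ν := by simp [Matrix.one_apply]
      rw [Fin.sum_univ_four, ← g1, ← g1, ← g1, ← g1] at hρ
      simp
      field_simp
      linear_combination -hρ
  · have g8 := e8 ν
    have g9 := e9 ν
    rw [Matrix.mul_apply, Fintype.sum_sum_type, Matrix.one_apply_ne (by simp)]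
    simp only [o21, hS.omega_inl_inr hz.1, omega_inr_inr, gcTensor, Matrix.of_apply,
      Fin.sum_univ_four] at g8 g9 ⊢
    fin_cases k
    · simp
      linear_combination S.m * g8
    · simp
      linear_combination S.m * zK z * g9
    · simp [brRTheta_eq, Fin.sum_univ_four, hanti _ ν]
      ring
    · simp
  · rw [Matrix.mul_apply, Fintype.sum_sum_type,
      show (1 : Matrix GCIdx GCIdx ℝ) (.inr k) (.inr l) = (1 : Ten) k l by
      simp [Matrix.one_apply]]
    simp only [o21, hS.omega_inl_inr hz.1, omega_inr_inr, gcTensor, Matrix.of_apply,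
      brRTheta_eq, brKTheta_eq, brBTheta_eq, Fin.sum_univ_four] at e8 e9 h4 h5 h6 h7 ⊢
    set ρ := S.gyroForm ord (zR z)
    fin_cases k
    · fin_cases l
      · simp
        field_simp at h4
        linear_combination h4
      · simp
        linear_combination S.m * h5
      · simp
      · simp
        linear_combination S.m * (e8 0 * ρ 0 + e8 1 * ρ 1 + e8 2 * ρ 2 + e8 3 * ρ 3)
    · fin_cases l
      · simp
        linear_combination S.m * zK z * h6
      · simp
        field_simp at h7
        linear_combination h7
      · simp
      · simp
        linear_combination S.m * zK z * (e9 0 * ρ 0 + e9 1 * ρ 1 + e9 2 * ρ 2 + e9 3 * ρ 3)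
    · fin_cases l
      · simp
        ring
      · simp
        ring
      · simp [hε]
      · simp
        -- The entry is proportional to 𝓡 · {R, R} · 𝓡, which vanishes by antisymmetry.
        rw [hanti 1 0, hanti 2 0, hanti 3 0, hanti 2 1, hanti 3 1, hanti 3 2, hd 0, hd 1, hd 2,
          hd 3]
        ring
    · fin_cases l <;> simp [hε]

theorem isUnit_det_omega (hS : S.Admissible O) (ord : GCOrder) (hz : z ∈ S.domain ord O) :
    IsUnit (S.omega ord z).det :=
  Matrix.isUnit_det_of_right_inverse (hS.omega_mul_gcTensor ord hz)

theorem poisson_eq_gcTensor (hS : S.Admissible O) (ord : GCOrder) (hz : z ∈ S.domain ord O) :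
    S.poisson ord z = S.gcTensor ord z :=
  Matrix.inv_eq_right_inv (hS.omega_mul_gcTensor ord hz)

theorem contDiffAt_omega (hS : S.Admissible O) (ord : GCOrder) (hz : zR z ∈ O) (i j : GCIdx) :
    ContDiffAt ℝ ∞ (fun y => S.omega ord y i j) z :=
  contDiffAt_extD (hS.contDiffAt_action hz ord) i j

theorem omega_closed (hS : S.Admissible O) (ord : GCOrder) (hz : zR z ∈ O) (i j k : GCIdx) :
    pd (fun y => S.omega ord y j k) i z + pd (fun y => S.omega ord y k i) j z
      + pd (fun y => S.omega ord y i j) k z = 0 :=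
  extD_closed (hS.contDiffAt_action hz ord) i j k

theorem contDiffAt_poisson (hS : S.Admissible O) (ord : GCOrder) (hz : z ∈ S.domain ord O)
    (i j : GCIdx) : ContDiffAt ℝ ∞ (fun y => S.poisson ord y i j) z :=
  contDiffAt_inv_apply (hS.contDiffAt_omega ord hz.1) (hS.isUnit_det_omega ord hz) i j

theorem isPoissonOn_poisson (hS : S.Admissible O) (ord : GCOrder) :
    IsPoissonOn (S.poisson ord) (S.domain ord O) :=
  isPoissonOn_inv (hS.isOpen_domain ord) (fun _ hz => hS.contDiffAt_omega ord hz.1)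
    (fun _ hz => hS.isUnit_det_omega ord hz) (fun _ _ i j => extD_antisymm _ _ i j)
    (fun _ hz => hS.omega_closed ord hz.1)

end Data.Admissible
end GuidingCenter

/-! ### The extended phase space and the map to the gauge-invariant coordinates -/

namespace GuidingCenter

section LocalInverse

/-- The inverse function theorem: in equal finite dimensions an injective derivative is an
isomorphism. Only the right-inverse property near the image point is kept. -/
theorem exists_smooth_section {E F : Type*} [NormedAddCommGroup E] [NormedSpace ℝ E]
    [FiniteDimensional ℝ E] [NormedAddCommGroup F] [NormedSpace ℝ F] [FiniteDimensional ℝ F]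
    {φ : E → F} {y : E} (hφ : ContDiffAt ℝ ∞ φ y) (hinj : ∀ v, fderiv ℝ φ y v = 0 → v = 0)
    (hdim : Module.finrank ℝ E = Module.finrank ℝ F) :
    ∃ σ : F → E, ContDiffAt ℝ ∞ σ (φ y) ∧ σ (φ y) = y ∧ ∀ᶠ Z in nhds (φ y), φ (σ Z) = Z := by
  have : CompleteSpace E := FiniteDimensional.complete ℝ E
  let A : E ≃L[ℝ] F := (LinearMap.linearEquivOfInjective (fderiv ℝ φ y : E →ₗ[ℝ] F)
    ((injective_iff_map_eq_zero _).2 hinj) hdim).toContinuousLinearEquiv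
  have hA : HasFDerivAt φ (A : E →L[ℝ] F) y := by
    have : (A : E →L[ℝ] F) = fderiv ℝ φ y := by ext v; rfl
    rw [this]; exact hφ.diff.hasFDerivAt
  refine ⟨hφ.localInverse hA (by simp), hφ.to_localInverse hA (by simp),
    hφ.localInverse_apply_image hA (by simp), ?_⟩
  exact (hφ.hasStrictFDerivAt' hA (by simp)).eventually_right_inverse

theorem fderiv_eq_deriv_line {E : Type*} [NormedAddCommGroup E] [NormedSpace ℝ E] {f : E → ℝ}
    {y : E} (hf : DifferentiableAt ℝ f y) (v : E) :
    fderiv ℝ f y v = deriv (fun t : ℝ => f (y + t • v)) 0 :=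
  hf.lineDeriv_eq_fderiv.symm

theorem mul_mul_transpose_apply {ι κ : Type} [Fintype ι] (A : Matrix κ ι ℝ) (J : Matrix ι ι ℝ)
    (a b : κ) : (A * J * A.transpose) a b = ∑ i, ∑ j, A a i * J i j * A b j := by
  simp only [Matrix.mul_apply, Matrix.transpose_apply, Finset.sum_mul]
  exact Finset.sum_comm

theorem pd_add_right {ι : Type} [Fintype ι] [DecidableEq ι] (f : (ι → ℝ) → ℝ) (i : ι)
    (z w : ι → ℝ) : pd f i (z + w) = pd (fun y => f (y + w)) i z := by
  simp only [pd, fderiv_comp_add_right]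

end LocalInverse

theorem contDiffAt_base (y : ExtIdx → ℝ) : ContDiffAt ℝ ∞ base y :=
  contDiffAt_pi.2 fun i => contDiffAt_apply ℝ ℝ (Sum.inl i) y

theorem contDiffAt_invR (Z : InvIdx → ℝ) : ContDiffAt ℝ ∞ invR Z :=
  contDiffAt_pi.2 fun μ => contDiffAt_apply ℝ ℝ (Sum.inl μ) Z

theorem contDiffAt_invU (Z : InvIdx → ℝ) : ContDiffAt ℝ ∞ invU Z :=
  contDiffAt_pi.2 fun μ => contDiffAt_apply ℝ ℝ (Sum.inr (.inl μ)) Z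

theorem contDiffAt_invMu (Z : InvIdx → ℝ) : ContDiffAt ℝ ∞ invMu Z :=
  contDiffAt_apply ℝ ℝ _ Z

theorem contDiffAt_invAlpha (Z : InvIdx → ℝ) : ContDiffAt ℝ ∞ invAlpha Z :=
  contDiffAt_pi.2 fun μ => contDiffAt_apply ℝ ℝ (Sum.inr (.inr (.inr μ))) Z

theorem smV_invU (Z : InvIdx → ℝ) : SmV invU Z := contDiffAt_pi.1 (contDiffAt_invU Z)
theorem smV_invAlpha (Z : InvIdx → ℝ) : SmV invAlpha Z := contDiffAt_pi.1 (contDiffAt_invAlpha Z)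

namespace Data

theorem toInv_invR (S : Data) (y : ExtIdx → ℝ) : invR (S.toInv y) = zR (base y) := rfl
theorem toInv_invMu (S : Data) (y : ExtIdx → ℝ) : invMu (S.toInv y) = zMu (base y) := rfl

theorem toInv_invU (S : Data) (y : ExtIdx → ℝ) :
    invU (S.toInv y) = (S.frame (zR (base y)) (zB (base y)) (zTheta (base y))).mulVec
      ![zK (base y), 0, y (.inr 0) / S.lamB (zR (base y)) / √(y (.inr 4)),
        y (.inr 1) / √(y (.inr 4))] := by
  have h : ∀ a b c : ℝ, (![a, 0, b, c] : Vec)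
      = a • ![1, 0, 0, 0] + b • ![0, 0, 1, 0] + c • ![0, 0, 0, 1] := by
    intro a b c; ext i; fin_cases i <;> simp
  rw [h, Matrix.mulVec_add, Matrix.mulVec_add, Matrix.mulVec_smul, Matrix.mulVec_smul,
    Matrix.mulVec_smul, ← frame_mulVec_that, ← frame_mulVec_chat, ← frame_mulVec_ahat]
  ext μ
  simp only [invU, toInv, Pi.add_apply, Pi.smul_apply, smul_eq_mul]
  ring

theorem toInv_invAlpha (S : Data) (y : ExtIdx → ℝ) :
    invAlpha (S.toInv y) = (S.frame (zR (base y)) (zB (base y)) (zTheta (base y))).mulVec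
      ![-y (.inr 2) / zK (base y), y (.inr 3) / S.lamB (zR (base y)) / zK (base y), 0,
        √(y (.inr 4))] := by
  have h : ∀ a b c : ℝ, (![a, b, 0, c] : Vec)
      = a • ![1, 0, 0, 0] + b • ![0, 1, 0, 0] + c • ![0, 0, 0, 1] := by
    intro a b c; ext i; fin_cases i <;> simp
  rw [h, Matrix.mulVec_add, Matrix.mulVec_add, Matrix.mulVec_smul, Matrix.mulVec_smul,
    Matrix.mulVec_smul, ← frame_mulVec_that S _ _ (zTheta (base y)),
    ← frame_mulVec_bhat, ← frame_mulVec_ahat]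
  ext μ
  simp only [invAlpha, toInv, Pi.add_apply, Pi.smul_apply, smul_eq_mul]
  ring

theorem jacInv_mulVec (S : Data) {y : ExtIdx → ℝ} (h : DifferentiableAt ℝ S.toInv y)
    (v : ExtIdx → ℝ) : (S.jacInv y).mulVec v = fderiv ℝ S.toInv y v := by
  ext a
  have h2 : fderiv ℝ (fun y => S.toInv y a) y = (ContinuousLinearMap.proj a).comp
      (fderiv ℝ S.toInv y) :=
    ((ContinuousLinearMap.proj (R := ℝ) (φ := fun _ : InvIdx => ℝ) a).hasFDerivAt.comp y
      h.hasFDerivAt).fderiv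
  have h3 := fderiv_apply_eq_sum_pd (fun y => S.toInv y a) y v
  rw [h2] at h3
  rw [show fderiv ℝ S.toInv y v a = ((ContinuousLinearMap.proj a).comp
      (fderiv ℝ S.toInv y)) v from rfl, h3]
  simp only [Matrix.mulVec, dotProduct, jacInv, Matrix.of_apply, mul_comm]

end Data

namespace Data.Admissible

variable {S : Data} {O : Set Vec} {ord : GCOrder} {y : ExtIdx → ℝ}

theorem isOpen_extDomain (hS : S.Admissible O) (ord : GCOrder) : IsOpen (S.extDomain ord O) := by
  rw [isOpen_iff_mem_nhds]
  rintro y ⟨h1, h2⟩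
  filter_upwards [(contDiffAt_base y).continuousAt.preimage_mem_nhds
      ((hS.isOpen_domain ord).mem_nhds h1),
    (continuous_apply (Sum.inr 4 : ExtIdx)).continuousAt.preimage_mem_nhds
      (isOpen_Ioi.mem_nhds h2)] with w a b
  exact ⟨a, b⟩

theorem contDiffAt_extPoisson (hS : S.Admissible O) (hy : y ∈ S.extDomain ord O) (a b : ExtIdx) :
    ContDiffAt ℝ ∞ (fun w => S.extPoisson ord w a b) y := by
  obtain i | i := a <;> obtain j | j := b
  · exact ContDiffAt.comp y (hS.contDiffAt_poisson ord hy.1 i j) (contDiffAt_base y)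
  all_goals exact contDiffAt_const

theorem isPoissonOn_extPoisson (hS : S.Admissible O) (ord : GCOrder) :
    IsPoissonOn (S.extPoisson ord) (S.extDomain ord O) := by
  have hP := hS.isPoissonOn_poisson ord
  refine ⟨hS.isOpen_extDomain ord, fun a b w hw =>
    (hS.contDiffAt_extPoisson hw a b).contDiffWithinAt, ?_, ?_⟩
  · intro y hy a b
    obtain i | i := a <;> obtain j | j := b
    · exact hP.antisymm _ hy.1 i j
    all_goals simp [extPoisson]
  · intro y hy
    -- Inclusion of the slice through `y` with the appended coordinates fixed. It relates the two
    -- brackets, because those coordinates commute with everything, so the Jacobi identity is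
    -- transported along it.
    let φ : (GCIdx → ℝ) → ExtIdx → ℝ := fun z => Sum.elim z fun k => y (.inr k)
    have hφy : φ (base y) = y := by ext (i | k) <;> rfl
    have hb : ∀ z, base (φ z) = z := fun _ => rfl
    have hφ : ∀ z, ContDiffAt ℝ ∞ φ z := by
      intro z
      refine contDiffAt_pi.2 ?_
      rintro (i | k)
      · exact contDiffAt_apply ℝ ℝ i z
      · exact contDiffAt_const
    have hD : ∀ z ∈ S.domain ord O, φ z ∈ S.extDomain ord O := fun z hz => ⟨hz, hy.2⟩
    rw [← hφy]
    refine jacobi_push hP.isOpen (fun z _ => hφ z) ?_ (hS.isOpen_extDomain ord) hD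
      (fun z hz a b => hS.contDiffAt_extPoisson (hD z hz) a b) hP.jacobi hy.1
    intro z hz a b
    obtain i | i := a <;> obtain j | j := b <;>
      simp [extPoisson, φ, pd_proj, pd_const, hb, Finset.sum_ite_eq]

theorem contDiffAt_toInv (hS : S.Admissible O) (hy : y ∈ S.extDomain ord O) :
    ContDiffAt ℝ ∞ S.toInv y := by
  have hO := hy.1.1
  have cb := contDiffAt_base y
  have cR : ContDiffAt ℝ ∞ (fun w => zR (base w)) y :=
    ContDiffAt.comp y (contDiffAt_zR _) cb
  have cK : ContDiffAt ℝ ∞ (fun w => zK (base w)) y := ContDiffAt.comp y (contDiffAt_zK _) cb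
  have cB : ContDiffAt ℝ ∞ (fun w => zB (base w)) y := ContDiffAt.comp y (contDiffAt_zB _) cb
  have cT : ContDiffAt ℝ ∞ (fun w => zTheta (base w)) y :=
    ContDiffAt.comp y (contDiffAt_zTheta _) cb
  have cC : ∀ k : Fin 5, ContDiffAt ℝ ∞ (fun w : ExtIdx → ℝ => w (.inr k)) y :=
    fun k => contDiffAt_apply ℝ ℝ _ y
  have cl : ContDiffAt ℝ ∞ (fun w => S.lamB (zR (base w))) y :=
    ContDiffAt.comp (g := S.lamB) (f := fun w => zR (base w)) y (hS.contDiffAt_lamB hO) cR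
  have hl := (hS.lamB_pos _ hO).ne'
  have cs : ContDiffAt ℝ ∞ (fun w : ExtIdx → ℝ => √(w (.inr 4))) y := (cC 4).sqrt hy.2.ne'
  have hs : √(y (.inr 4)) ≠ 0 := (Real.sqrt_pos.2 hy.2).ne'
  have ht := smV_that_param (X := fun w => zR (base w)) (hS.smV_e hO 0) (hS.smV_e hO 1) cR cB
  have hb := smV_bhat_param (X := fun w => zR (base w)) (hS.smV_e hO 0) (hS.smV_e hO 1) cR cB
  have hc := smV_chat_param (X := fun w => zR (base w)) (hS.smV_e hO 2) (hS.smV_e hO 3) cR cT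
  have ha := smV_ahat_param (X := fun w => zR (base w)) (hS.smV_e hO 2) (hS.smV_e hO 3) cR cT
  refine contDiffAt_pi.2 ?_
  rintro (μ | μ | μ | μ)
  · exact contDiffAt_apply ℝ ℝ _ y
  · exact (cK.mul (ht μ)).add ((contDiffAt_const.div cs hs).mul
      ((((cC 0).div cl hl).mul (hc μ)).add ((cC 1).mul (ha μ))))
  · exact contDiffAt_apply ℝ ℝ _ y
  · exact (cs.mul (ha μ)).add ((contDiffAt_const.div cK hy.1.2.1.ne').mul
      (((cC 2).neg.mul (ht μ)).add (((cC 3).div cl hl).mul (hb μ))))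

/-- In the frame, U has components along t̂, ĉ, â and α̂ along t̂, b̂, â. Each constraint therefore
reduces to a single product, and the factors K, λ_B, √C₃ in the definition of the map cancel. -/
theorem constraint_toInv (hS : S.Admissible O) (hy : y ∈ S.extDomain ord O) (k : Fin 5) :
    S.constraint k (S.toInv y) = y (.inr k) := by
  have hO := hy.1.1
  have hE := hS.frame_orthonormal hO (zB (base y)) (zTheta (base y))
  have hl := (hS.lamB_pos _ hO).ne'
  have hK := hy.1.2.1.ne'
  have hs : √(y (.inr 4)) ≠ 0 := (Real.sqrt_pos.2 hy.2).ne'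
  have hs2 : √(y (.inr 4)) * √(y (.inr 4)) = y (.inr 4) := Real.mul_self_sqrt hy.2.le
  unfold constraint
  rw [toInv_invR, toInv_invU, toInv_invAlpha, hS.F0_eq hO (zB (base y)) (zTheta (base y)),
    hS.dualF0_eq hO (zB (base y)) (zTheta (base y)),
    hS.Pperp_eq hO (zB (base y)) (zTheta (base y)),
    hS.Ppar_eq hO (zB (base y)) (zTheta (base y))]
  simp only [tvec_conj hE, vdot_conj hE, frameF, frameDual, tvec_explicit, vdot_explicit]
  fin_cases k
  · simp; field_simp
  · simp; field_simp
  · simp; field_simp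
  · simp; field_simp
  · simpa using hs2

/-- Components of `U` and `α̂` along the tetrad. -/
theorem tetrad_readout (hS : S.Admissible O) (hO : zR (base y) ∈ O) :
    vdot (S.e 0 (zR (base y))) (invU (S.toInv y)) = -(zK (base y) * Real.cosh (zB (base y))) ∧
    vdot (S.e 1 (zR (base y))) (invU (S.toInv y)) = zK (base y) * Real.sinh (zB (base y)) ∧
    vdot (S.e 2 (zR (base y))) (invAlpha (S.toInv y))
      = √(y (.inr 4)) * Real.cos (zTheta (base y)) ∧
    vdot (S.e 3 (zR (base y))) (invAlpha (S.toInv y))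
      = -(√(y (.inr 4)) * Real.sin (zTheta (base y))) := by
  have hE := hS.tetrad_orthonormal hO
  have he : ∀ i, S.e i (zR (base y)) = (S.tetrad (zR (base y))).mulVec (Pi.single i 1) := by
    intro i; ext μ; simp [tetrad]
  rw [toInv_invU, toInv_invAlpha, frame, ← Matrix.mulVec_mulVec, ← Matrix.mulVec_mulVec, he, he,
    he, he, vdot_conj hE, vdot_conj hE, vdot_conj hE, vdot_conj hE]
  refine ⟨?_, ?_, ?_, ?_⟩ <;>
  simp [vdot_eq, boostRot, eta_explicit, Matrix.mulVec, dotProduct, Fin.sum_univ_four]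

end Data.Admissible
end GuidingCenter

/-! ### The push-forward Poisson structure -/

namespace GuidingCenter

namespace Data

/-- The push-forward of the extended Poisson tensor to the coordinates `(R, U, μ, α̂)`. -/
noncomputable def invPoisson (S : Data) (ord : GCOrder) (O : Set Vec) (Z : InvIdx → ℝ) :
    Matrix InvIdx InvIdx ℝ :=
  open Classical in
  if h : ∃ y ∈ S.extDomain ord O, S.toInv y = Z then
    S.jacInv h.choose * S.extPoisson ord h.choose * (S.jacInv h.choose).transpose
  else 0

end Data

namespace Data.Admissible

variable {S : Data} {O : Set Vec} {ord : GCOrder} {y : ExtIdx → ℝ}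

theorem contDiffAt_constraint (hS : S.Admissible O) {Z : InvIdx → ℝ} (hZ : invR Z ∈ O)
    (k : Fin 5) : ContDiffAt ℝ ∞ (S.constraint k) Z := by
  have cR := contDiffAt_invR Z
  fin_cases k
  · exact contDiffAt_vdot (smV_invU Z) (SmV.tvec ((hS.smT_F0 hZ).comp cR) (smV_invAlpha Z))
  · exact contDiffAt_vdot (smV_invU Z) (SmV.tvec ((hS.smT_Pperp hZ).comp cR) (smV_invAlpha Z))
  · exact contDiffAt_vdot (smV_invU Z) (SmV.tvec ((hS.smT_Ppar hZ).comp cR) (smV_invAlpha Z))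
  · exact contDiffAt_vdot (smV_invU Z) (SmV.tvec ((hS.smT_dualF0 hZ).comp cR) (smV_invAlpha Z))
  · exact contDiffAt_vdot (smV_invAlpha Z)
      (SmV.tvec ((hS.smT_Pperp hZ).comp cR) (smV_invAlpha Z))

theorem eventually_mem_extDomain (hS : S.Admissible O) (hy : y ∈ S.extDomain ord O) :
    ∀ᶠ w in nhds y, w ∈ S.extDomain ord O :=
  (hS.isOpen_extDomain ord).mem_nhds hy

/-- No Jacobian determinant is computed. A vector in the kernel is annihilated by the derivative of
every function of the image; the constraints, R, μ and the tetrad components of U and α̂ are such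
functions, and together they determine all its components. -/
theorem eq_zero_of_fderiv_toInv (hS : S.Admissible O) (hy : y ∈ S.extDomain ord O)
    {v : ExtIdx → ℝ} (hv : fderiv ℝ S.toInv y v = 0) : v = 0 := by
  have hO := hy.1.1
  have hK := hy.1.2.1
  have hd := (hS.contDiffAt_toInv hy).diff
  -- If `G` on the image pulls back to `g`, the derivative of `g` along a kernel vector is zero.
  have chain : ∀ (G : (InvIdx → ℝ) → ℝ) (g : (ExtIdx → ℝ) → ℝ),
      DifferentiableAt ℝ G (S.toInv y) → (∀ w ∈ S.extDomain ord O, G (S.toInv w) = g w) →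
      deriv (fun t : ℝ => g (y + t • v)) 0 = 0 := by
    intro G g hG hg
    have he : (fun w => G (S.toInv w)) =ᶠ[nhds y] g :=
      (hS.eventually_mem_extDomain hy).mono fun w hw => hg w hw
    have h1 : fderiv ℝ (fun w => G (S.toInv w)) y
      = (fderiv ℝ G (S.toInv y)).comp (fderiv ℝ S.toInv y) := fderiv_comp y hG hd
    rw [← fderiv_eq_deriv_line ((hG.comp y hd).congr_of_eventuallyEq he.symm), ← he.fderiv_eq, h1,
      ContinuousLinearMap.comp_apply, hv, map_zero]
  have lin : ∀ j : ExtIdx, deriv (fun t : ℝ => (y + t • v) j) 0 = v j := by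
    intro j
    simp
  have hC : ∀ k : Fin 5, v (.inr k) = 0 := by
    intro k
    rw [← lin]
    exact chain (S.constraint k) (fun w => w (.inr k)) (hS.contDiffAt_constraint (Z := S.toInv y) hO k).diff
      fun w hw => hS.constraint_toInv hw k
  have hR : ∀ μ : Fin 4, v (.inl (.inl μ)) = 0 := by
    intro μ
    rw [← lin]
    exact chain (fun Z => Z (.inl μ)) (fun w => w (.inl (.inl μ)))
      (differentiableAt_apply (𝕜 := ℝ) _ _) fun w hw => rfl
  have hMu : v (.inl (.inr 2)) = 0 := by
    rw [← lin]
    exact chain invMu (fun w => w (.inl (.inr 2))) (contDiffAt_invMu _).diff fun w hw => rfl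
  have smU : ∀ i, DifferentiableAt ℝ (fun Z => vdot (S.e i (invR Z)) (invU Z)) (S.toInv y) :=
    fun i => (contDiffAt_vdot (SmV.comp (φ := invR) (hS.smV_e hO i) (contDiffAt_invR _)) (smV_invU _)).diff
  have smA : ∀ i, DifferentiableAt ℝ (fun Z => vdot (S.e i (invR Z)) (invAlpha Z)) (S.toInv y) :=
    fun i => (contDiffAt_vdot (SmV.comp (φ := invR) (hS.smV_e hO i) (contDiffAt_invR _)) (smV_invAlpha _)).diff
  have r0 := chain _ _ (smU 0) fun w hw => (hS.tetrad_readout hw.1.1).1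
  have r1 := chain _ _ (smU 1) fun w hw => (hS.tetrad_readout hw.1.1).2.1
  have r2 := chain _ _ (smA 2) fun w hw => (hS.tetrad_readout hw.1.1).2.2.1
  have r3 := chain _ _ (smA 3) fun w hw => (hS.tetrad_readout hw.1.1).2.2.2
  have line : ∀ j : ExtIdx, HasDerivAt (fun t : ℝ => (y + t • v) j) (v j) 0 := by
    intro j
    simpa using ((hasDerivAt_id (0 : ℝ)).mul_const (v j)).const_add (y j)
  have lK := line (.inl (.inr 0))
  have lB := line (.inl (.inr 1))
  have lT := line (.inl (.inr 3))
  have d0 := (lK.mul lB.cosh).neg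
  have d1 := lK.mul lB.sinh
  -- The constraint components of the vector are already known to vanish, so √C₃ is constant along
  -- the line.
  have hs : ∀ t : ℝ, (y + t • v) (.inr 4) = y (.inr 4) := by
    intro t; simp [hC]
  have hs0 : √(y (.inr 4)) ≠ 0 := (Real.sqrt_pos.2 hy.2).ne'
  have d2 := lT.cos.const_mul √(y (.inr 4))
  have d3 := (lT.sin.const_mul √(y (.inr 4))).neg
  simp only [hs] at r2 r3
  replace r0 := d0.deriv.symm.trans r0
  replace r1 := d1.deriv.symm.trans r1
  replace r2 := d2.deriv.symm.trans r2
  replace r3 := d3.deriv.symm.trans r3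
  simp only [zero_smul, add_zero] at r0 r1 r2 r3
  change 0 < y (.inl (.inr 0)) at hK
  have hch := Real.cosh_sq (y (.inl (.inr 1)))
  have hcs := Real.sin_sq_add_cos_sq (y (.inl (.inr 3)))
  -- (K, 𝓑) and (√C₃, Θ) are hyperbolic and ordinary polar coordinates, with K and √C₃ positive. The
  -- relations are inverted using cosh² − sinh² = 1 and sin² + cos² = 1.
  have hvK : v (.inl (.inr 0)) = 0 := by
    linear_combination -Real.cosh (y (.inl (.inr 1))) * r0
      - Real.sinh (y (.inl (.inr 1))) * r1 - v (.inl (.inr 0)) * hch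
  have hvB : v (.inl (.inr 1)) = 0 := by
    have : y (.inl (.inr 0)) * v (.inl (.inr 1)) = 0 := by
      linear_combination Real.sinh (y (.inl (.inr 1))) * r0
        + Real.cosh (y (.inl (.inr 1))) * r1 - y (.inl (.inr 0)) * v (.inl (.inr 1)) * hch
    exact (mul_eq_zero.1 this).resolve_left hK.ne'
  have hvT : v (.inl (.inr 3)) = 0 := by
    have : √(y (.inr 4)) * v (.inl (.inr 3)) = 0 := by
      linear_combination -Real.sin (y (.inl (.inr 3))) * r2
        - Real.cos (y (.inl (.inr 3))) * r3 - √(y (.inr 4)) * v (.inl (.inr 3)) * hcs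
    exact (mul_eq_zero.1 this).resolve_left hs0
  ext ((μ | k) | k)
  · exact hR μ
  · fin_cases k
    · exact hvK
    · exact hvB
    · exact hMu
    · exact hvT
  · exact hC k

theorem exists_section (hS : S.Admissible O) (hy : y ∈ S.extDomain ord O) :
    ∃ σ : (InvIdx → ℝ) → ExtIdx → ℝ, ContDiffAt ℝ ∞ σ (S.toInv y) ∧ σ (S.toInv y) = y ∧
      ∀ᶠ Z in nhds (S.toInv y), σ Z ∈ S.extDomain ord O ∧ S.toInv (σ Z) = Z := by
  obtain ⟨σ, h1, h2, h3⟩ := exists_smooth_section (hS.contDiffAt_toInv hy)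
    (fun v hv => hS.eq_zero_of_fderiv_toInv hy hv) (by simp)
  refine ⟨σ, h1, h2, ?_⟩
  have := h1.continuousAt.eventually (p := fun w => w ∈ S.extDomain ord O)
    (by rw [h2]; exact hS.eventually_mem_extDomain hy)
  filter_upwards [this, h3] with Z a b
  exact ⟨a, b⟩

theorem isOpen_invDomain (hS : S.Admissible O) (ord : GCOrder) : IsOpen (S.invDomain ord O) := by
  rw [isOpen_iff_mem_nhds]
  rintro _ ⟨y, hy, rfl⟩
  obtain ⟨σ, -, -, h⟩ := hS.exists_section hy
  filter_upwards [h] with Z hZ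
  exact ⟨σ Z, hZ.1, hZ.2⟩

/-- Two points with the same image differ by a full turn of the gyroangle. -/
theorem push_eq_of_toInv_eq (hS : S.Admissible O) {y' : ExtIdx → ℝ}
    (hy : y ∈ S.extDomain ord O) (hy' : y' ∈ S.extDomain ord O) (h : S.toInv y' = S.toInv y) :
    S.jacInv y' * S.extPoisson ord y' * (S.jacInv y').transpose
      = S.jacInv y * S.extPoisson ord y * (S.jacInv y).transpose := by
  have hC : ∀ k : Fin 5, y' (.inr k) = y (.inr k) := fun k => by
    rw [← hS.constraint_toInv hy, ← hS.constraint_toInv hy', h]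
  have hR : zR (base y') = zR (base y) := by rw [← toInv_invR S, ← toInv_invR S, h]
  have hMu : zMu (base y') = zMu (base y) := by rw [← toInv_invMu S, ← toInv_invMu S, h]
  obtain ⟨a0, a1, a2, a3⟩ := hS.tetrad_readout hy.1.1
  obtain ⟨b0, b1, b2, b3⟩ := hS.tetrad_readout hy'.1.1
  rw [hR, h, a0] at b0
  rw [hR, h, a1] at b1
  rw [hR, h, a2, hC] at b2
  rw [hR, h, a3, hC] at b3
  have hK := hy.1.2.1
  have hK' := hy'.1.2.1
  have hs0 : √(y (.inr 4)) ≠ 0 := (Real.sqrt_pos.2 hy.2).ne'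
  -- K² is the difference of the squares of the ê₀ and ê₁ components of U, and K is positive on both
  -- sides.
  have hKK : zK (base y') = zK (base y) := by
    have : zK (base y') ^ 2 = zK (base y) ^ 2 := by
      have h1 := Real.cosh_sq (zB (base y))
      have h2 := Real.cosh_sq (zB (base y'))
      linear_combination (zK (base y)) ^ 2 * h1 - (zK (base y')) ^ 2 * h2
        + (zK (base y) * Real.cosh (zB (base y)) + zK (base y') * Real.cosh (zB (base y'))) * b0
        + (zK (base y) * Real.sinh (zB (base y)) + zK (base y') * Real.sinh (zB (base y'))) * b1
    exact (pow_left_inj₀ hK'.le hK.le two_ne_zero).1 this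
  have hBB : zB (base y') = zB (base y) := by
    rw [hKK] at b1
    exact Real.sinh_injective (mul_left_cancel₀ hK.ne' b1).symm
  have hcos : Real.cos (zTheta (base y)) = Real.cos (zTheta (base y')) :=
    mul_left_cancel₀ hs0 b2
  have hsin : Real.sin (zTheta (base y)) = Real.sin (zTheta (base y')) :=
    mul_left_cancel₀ hs0 (neg_inj.1 b3)
  -- The number of full turns need not be found: cos d = 1 and sin d = 0 are all that is used.
  set d := zTheta (base y') - zTheta (base y) with hd
  have hcd : Real.cos d = 1 := by
    rw [hd, Real.cos_sub, ← hcos, ← hsin]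
    linear_combination Real.sin_sq_add_cos_sq (zTheta (base y))
  have hsd : Real.sin d = 0 := by
    rw [hd, Real.sin_sub, ← hcos, ← hsin]; ring
  set w : ExtIdx → ℝ := Pi.single (.inl (.inr 3)) d with hw
  have hyw : y' = y + w := by
    ext ((μ | k) | k)
    · simpa [hw, zR, zK, zB, zMu, base] using congrFun hR μ
    · fin_cases k
      · simpa [hw, zR, zK, zB, zMu, base] using hKK
      · simpa [hw, zR, zK, zB, zMu, base] using hBB
      · simpa [hw, zR, zK, zB, zMu, base] using hMu
      · simp [hw, hd, zTheta, base]
    · simpa [hw] using hC k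
  have wC : ∀ (u : ExtIdx → ℝ) (k : Fin 5), (u + w) (.inr k) = u (.inr k) := by
    intro u k; simp [hw]
  have bR : ∀ u, zR (base (u + w)) = zR (base u) := by
    intro u; ext μ; simp [hw, zR, base]
  have bK : ∀ u, zK (base (u + w)) = zK (base u) := by
    intro u; simp [hw, zK, base]
  have bB : ∀ u, zB (base (u + w)) = zB (base u) := by
    intro u; simp [hw, zB, base]
  have bMu : ∀ u, zMu (base (u + w)) = zMu (base u) := by
    intro u; simp [hw, zMu, base]
  have bT : ∀ u, zTheta (base (u + w)) = zTheta (base u) + d := by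
    intro u; simp [hw, zTheta, base]
  have ha : ∀ x θ, S.ahat x (θ + d) = S.ahat x θ := by
    intro x θ; simp [ahat, Real.cos_add, Real.sin_add, hcd, hsd]
  have hc : ∀ x θ, S.chat x (θ + d) = S.chat x θ := by
    intro x θ; simp [chat, Real.cos_add, Real.sin_add, hcd, hsd]
  have hinv : ∀ u, S.toInv (u + w) = S.toInv u := by
    intro u
    ext (μ | μ | μ | μ)
    · exact congrFun (bR u) μ
    · simp only [toInv, bR, bK, bB, bT, wC, ha, hc]
    · exact bMu u
    · simp only [toInv, bR, bK, bB, bT, wC, ha]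
  -- The map and the action form are invariant under translation by `w`, so their partial
  -- derivatives agree at the two points.
  have hjac : S.jacInv y' = S.jacInv y := by
    ext a i
    simp only [jacInv, Matrix.of_apply, hyw, pd_add_right, hinv]
  have hact : ∀ z, S.action ord (z + base w) = S.action ord z := by
    intro z
    have h3 : ∀ i : GCIdx, i ≠ .inr 3 → (z + base w) i = z i := by
      intro i hi
      simp [hw, base, hi]
    have eR : zR (z + base w) = zR z := by ext μ; exact h3 _ (by simp)
    have eK : zK (z + base w) = zK z := h3 _ (by simp)
    have eB : zB (z + base w) = zB z := h3 _ (by simp)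
    have eMu : zMu (z + base w) = zMu z := h3 _ (by simp)
    ext (μ | k)
    · simp only [action_inl, eR, eK, eB, eMu]
    · simp only [action, eMu]
  have hpoi : S.extPoisson ord y' = S.extPoisson ord y := by
    have : S.omega ord (base y') = S.omega ord (base y) := by
      ext i j
      rw [hyw, show base (y + w) = base y + base w from rfl]
      simp only [omega, extD, Matrix.of_apply, pd_add_right, hact]
    simp only [extPoisson, poisson, this]
  rw [hjac, hpoi]

theorem invPoisson_toInv (hS : S.Admissible O) (hy : y ∈ S.extDomain ord O) :
    S.invPoisson ord O (S.toInv y)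
      = S.jacInv y * S.extPoisson ord y * (S.jacInv y).transpose := by
  have h : ∃ w ∈ S.extDomain ord O, S.toInv w = S.toInv y := ⟨y, hy, rfl⟩
  rw [invPoisson, dif_pos h]
  exact hS.push_eq_of_toInv_eq hy h.choose_spec.1 h.choose_spec.2

theorem invPoisson_toInv_apply (hS : S.Admissible O) (hy : y ∈ S.extDomain ord O)
    (a b : InvIdx) : S.invPoisson ord O (S.toInv y) a b
      = ∑ i, ∑ j, pd (fun w => S.toInv w a) i y * S.extPoisson ord y i j
        * pd (fun w => S.toInv w b) j y := by
  rw [hS.invPoisson_toInv hy, mul_mul_transpose_apply]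
  rfl

/-- The preimages picked by choice need not vary smoothly. Since the value is independent of the
preimage, a smooth local section may be used instead. -/
theorem contDiffAt_invPoisson (hS : S.Admissible O) (hy : y ∈ S.extDomain ord O)
    (a b : InvIdx) :
    ContDiffAt ℝ ∞ (fun Z => S.invPoisson ord O Z a b) (S.toInv y) := by
  obtain ⟨σ, h1, h2, h3⟩ := hS.exists_section hy
  have hσ : ContDiffAt ℝ ∞ (fun Z => ∑ i, ∑ j, pd (fun w => S.toInv w a) i (σ Z)
      * S.extPoisson ord (σ Z) i j * pd (fun w => S.toInv w b) j (σ Z)) (S.toInv y) := by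
    have c := fun a => contDiffAt_pi.1 (hS.contDiffAt_toInv hy) a
    have key : ContDiffAt ℝ ∞ (fun u => ∑ i, ∑ j, pd (fun w => S.toInv w a) i u
        * S.extPoisson ord u i j * pd (fun w => S.toInv w b) j u) y :=
      ContDiffAt.sum fun i _ => ContDiffAt.sum fun j _ =>
        ((contDiffAt_pd (c a) i).mul (hS.contDiffAt_extPoisson hy i j)).mul
          (contDiffAt_pd (c b) j)
    rw [← h2] at key
    exact ContDiffAt.comp (g := fun u => ∑ i, ∑ j, pd (fun w => S.toInv w a) i u
        * S.extPoisson ord u i j * pd (fun w => S.toInv w b) j u) (f := σ) (S.toInv y) key h1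
  refine hσ.congr_of_eventuallyEq ?_
  filter_upwards [h3] with Z hZ
  conv_lhs => rw [← hZ.2]
  exact hS.invPoisson_toInv_apply hZ.1 a b

theorem isPoissonOn_invPoisson (hS : S.Admissible O) (ord : GCOrder) :
    IsPoissonOn (S.invPoisson ord O) (S.invDomain ord O) := by
  have hE := hS.isPoissonOn_extPoisson ord
  refine ⟨hS.isOpen_invDomain ord, ?_, ?_, ?_⟩
  · rintro a b _ ⟨y, hy, rfl⟩
    exact (hS.contDiffAt_invPoisson hy a b).contDiffWithinAt
  · rintro _ ⟨y, hy, rfl⟩ a b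
    rw [hS.invPoisson_toInv_apply hy, hS.invPoisson_toInv_apply hy, Finset.sum_comm,
      ← Finset.sum_neg_distrib]
    refine Finset.sum_congr rfl fun i _ => ?_
    rw [← Finset.sum_neg_distrib]
    refine Finset.sum_congr rfl fun j _ => ?_
    rw [hE.antisymm y hy j i]
    ring
  · rintro _ ⟨y, hy, rfl⟩
    exact jacobi_push hE.isOpen (fun w hw => hS.contDiffAt_toInv hw)
      (fun w hw => hS.invPoisson_toInv_apply hw) (hS.isOpen_invDomain ord)
      (fun w hw => ⟨w, hw, rfl⟩) (fun w hw => hS.contDiffAt_invPoisson hw) hE.jacobi hy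

/-- A function whose pull-back depends on the constraint coordinates only, to first order, is a
Casimir function. -/
theorem casimirAt_of_pd_eq_zero (hS : S.Admissible O) (hy : y ∈ S.extDomain ord O)
    {C : (InvIdx → ℝ) → ℝ} (hC : DifferentiableAt ℝ C (S.toInv y))
    (h : ∀ i, pd (fun w => C (S.toInv w)) (.inl i) y = 0) :
    CasimirAt (S.invPoisson ord O) (S.invDomain ord O) C (S.toInv y) := by
  intro g hg
  have hg' : DifferentiableAt ℝ g (S.toInv y) :=
    (hg.contDiffAt ((hS.isOpen_invDomain ord).mem_nhds ⟨y, hy, rfl⟩)).diff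
  rw [bracket_push (hS.contDiffAt_toInv hy).diff (hS.invPoisson_toInv_apply hy) hC hg', bracket]
  simp [extPoisson, h]

theorem casimirAt_constraint (hS : S.Admissible O) (hy : y ∈ S.extDomain ord O) (k : Fin 5) :
    CasimirAt (S.invPoisson ord O) (S.invDomain ord O) (S.constraint k) (S.toInv y) := by
  refine hS.casimirAt_of_pd_eq_zero hy (hS.contDiffAt_constraint (Z := S.toInv y) hy.1.1 k).diff fun i => ?_
  rw [pd_congr ((hS.eventually_mem_extDomain hy).mono fun w hw => hS.constraint_toInv hw k), pd_proj]
  simp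

end Data.Admissible
end GuidingCenter

/-! ### The leaves of the hypersurface and the gradients on them -/

namespace GuidingCenter

theorem pd_vdot {ι : Type} [Fintype ι] [DecidableEq ι] {V W : (ι → ℝ) → Vec} {x : ι → ℝ}
    (hV : SmV V x) (hW : SmV W x) (i : ι) :
    pd (fun y => vdot (V y) (W y)) i x
      = vdot (fun ν => pd (fun y => V y ν) i x) (W x)
        + vdot (V x) fun ν => pd (fun y => W y ν) i x := by
  have h : ∀ u v : Vec, vdot u v = ∑ μ, eta μ μ * (u μ * v μ) := by
    intro u v
    rw [vdot_eq, dotProduct]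
    refine Finset.sum_congr rfl fun μ _ => ?_
    rw [eta_mulVec_apply]; ring
  simp only [h]
  rw [pd_sum _ fun μ _ => ((hV μ).diff.fun_mul (hW μ).diff).const_mul _,
    ← Finset.sum_add_distrib]
  refine Finset.sum_congr rfl fun μ _ => ?_
  rw [pd_const_mul _ ((hV μ).diff.fun_mul (hW μ).diff), pd_mul (hV μ).diff (hW μ).diff]
  ring

theorem eta_mul_dyad (u v : Vec) : eta * dyad u v = dyad (eta.mulVec u) v :=
  Matrix.mul_vecMulVec _ _ _

theorem tdot_eta_mul (A B : Ten) : A ⊡ (eta * B) = A * B := by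
  rw [tdot, Matrix.mul_assoc, ← Matrix.mul_assoc eta, eta_mul_eta, Matrix.one_mul]

theorem eta_mul_transpose_tdot (A B : Ten) : (eta * A).transpose ⊡ B = A.transpose * B := by
  rw [tdot, Matrix.transpose_mul, eta_transpose, Matrix.mul_assoc A.transpose, eta_mul_eta,
    Matrix.mul_one]

namespace Data

/-- The matrix of partial derivatives `∂_σ V^ν`. -/
noncomputable def jac (V : Vec → Vec) (x : Vec) : Ten :=
  Matrix.of fun σ ν => pd (fun y => V y ν) σ x

theorem grad_eq (V : Vec → Vec) (x : Vec) : grad V x = eta * jac V x := rfl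

/-- The embedding of the guiding-center phase space on which `C₁ₐ, C₁ᵦ, C₂ₐ, C₂ᵦ` vanish. -/
noncomputable def surf (S : Data) (r : ℝ) (z : GCIdx → ℝ) : InvIdx → ℝ :=
  S.toInv (Sum.elim z ![0, 0, 0, 0, r])

theorem invR_surf (S : Data) (r : ℝ) (z : GCIdx → ℝ) : invR (S.surf r z) = zR z := rfl
theorem invMu_surf (S : Data) (r : ℝ) (z : GCIdx → ℝ) : invMu (S.surf r z) = zMu z := rfl

theorem base_sumElim (z : GCIdx → ℝ) (C : Fin 5 → ℝ) : base (Sum.elim z C) = z := rfl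

theorem invU_surf (S : Data) (r : ℝ) (z : GCIdx → ℝ) :
    invU (S.surf r z) = zK z • S.that (zR z) (zB z) := by
  ext μ
  simp [surf, invU, toInv, base_sumElim]

theorem invAlpha_surf (S : Data) (r : ℝ) (z : GCIdx → ℝ) :
    invAlpha (S.surf r z) = √r • S.ahat (zR z) (zTheta z) := by
  ext μ
  simp [surf, invAlpha, toInv, base_sumElim]

/-- The Jacobian matrix of `surf`. -/
noncomputable def surfJac (S : Data) (r : ℝ) (z : GCIdx → ℝ) : Matrix InvIdx GCIdx ℝ :=
  Matrix.of fun a i =>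
    match a, i with
    | .inl μ, .inl σ => if μ = σ then 1 else 0
    | .inl _, .inr _ => 0
    | .inr (.inl μ), .inl σ => zK z * jac (fun y => S.that y (zB z)) (zR z) σ μ
    | .inr (.inl μ), .inr k =>
        ![S.that (zR z) (zB z) μ, zK z * S.bhat (zR z) (zB z) μ, 0, 0] k
    | .inr (.inr (.inl _)), .inl _ => 0
    | .inr (.inr (.inl _)), .inr k => ![0, 0, 1, 0] k
    | .inr (.inr (.inr μ)), .inl σ => √r * jac (fun y => S.ahat y (zTheta z)) (zR z) σ μ
    | .inr (.inr (.inr μ)), .inr k => ![0, 0, 0, √r * S.chat (zR z) (zTheta z) μ] k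

end Data

namespace Data.Admissible

variable {S : Data} {O : Set Vec} {z : GCIdx → ℝ}

theorem smV_ahat (hS : S.Admissible O) {x : Vec} (hx : x ∈ O) (θ : ℝ) :
    SmV (fun y => S.ahat y θ) x :=
  smV_ahat_param (X := fun y => y) (hS.smV_e hx 2) (hS.smV_e hx 3) contDiffAt_id
    contDiffAt_const

theorem smV_chat (hS : S.Admissible O) {x : Vec} (hx : x ∈ O) (θ : ℝ) :
    SmV (fun y => S.chat y θ) x :=
  smV_chat_param (X := fun y => y) (hS.smV_e hx 2) (hS.smV_e hx 3) contDiffAt_id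
    contDiffAt_const

theorem surf_mem {ord : GCOrder} {r : ℝ} (hr : 0 < r)
    (hz : z ∈ S.domain ord O) :
    (Sum.elim z ![0, 0, 0, 0, r] : ExtIdx → ℝ) ∈ S.extDomain ord O :=
  ⟨hz, hr⟩

theorem contDiffAt_surf (hS : S.Admissible O) {ord : GCOrder} {r : ℝ} (hr : 0 < r)
    (hz : z ∈ S.domain ord O) : ContDiffAt ℝ ∞ (S.surf r) z := by
  have h : ContDiffAt ℝ ∞ (fun w : GCIdx → ℝ => (Sum.elim w ![0, 0, 0, 0, r] : ExtIdx → ℝ)) z := by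
    refine contDiffAt_pi.2 ?_
    rintro (i | k)
    · exact contDiffAt_apply ℝ ℝ i z
    · exact contDiffAt_const
  exact ContDiffAt.comp z (hS.contDiffAt_toInv (surf_mem hr hz)) h

/-- The entries come from ∂t̂/∂𝓑 = b̂ and ∂â/∂Θ = ĉ, with the gradients of t̂ and â taken at fixed
angles. -/
theorem pd_surf (hS : S.Admissible O) {ord : GCOrder} {r : ℝ} (hr : 0 < r)
    (hz : z ∈ S.domain ord O) (a : InvIdx) (i : GCIdx) :
    pd (fun w => S.surf r w a) i z = S.surfJac r z a i := by
  have hd := (contDiffAt_pi.1 (hS.contDiffAt_surf hr hz) a).diff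
  have e : ∀ (k : Fin 4) s, zR (Function.update z (.inr k) s) = zR z :=
    fun k s => by ext; simp [zR]
  obtain μ | μ | μ | μ := a
  · change pd (fun w => w (.inl μ)) i z = _
    rw [pd_proj]
    obtain σ | k := i <;> simp [surfJac]
  · have hd' : DifferentiableAt ℝ (fun w => zK w * S.that (zR w) (zB w) μ) z := by
      refine hd.congr_of_eventuallyEq (Filter.Eventually.of_forall fun w => ?_)
      exact (congrFun (invU_surf S r w) μ).symm
    rw [show (fun w => S.surf r w (.inr (.inl μ))) = fun w => zK w * S.that (zR w) (zB w) μ from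
      funext fun w => congrFun (invU_surf S r w) μ]
    obtain σ | k := i
    · rw [pd_slice_left hd']
      exact pd_const_mul (zK z) (hS.smV_that hz.1 (zB z) μ).diff σ
    · rw [pd_eq_deriv hd']
      fin_cases k <;> simp [surfJac, zK, zB, that, bhat, e]
  · change pd (fun w => w (.inr 2)) i z = _
    rw [pd_proj]
    obtain σ | k := i
    · simp [surfJac]
    · fin_cases k <;> simp [surfJac]
  · have hd' : DifferentiableAt ℝ (fun w => √r * S.ahat (zR w) (zTheta w) μ) z := by
      refine hd.congr_of_eventuallyEq (Filter.Eventually.of_forall fun w => ?_)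
      exact (congrFun (invAlpha_surf S r w) μ).symm
    rw [show (fun w => S.surf r w (.inr (.inr (.inr μ))))
      = fun w => √r * S.ahat (zR w) (zTheta w) μ from
      funext fun w => congrFun (invAlpha_surf S r w) μ]
    obtain σ | k := i
    · rw [pd_slice_left hd']
      exact pd_const_mul (√r) (hS.smV_ahat hz.1 (zTheta z) μ).diff σ
    · rw [pd_eq_deriv hd']
      fin_cases k <;> simp [surfJac, zTheta, ahat, chat, e]

/-- The rows and columns of the appended coordinates are zero, so only derivatives along the leaf
contribute. -/
theorem invPoisson_surf (hS : S.Admissible O) {ord : GCOrder} {r : ℝ} (hr : 0 < r)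
    (hz : z ∈ S.domain ord O) (a b : InvIdx) :
    S.invPoisson ord O (S.surf r z) a b
      = ∑ i, ∑ j, pd (fun w => S.surf r w a) i z * S.poisson ord z i j
        * pd (fun w => S.surf r w b) j z := by
  have hm := surf_mem hr hz
  rw [surf, hS.invPoisson_toInv_apply hm]
  have h : ∀ a i, pd (fun w => S.toInv w a) (.inl i) (Sum.elim z ![0, 0, 0, 0, r])
      = pd (fun w => S.surf r w a) i z := fun a i =>
    pd_slice_left (contDiffAt_pi.1 (hS.contDiffAt_toInv hm) a).diff i
  simp [extPoisson, h, base_sumElim]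

/-! The frame vectors as vector fields of the position. -/

theorem vdot_frame (hS : S.Admissible O) {x : Vec} (hx : x ∈ O) (β θ : ℝ) :
    vdot (S.that x β) (S.that x β) = -1 ∧ vdot (S.bhat x β) (S.bhat x β) = 1 ∧
    vdot (S.that x β) (S.bhat x β) = 0 ∧ vdot (S.chat x θ) (S.chat x θ) = 1 ∧
    vdot (S.ahat x θ) (S.ahat x θ) = 1 ∧ vdot (S.chat x θ) (S.ahat x θ) = 0 := by
  have hE := hS.frame_orthonormal hx β θ
  rw [frame_mulVec_that S x β θ, frame_mulVec_bhat S x β θ, frame_mulVec_chat S x β θ,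
    frame_mulVec_ahat S x β θ]
  simp only [vdot_conj hE, vdot_explicit]
  norm_num

/-- P_∥ = b̂b̂ − t̂t̂ for every fixed boost angle, so its gradient can be computed with 𝓑 held
constant at the value of the point. The same holds for P_⊥ and the gyroangle. -/
theorem tvec_Ppar (hS : S.Admissible O) {x : Vec} (hx : x ∈ O) (β : ℝ) (v : Vec) :
    tvec (S.Ppar x) v
      = vdot (S.bhat x β) v • S.bhat x β - vdot (S.that x β) v • S.that x β := by
  have hE := hS.frame_orthonormal hx β 0
  obtain ⟨w, rfl⟩ := exists_eq_mulVec hE v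
  rw [hS.Ppar_eq hx β 0, frame_mulVec_that S x β 0, frame_mulVec_bhat S x β 0, tvec_conj hE,
    vdot_conj hE, vdot_conj hE, ← Matrix.mulVec_smul, ← Matrix.mulVec_smul, ← Matrix.mulVec_sub]
  congr 1
  ext i
  fin_cases i <;> simp [tvec, vdot, eta_explicit, Matrix.mulVec, dotProduct, Fin.sum_univ_four]

theorem tvec_Pperp (hS : S.Admissible O) {x : Vec} (hx : x ∈ O) (θ : ℝ) (v : Vec) :
    tvec (S.Pperp x) v
      = vdot (S.chat x θ) v • S.chat x θ + vdot (S.ahat x θ) v • S.ahat x θ := by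
  have hE := hS.frame_orthonormal hx 0 θ
  obtain ⟨w, rfl⟩ := exists_eq_mulVec hE v
  rw [hS.Pperp_eq hx 0 θ, frame_mulVec_chat S x 0 θ, frame_mulVec_ahat S x 0 θ, tvec_conj hE,
    vdot_conj hE, vdot_conj hE, ← Matrix.mulVec_smul, ← Matrix.mulVec_smul, ← Matrix.mulVec_add]
  congr 1
  ext i
  fin_cases i <;> simp [tvec, vdot, eta_explicit, Matrix.mulVec, dotProduct, Fin.sum_univ_four]

/-- Differentiating a constant scalar product. -/
theorem vdot_jac (hS : S.Admissible O) {x : Vec} (hx : x ∈ O) {V W : Vec → Vec} {k : ℝ}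
    (hV : SmV V x) (hW : SmV W x) (h : ∀ y ∈ O, vdot (V y) (W y) = k) (σ : Fin 4) :
    vdot (jac V x σ) (W x) + vdot (V x) (jac W x σ) = 0 := by
  have := pd_vdot hV hW σ
  rw [pd_congr (g := fun _ => k) (by
    filter_upwards [hS.isOpen.mem_nhds hx] with y hy using h y hy), pd_const] at this
  exact this.symm

/-- Differentiate b̂(b̂·U) − t̂(t̂·U) with U frozen at K t̂, using ∂t̂·t̂ = 0 and ∂b̂·t̂ = −∂t̂·b̂.
The subtracted b̂-component is the one that a position-dependent boost of the tetrad alters. -/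
theorem gradU_surf (hS : S.Admissible O) (hz : zR z ∈ O) (r : ℝ) :
    S.gradU (S.surf r z) = zK z • (grad (fun y => S.that y (zB z)) (zR z)
      - dyad (tvec (grad (fun y => S.that y (zB z)) (zR z)) (S.bhat (zR z) (zB z)))
          (S.bhat (zR z) (zB z))) := by
  obtain ⟨htt, hbb, htb, -⟩ := hS.vdot_frame hz (zB z) 0
  set t := fun y => S.that y (zB z) with ht
  set b := fun y => S.bhat y (zB z) with hb
  have st : SmV t (zR z) := hS.smV_that hz (zB z)
  have sb : SmV b (zR z) := hS.smV_bhat hz (zB z)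
  have o1 := hS.vdot_jac hz st st (k := -1) fun y hy => (hS.vdot_frame hy (zB z) 0).1
  have o2 := hS.vdot_jac hz st sb (k := 0) fun y hy => (hS.vdot_frame hy (zB z) 0).2.2.1
  have hx : tvec (grad t (zR z)) (b (zR z))
      = eta.mulVec fun σ => vdot (jac t (zR z) σ) (b (zR z)) := by
    rw [grad_eq, tvec, ← Matrix.mulVec_mulVec]
    congr 1
    ext σ
    rw [vdot_eq]
    rfl
  change _ = zK z • (grad t (zR z) - dyad (tvec (grad t (zR z)) (b (zR z))) (b (zR z)))
  rw [hx, ← eta_mul_dyad, grad_eq, ← Matrix.mul_sub, ← Matrix.mul_smul, gradU, gradDot, invU_surf,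
    invR_surf, grad_eq]
  congr 1
  ext σ ν
  -- The gradient acts on the projector only, so U enters as a constant field.
  have cst : SmV (fun _ : Vec => zK z • t (zR z)) (zR z) := fun _ => contDiffAt_const
  have hzero : ∀ u : Vec, vdot u (fun ν => pd (fun _ : Vec => (zK z • t (zR z)) ν) σ (zR z)) = 0 := by
    intro u
    simp [pd_const, vdot]
  have dt := (contDiffAt_vdot st cst).diff
  have db := (contDiffAt_vdot sb cst).diff
  rw [jac, Matrix.of_apply, pd_congr (g := fun y => vdot (b y) (zK z • t (zR z)) * b y ν
      - vdot (t y) (zK z • t (zR z)) * t y ν) (by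
    filter_upwards [hS.isOpen.mem_nhds hz] with y hy
    exact congrFun (hS.tvec_Ppar hy (zB z) (zK z • t (zR z))) ν)]
  rw [pd_sub (db.fun_mul (sb ν).diff) (dt.fun_mul (st ν).diff), pd_mul db (sb ν).diff,
    pd_mul dt (st ν).diff, pd_vdot sb cst, pd_vdot st cst, hzero, hzero]
  simp only [vdot_smul_right]
  have o1' := o1 σ
  have o2' := o2 σ
  rw [vdot_comm (t _) (jac t _ σ)] at o1'
  rw [vdot_comm (t _) (jac b _ σ)] at o2'
  rw [vdot_comm] at htb
  change vdot (t (zR z)) (t (zR z)) = -1 at htt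
  change vdot (b (zR z)) (t (zR z)) = 0 at htb
  rw [htt, htb]
  change (zK z * vdot (jac b (zR z) σ) (t (zR z)) + 0) * b (zR z) ν + _ * jac b (zR z) σ ν
    - ((zK z * vdot (jac t (zR z) σ) (t (zR z)) + 0) * t (zR z) ν + _ * jac t (zR z) σ ν)
    = zK z * (jac t (zR z) σ ν - vdot (jac t (zR z) σ) (b (zR z)) * b (zR z) ν)
  linear_combination zK z * b (zR z) ν * o2' - zK z / 2 * t (zR z) ν * o1'

/-- ĉ and â arise from ê₂ and ê₃ by a rotation through an angle that is constant in x, and such a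
rotation preserves 𝓡. -/
theorem vdot_jac_chat_ahat (hS : S.Admissible O) {x : Vec} (hx : x ∈ O) (θ : ℝ) (σ : Fin 4) :
    vdot (jac (fun y => S.chat y θ) x σ) (S.ahat x θ) = S.Rcov x σ := by
  have s2 := hS.smV_e hx 2
  have s3 := hS.smV_e hx 3
  have o22 := hS.vdot_jac hx s2 s2 (k := 1) (fun y hy => by
    rw [hS.orthonormal y hy]; simp [eta]) σ
  have o33 := hS.vdot_jac hx s3 s3 (k := 1) (fun y hy => by
    rw [hS.orthonormal y hy]; simp [eta]) σ
  have o23 := hS.vdot_jac hx s2 s3 (k := 0) (fun y hy => by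
    rw [hS.orthonormal y hy]; simp [eta]) σ
  have h : jac (fun y => S.chat y θ) x σ
      = -(Real.sin θ) • jac (S.e 2) x σ - Real.cos θ • jac (S.e 3) x σ := by
    ext ν
    simp only [jac, Matrix.of_apply, chat, Pi.sub_apply, Pi.smul_apply, smul_eq_mul]
    rw [pd_sub ((s2 ν).diff.const_mul _) ((s3 ν).diff.const_mul _), pd_const_mul _ (s2 ν).diff,
      pd_const_mul _ (s3 ν).diff]
  rw [h, ahat]
  simp only [vdot_sub_left, vdot_sub_right, vdot_smul_left, vdot_smul_right]
  rw [vdot_comm (S.e 2 x) (jac _ x σ)] at o22 o23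
  rw [vdot_comm (S.e 3 x) (jac _ x σ)] at o33
  change _ = vdot (jac (S.e 2) x σ) (S.e 3 x)
  have hcs := Real.sin_sq_add_cos_sq θ
  linear_combination vdot (jac (S.e 2) x σ) (S.e 3 x) * hcs - Real.cos θ ^ 2 * o23
    - Real.sin θ * Real.cos θ / 2 * o22 + Real.sin θ * Real.cos θ / 2 * o33

/-- Differentiate ĉ(ĉ·α̂) + â(â·α̂) with α̂ frozen at √r â. Besides ∇â there remains (∂ĉ·â) ĉ, which
is 𝓡 ĉ. -/
theorem gradDot_Pperp_surf (hS : S.Admissible O) (hz : zR z ∈ O) (r : ℝ) :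
    gradDot S.Pperp (invAlpha (S.surf r z)) (zR z)
      = √r • (grad (fun y => S.ahat y (zTheta z)) (zR z)
        + dyad (S.Rvec (zR z)) (S.chat (zR z) (zTheta z))) := by
  obtain ⟨-, -, -, hcc, haa, hca⟩ := hS.vdot_frame hz 0 (zTheta z)
  have hR := hS.vdot_jac_chat_ahat hz (zTheta z)
  set a := fun y => S.ahat y (zTheta z) with ha
  set c := fun y => S.chat y (zTheta z) with hc
  have sa : SmV a (zR z) := hS.smV_ahat hz (zTheta z)
  have sc : SmV c (zR z) := hS.smV_chat hz (zTheta z)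
  have o1 := hS.vdot_jac hz sa sa (k := 1) fun y hy => (hS.vdot_frame hy 0 (zTheta z)).2.2.2.2.1
  change _ = √r • (grad a (zR z) + dyad (S.Rvec (zR z)) (c (zR z)))
  rw [Rvec, ← eta_mul_dyad, grad_eq, ← Matrix.mul_add, ← Matrix.mul_smul, gradDot,
    invAlpha_surf, grad_eq]
  congr 1
  ext σ ν
  have cst : SmV (fun _ : Vec => √r • a (zR z)) (zR z) := fun _ => contDiffAt_const
  have hzero : ∀ u : Vec, vdot u (fun ν => pd (fun _ : Vec => (√r • a (zR z)) ν) σ (zR z)) = 0 := by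
    intro u
    simp [pd_const, vdot]
  have da := (contDiffAt_vdot sa cst).diff
  have dc := (contDiffAt_vdot sc cst).diff
  rw [jac, Matrix.of_apply, pd_congr (g := fun y => vdot (c y) (√r • a (zR z)) * c y ν
      + vdot (a y) (√r • a (zR z)) * a y ν) (by
    filter_upwards [hS.isOpen.mem_nhds hz] with y hy
    exact congrFun (hS.tvec_Pperp hy (zTheta z) (√r • a (zR z))) ν)]
  rw [pd_add (dc.fun_mul (sc ν).diff) (da.fun_mul (sa ν).diff), pd_mul dc (sc ν).diff,
    pd_mul da (sa ν).diff, pd_vdot sc cst, pd_vdot sa cst, hzero, hzero]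
  simp only [vdot_smul_right]
  have o1' := o1 σ
  have hR' := hR σ
  rw [vdot_comm (a _) (jac a _ σ)] at o1'
  change vdot (a (zR z)) (a (zR z)) = 1 at haa
  change vdot (c (zR z)) (a (zR z)) = 0 at hca
  change vdot (jac c (zR z) σ) (a (zR z)) = S.Rcov (zR z) σ at hR'
  rw [haa, hca]
  change (√r * vdot (jac c (zR z) σ) (a (zR z)) + 0) * c (zR z) ν + _ * jac c (zR z) σ ν
    + ((√r * vdot (jac a (zR z) σ) (a (zR z)) + 0) * a (zR z) ν + _ * jac a (zR z) σ ν)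
    = √r * (jac a (zR z) σ ν + S.Rcov (zR z) σ * c (zR z) ν)
  linear_combination √r * c (zR z) ν * hR' + √r / 2 * a (zR z) ν * o1'

theorem tvec_F0_ahat (hS : S.Admissible O) {x : Vec} (hx : x ∈ O) (θ : ℝ) :
    tvec (S.F0 x) (S.ahat x θ) = S.lamB x • S.chat x θ := by
  have hE := hS.frame_orthonormal hx 0 θ
  rw [hS.F0_eq hx 0 θ, frame_mulVec_ahat S x 0 θ, frame_mulVec_chat S x 0 θ, tvec_conj hE,
    ← Matrix.mulVec_smul]
  congr 1
  simp only [frameF, tvec_explicit, smul_vec_explicit]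
  norm_num

theorem tvec_smul (A : Ten) (r : ℝ) (v : Vec) : tvec A (r • v) = r • tvec A v := by
  simp [tvec, Matrix.mulVec_smul]

theorem dyad_smul_right (r : ℝ) (u v : Vec) : dyad u (r • v) = r • dyad u v := by
  ext i j; simp [dyad]; ring

/-- Since F₀·â = λ_B ĉ, the correction at the classical order removes exactly the term 𝓡 ĉ. At both
orders what is left is ∇â plus ĉ times the form that appears in the Lagrangian. -/
theorem gradAlpha_surf (hS : S.Admissible O) (hz : zR z ∈ O) (r : ℝ) (ord : GCOrder) :
    S.gradAlpha ord (S.surf r z) = √r • (grad (fun y => S.ahat y (zTheta z)) (zR z)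
      + dyad (eta.mulVec (S.gyroForm ord (zR z))) (S.chat (zR z) (zTheta z))) := by
  have hl := (hS.lamB_pos _ hz).ne'
  cases ord
  · simp only [gradAlpha, gyroForm, Matrix.mulVec_zero, invR_surf]
    rw [hS.gradDot_Pperp_surf hz, invAlpha_surf, tvec_smul, hS.tvec_F0_ahat hz, dyad_smul_right,
      dyad_smul_right, smul_add, smul_add, smul_smul, smul_smul]
    have : 1 / S.lamB (zR z) * (√r * S.lamB (zR z)) = √r := by field_simp
    rw [← mul_assoc] at this
    rw [this]
    have h0 : dyad 0 (S.chat (zR z) (zTheta z)) = 0 := by ext i j; simp [dyad]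
    rw [h0, smul_zero]
    abel
  · exact hS.gradDot_Pperp_surf hz r

/-- The boost-gauge dependent vector `(∇t̂) · b̂`. -/
noncomputable def boostVec (S : Data) (z : GCIdx → ℝ) : Vec :=
  tvec (grad (fun y => S.that y (zB z)) (zR z)) (S.bhat (zR z) (zB z))

theorem dyad_transpose (u v : Vec) : (dyad u v).transpose = dyad v u := by
  ext i j; simp [dyad, mul_comm]

/-- F''' differs from F'' by the b̂-component of ∇t̂, antisymmetrized. -/
theorem Fppp_surf (hS : S.Admissible O) (hz : zR z ∈ O) (r : ℝ) (ord : GCOrder) :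
    S.Fppp ord (S.surf r z) = S.Fpp ord z - (S.m * S.c * zK z / S.q) •
      (dyad (boostVec S z) (S.bhat (zR z) (zB z)) - dyad (S.bhat (zR z) (zB z)) (boostVec S z)) := by
  rw [Fppp, hS.gradU_surf hz, Fpp, invR_surf, invMu_surf]
  simp only [Matrix.transpose_smul, Matrix.transpose_sub, dyad_transpose]
  change _ + (S.m * S.c / S.q) • (zK z • (_ - dyad (boostVec S z) _)
    - zK z • (_ - dyad _ (boostVec S z))) = _
  simp only [← smul_sub, smul_smul]
  rw [show S.m * S.c / S.q * zK z = S.m * S.c * zK z / S.q by ring, add_sub_assoc, ← smul_sub]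
  congr 2
  abel

/-- The frame components of `∇t̂`. -/
theorem exists_grad_that (hS : S.Admissible O) (hz : zR z ∈ O) :
    ∃ x₀ x₁ x₂ x₃ y₀ y₁ y₂ y₃ w₀ w₁ w₂ w₃ : ℝ,
      grad (fun y => S.that y (zB z)) (zR z) = conj (S.frame (zR z) (zB z) 0)
        !![0, x₀, y₀, w₀; 0, x₁, y₁, w₁; 0, x₂, y₂, w₂; 0, x₃, y₃, w₃] ∧
      boostVec S z = (S.frame (zR z) (zB z) 0).mulVec ![x₀, x₁, x₂, x₃] := by
  have hE := hS.frame_orthonormal hz (zB z) 0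
  obtain ⟨T, hT⟩ := exists_eq_conj hE (grad (fun y => S.that y (zB z)) (zR z))
  -- The derivative of t̂·t̂ = −1; in the frame it makes the first column of ∇t̂ zero.
  have h0 : tvec (grad (fun y => S.that y (zB z)) (zR z)) (S.that (zR z) (zB z)) = 0 := by
    rw [grad_eq, tvec, ← Matrix.mulVec_mulVec]
    suffices h : (jac (fun y => S.that y (zB z)) (zR z)).mulVec
        (eta.mulVec (S.that (zR z) (zB z))) = 0 by rw [h, Matrix.mulVec_zero]
    funext σ
    have o1 := hS.vdot_jac hz (hS.smV_that hz (zB z)) (hS.smV_that hz (zB z)) (k := -1)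
      (fun y hy => (hS.vdot_frame hy (zB z) 0).1) σ
    rw [vdot_comm (S.that _ _)] at o1
    have : vdot (jac (fun y => S.that y (zB z)) (zR z) σ) (S.that (zR z) (zB z)) = 0 := by
      linarith
    rw [vdot_eq] at this
    exact this
  rw [hT, frame_mulVec_that S _ _ 0, tvec_conj hE] at h0
  have h1 : tvec T ![1, 0, 0, 0] = 0 :=
    mulVec_injective hE (h0.trans (Matrix.mulVec_zero _).symm)
  have hcol : ∀ i, T i 0 = 0 := by
    intro i
    have := congrFun h1 i
    fin_cases i <;>
      simpa [tvec, eta_explicit, Matrix.mulVec, dotProduct, Fin.sum_univ_four] using this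
  have hT2 : T = !![0, T 0 1, T 0 2, T 0 3; 0, T 1 1, T 1 2, T 1 3; 0, T 2 1, T 2 2, T 2 3;
      0, T 3 1, T 3 2, T 3 3] := by
    ext i j
    fin_cases j
    · fin_cases i <;> exact hcol _
    all_goals fin_cases i <;> rfl
  refine ⟨T 0 1, T 1 1, T 2 1, T 3 1, T 0 2, T 1 2, T 2 2, T 3 2, T 0 3, T 1 3, T 2 3, T 3 3,
    by rw [← hT2, hT], ?_⟩
  rw [boostVec, hT, frame_mulVec_bhat S _ _ 0, tvec_conj hE]
  congr 1
  ext i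
  fin_cases i <;> simp [tvec, eta_explicit, Matrix.mulVec, dotProduct, Fin.sum_univ_four]

/-- Each term of F''' − F'' contains a factor b̂, and F₀·b̂ = 0, so the double contraction with F₀
does not change. -/
theorem Upsp_surf (hS : S.Admissible O) (hz : zR z ∈ O) (r : ℝ) (ord : GCOrder) :
    S.Upsp ord (S.surf r z) = S.Ups ord z := by
  have hE := hS.frame_orthonormal hz (zB z) 0
  obtain ⟨B, hB⟩ := exists_eq_conj hE (S.Fpp ord z)
  obtain ⟨w, hw⟩ := exists_eq_mulVec hE (boostVec S z)
  rw [Upsp, Ups, hS.Fppp_surf hz, invR_surf, hS.F0_eq hz (zB z) 0, hw, hB,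
    frame_mulVec_bhat S _ _ 0, dyad_conj, dyad_conj, conj_sub, conj_smul, conj_sub, ddot_conj hE,
    ddot_conj hE]
  simp [ddot, frameF, eta_explicit, Fin.sum_univ_four, dyad]

/-- The brackets `{R, U}` and `{U, U}` on the hypersurface. -/
theorem table_relations (hS : S.Admissible O) (ord : GCOrder) (hz : z ∈ S.domain ord O) (r : ℝ) :
    (S.brRR ord z ⊡ (zK z • grad (fun y => S.that y (zB z)) (zR z))
      + (dyad (S.brRK ord z) (S.that (zR z) (zB z))
        + zK z • dyad (S.brRB ord z) (S.bhat (zR z) (zB z))) = S.invRU ord (S.surf r z)) ∧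
    ((zK z • grad (fun y => S.that y (zB z)) (zR z)).transpose ⊡ S.brRR ord z
        ⊡ (zK z • grad (fun y => S.that y (zB z)) (zR z))
      + ((zK z • grad (fun y => S.that y (zB z)) (zR z)).transpose
          ⊡ (dyad (S.brRK ord z) (S.that (zR z) (zB z))
            + zK z • dyad (S.brRB ord z) (S.bhat (zR z) (zB z)))
        - (dyad (S.brRK ord z) (S.that (zR z) (zB z))
            + zK z • dyad (S.brRB ord z) (S.bhat (zR z) (zB z))).transpose
          ⊡ (zK z • grad (fun y => S.that y (zB z)) (zR z)))
      + (zK z * S.brKB ord z) • (dyad (S.that (zR z) (zB z)) (S.bhat (zR z) (zB z))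
        - dyad (S.bhat (zR z) (zB z)) (S.that (zR z) (zB z))) = S.invUU ord (S.surf r z)) := by
  obtain ⟨hz1, hz2, hz3⟩ := hz
  have hl := (hS.lamB_pos _ hz1).ne'
  have hE := hS.frame_orthonormal hz1 (zB z) 0
  obtain ⟨a, b, c, d, e, hA⟩ := hS.exists_frameA hz1 (zB z) 0 (Fpp_antisymm S ord z)
    (Y := S.Ups ord z) rfl
  obtain ⟨x₀, x₁, x₂, x₃, y₀, y₁, y₂, y₃, w₀, w₁, w₂, w₃, hT, hx⟩ := hS.exists_grad_that hz1
  have hX := hS.Xi_eq_conj hz1 ord 0 hA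
  have hF := hS.F0_eq hz1 (zB z) 0
  have ht := frame_mulVec_that S (zR z) (zB z) 0
  have hb := frame_mulVec_bhat S (zR z) (zB z) 0
  have hD : S.gradU (S.surf r z) = conj (S.frame (zR z) (zB z) 0)
      (zK z • !![0, 0, y₀, w₀; 0, 0, y₁, w₁; 0, 0, y₂, w₂; 0, 0, y₃, w₃]) := by
    rw [hS.gradU_surf hz1]
    change zK z • (_ - dyad (boostVec S z) _) = _
    rw [hT, hx, hb, dyad_conj, conj_sub, conj_smul]
    congr 2
    simp only [dyad_explicit, sub_explicit]
    apply explicit_ext <;> ring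
  have hA' := hS.Fppp_surf hz1 r ord
  rw [hA, hx, hb, dyad_conj, dyad_conj, conj_sub, conj_smul, conj_sub] at hA'
  have hP : S.Ppar (zR z) = conj (S.frame (zR z) (zB z) 0)
      (eta + (S.lamB (zR z) ^ 2)⁻¹ • (frameF (S.lamB (zR z)) ⊡ frameF (S.lamB (zR z)))) := by
    rw [Ppar, hF, tdot_conj hE, conj_smul, eta_eq_conj hE, conj_add, ← eta_eq_conj hE]
  have hX' : S.Xip ord (S.surf r z) = conj (S.frame (zR z) (zB z) 0)
      (eta + (S.ε / (S.lamB (zR z) ^ 2 * S.Ups ord z)) •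
        ((frameA S.ε (S.lamB (zR z)) (S.Ups ord z) a b c d e - (S.m * S.c * zK z / S.q) •
          (dyad ![x₀, x₁, x₂, x₃] ![0, 1, 0, 0] - dyad ![0, 1, 0, 0] ![x₀, x₁, x₂, x₃]))
          ⊡ frameF (S.lamB (zR z)))) := by
    rw [Xip, hA', invR_surf, hF, tdot_conj hE, conj_smul, eta_eq_conj hE, conj_add,
      hS.Upsp_surf hz1, ← eta_eq_conj hE]
  have hRR : S.brRR ord z = conj (S.frame (zR z) (zB z) 0) (-(S.ε / (S.m * S.lamB (zR z) *
      (S.q * S.lamB (zR z) / (S.m * S.c)) * S.Ups ord z)) • frameF (S.lamB (zR z))) := by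
    rw [brRR, hF, conj_smul]; rfl
  have hdual := hS.dualF0_eq hz1 (zB z) 0
  constructor
  · rw [invRU, hD, hA', invR_surf, hP, hS.Upsp_surf hz1, hRR, brRK, brRB, hX, hF, hT, ht, hb]
    simp only [vten_conj hE, ← Matrix.mulVec_smul, dyad_conj, conj_smul, conj_add, conj_sub,
      tdot_conj hE]
    congr 1
    exact frame_RU _ _ _ _ _ _ _ a b c d e hS.m_pos.ne' hS.q_ne hS.c_pos.ne' hS.ε_ne hl hz2.ne'
      hz3 _ _ rfl rfl x₀ x₁ x₂ x₃ y₀ y₁ y₂ y₃ w₀ w₁ w₂ w₃ _ _ _ _ _ rfl rfl rfl rfl rfl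
  · rw [invUU, hX', hD, hA', invR_surf, hP, hS.Upsp_surf hz1, hRR, brKB, brRK, brRB, hX, hA, hF, hT,
      ht, hb, hdual, OmegaB]
    simp only [vten_conj hE, ← Matrix.mulVec_smul, dyad_conj, conj_smul, conj_add, conj_sub,
      tdot_conj hE, transpose_conj, vdot_conj hE, ddot_conj hE]
    congr 1
    exact frame_UU _ _ _ _ _ _ _ a b c d e hS.m_pos.ne' hS.q_ne hS.c_pos.ne' hS.ε_ne hl hz2.ne'
      hz3 _ _ rfl rfl x₀ x₁ x₂ x₃ y₀ y₁ y₂ y₃ w₀ w₁ w₂ w₃ _ _ _ _ _ rfl rfl rfl rfl rfl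

end Data.Admissible
end GuidingCenter

/-! ### The explicit brackets on a leaf -/

namespace GuidingCenter
namespace Data

/-- Antisymmetry is collected here, so that every bracket of the table occurs once in the chain
rule. -/
theorem sum_gcTensor (S : Data) (ord : GCOrder) (z u v : GCIdx → ℝ) :
    ∑ i, ∑ j, u i * S.gcTensor ord z i j * v j
      = ∑ σ, ∑ τ, u (.inl σ) * S.brRR ord z σ τ * v (.inl τ)
        + ∑ σ, (u (.inl σ) * v (.inr 0) - u (.inr 0) * v (.inl σ)) * S.brRK ord z σ
        + ∑ σ, (u (.inl σ) * v (.inr 1) - u (.inr 1) * v (.inl σ)) * S.brRB ord z σ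
        + ∑ σ, (u (.inl σ) * v (.inr 3) - u (.inr 3) * v (.inl σ)) * S.brRTheta ord z σ
        + (u (.inr 0) * v (.inr 1) - u (.inr 1) * v (.inr 0)) * S.brKB ord z
        + (u (.inr 0) * v (.inr 3) - u (.inr 3) * v (.inr 0)) * S.brKTheta ord z
        + (u (.inr 1) * v (.inr 3) - u (.inr 3) * v (.inr 1)) * S.brBTheta ord z
        + (u (.inr 3) * v (.inr 2) - u (.inr 2) * v (.inr 3)) * (1 / S.ε) := by
  simp only [Fintype.sum_sum_type, Fin.sum_univ_four, gcTensor, Matrix.of_apply,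
    Matrix.cons_val, Matrix.cons_val_zero, Matrix.cons_val_one]
  ring

end Data

namespace Data.Admissible

variable {S : Data} {O : Set Vec} {ord : GCOrder} {z : GCIdx → ℝ}

theorem invRR_surf (hS : S.Admissible O) (hz : zR z ∈ O) (r : ℝ) :
    S.invRR ord (S.surf r z) = S.brRR ord z := by
  rw [invRR, hS.Upsp_surf hz]; rfl

theorem brRR_antisymm (S : Data) (ord : GCOrder) (z : GCIdx → ℝ) (μ ν : Fin 4) :
    S.brRR ord z μ ν = -S.brRR ord z ν μ := by
  have h := congrFun (congrFun (F0_antisymm S (zR z)) ν) μ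
  simp only [Matrix.transpose_apply, Matrix.neg_apply] at h
  simp [brRR, h]

theorem gradAlpha_surf_eq (hS : S.Admissible O) (hz : zR z ∈ O) (r : ℝ) (ord : GCOrder) :
    S.gradAlpha ord (S.surf r z) = eta * (√r • (jac (fun y => S.ahat y (zTheta z)) (zR z)
      + dyad (S.gyroForm ord (zR z)) (S.chat (zR z) (zTheta z)))) := by
  rw [hS.gradAlpha_surf hz, grad_eq, ← eta_mul_dyad, ← Matrix.mul_add, Matrix.mul_smul]

theorem invAlphaMu_surf (hS : S.Admissible O) (hz : zR z ∈ O) (r : ℝ) :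
    S.invAlphaMu (S.surf r z) = (√r / S.ε) • S.chat (zR z) (zTheta z) := by
  have hl := (hS.lamB_pos _ hz).ne'
  have hε := hS.ε_ne
  rw [invAlphaMu, invR_surf, invAlpha_surf, tvec_smul, hS.tvec_F0_ahat hz, smul_smul, smul_smul]
  congr 1
  field_simp

/-- The chain rule on a leaf. The R–U and U–U blocks are `table_relations`. In the blocks of R and U
with α̂, and of α̂ with itself, {·, Θ} = {·, R} · 𝓡 merges the derivative ĉ in the gyroangle with ∇â
into the full gradient of α̂. The α̂–μ block comes from {Θ, μ}. -/
theorem sum_surfJac_eq_invTensor (hS : S.Admissible O) (hz : z ∈ S.domain ord O) (r : ℝ)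
    (a b : InvIdx) :
    ∑ i, ∑ j, S.surfJac r z a i * S.gcTensor ord z i j * S.surfJac r z b j
      = S.invTensor ord (S.surf r z) a b := by
  obtain ⟨hRU, hUU⟩ := hS.table_relations ord hz r
  have hN := hS.gradAlpha_surf_eq hz.1 r ord
  have hRR := hS.invRR_surf (ord := ord) hz.1 r
  have hAM := hS.invAlphaMu_surf hz.1 r
  have hAA : S.invAlphaAlpha ord (S.surf r z) = (S.gradAlpha ord (S.surf r z)).transpose
      ⊡ S.invRR ord (S.surf r z) ⊡ S.gradAlpha ord (S.surf r z) := by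
    simp only [invAlphaAlpha, invRR, tdot, Matrix.mul_smul, Matrix.smul_mul]
  have anti := brRR_antisymm S ord z
  have h00 : ∀ μ, S.brRR ord z μ μ = 0 := fun μ => by linarith [anti μ μ]
  have h10 := anti 1 0
  have h20 := anti 2 0
  have h30 := anti 3 0
  have h21 := anti 2 1
  have h31 := anti 3 1
  have h32 := anti 3 2
  -- The metric in the contraction cancels the one that raises the gradient index, leaving plain
  -- matrix products to compare with the Jacobian.
  rw [grad_eq, ← Matrix.mul_smul, tdot_eta_mul] at hRU
  rw [grad_eq, ← Matrix.mul_smul] at hUU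
  simp only [eta_mul_transpose_tdot, tdot_eta_mul] at hUU
  have hRU' := fun μ ν => congrFun (congrFun hRU μ) ν
  have hUU' := fun μ ν => congrFun (congrFun hUU μ) ν
  simp only [Matrix.add_apply, Matrix.sub_apply, Matrix.smul_apply, Matrix.mul_apply, dyad,
    Matrix.of_apply, Matrix.transpose_apply, smul_eq_mul] at hRU' hUU'
  rw [sum_gcTensor, brKTheta_eq, brBTheta_eq]
  simp only [brRTheta_eq]
  obtain μ | μ | μ | μ := a <;> obtain ν | ν | ν | ν := b
  · simp [invTensor, surfJac, hRR]
  · simp only [invTensor, Matrix.of_apply, ← hRU']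
    simp [surfJac]
    ring
  · simp [invTensor, surfJac]
  · simp only [invTensor, Matrix.of_apply, invRAlpha, hN, hRR, tdot_eta_mul]
    simp [surfJac, Matrix.mul_apply, dyad, Fin.sum_univ_four]
    ring
  · simp only [invTensor, Matrix.of_apply, ← hRU']
    simp [surfJac, Fin.sum_univ_four]
    linear_combination zK z * (jac (fun y => S.that y (zB z)) (zR z) 0 μ * anti 0 ν
      + jac (fun y => S.that y (zB z)) (zR z) 1 μ * anti 1 ν
      + jac (fun y => S.that y (zB z)) (zR z) 2 μ * anti 2 ν
      + jac (fun y => S.that y (zB z)) (zR z) 3 μ * anti 3 ν)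
  · simp only [invTensor, Matrix.of_apply, ← hUU']
    simp only [surfJac, Fin.sum_univ_four, Matrix.of_apply, h00, h10, h20, h30, h21, h31, h32,
      Matrix.cons_val, Matrix.cons_val_zero, Matrix.cons_val_one]
    ring
  · simp [invTensor, surfJac]
  · simp only [invTensor, Matrix.of_apply, invUAlpha, hN, tdot_eta_mul, Matrix.mul_apply,
      Matrix.neg_apply, Matrix.transpose_apply, ← hRU']
    simp only [surfJac, Fin.sum_univ_four, Matrix.of_apply, Matrix.add_apply,
      Matrix.smul_apply, dyad, smul_eq_mul, h00, h10, h20, h30, h21, h31,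
      h32, Matrix.cons_val, Matrix.cons_val_zero, Matrix.cons_val_one]
    ring
  · simp [invTensor, surfJac]
  · simp [invTensor, surfJac]
  · simp [invTensor, surfJac]
  · simp [invTensor, surfJac, hAM]; ring
  · simp only [invTensor, Matrix.of_apply, invRAlpha, hN, hRR, tdot_eta_mul]
    simp [surfJac, Matrix.mul_apply, dyad, Fin.sum_univ_four]
    linear_combination √r * (
      (jac (fun y => S.ahat y (zTheta z)) (zR z) 0 μ) * anti 0 ν
      + (jac (fun y => S.ahat y (zTheta z)) (zR z) 1 μ) * anti 1 ν
      + (jac (fun y => S.ahat y (zTheta z)) (zR z) 2 μ) * anti 2 ν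
      + (jac (fun y => S.ahat y (zTheta z)) (zR z) 3 μ) * anti 3 ν)
  · simp only [invTensor, Matrix.of_apply, invUAlpha, hN, tdot_eta_mul, Matrix.mul_apply,
      Matrix.neg_apply, Matrix.transpose_apply, ← hRU']
    simp only [surfJac, Fin.sum_univ_four, Matrix.of_apply, Matrix.add_apply,
      Matrix.smul_apply, dyad, smul_eq_mul, h00, h10, h20, h30, h21, h31,
      h32, Matrix.cons_val, Matrix.cons_val_zero, Matrix.cons_val_one]
    ring
  · simp [invTensor, surfJac, hAM]; ring
  · simp only [invTensor, Matrix.of_apply, hAA, hN, hRR, eta_mul_transpose_tdot, tdot_eta_mul]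
    simp only [surfJac, Fin.sum_univ_four, Matrix.of_apply, Matrix.mul_apply, Matrix.add_apply,
      Matrix.smul_apply, Matrix.transpose_apply, dyad, smul_eq_mul, h00, h10, h20, h30, h21, h31,
      h32, Matrix.cons_val, Matrix.cons_val_zero, Matrix.cons_val_one]
    ring

end Data.Admissible
end GuidingCenter

/-! ### Jacobi identity and Casimir functions on the hypersurface -/

namespace GuidingCenter
namespace Data.Admissible

variable {S : Data} {O : Set Vec} {ord : GCOrder} {z : GCIdx → ℝ}

/-- In frame components P_⊥·U carries the first two constraint coordinates and P_∥·α̂ the next two,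
with nonzero factors, so the two conditions put the point on a leaf. -/
theorem exists_surf_eq (hS : S.Admissible O) {Z : InvIdx → ℝ}
    (hZ : Z ∈ S.constraintSurface ord O) :
    ∃ r > 0, ∃ z ∈ S.domain ord O, Z = S.surf r z := by
  obtain ⟨⟨y, hy, rfl⟩, hU, hA⟩ := hZ
  have hO := hy.1.1
  have hK := hy.1.2.1.ne'
  have hl := (hS.lamB_pos _ hO).ne'
  have hr : √(y (.inr 4)) ≠ 0 := (Real.sqrt_pos.2 hy.2).ne'
  have hE := hS.frame_orthonormal hO (zB (base y)) (zTheta (base y))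
  rw [perpU, toInv_invR, hS.Pperp_eq hO (zB (base y)) (zTheta (base y)), toInv_invU,
    tvec_conj hE] at hU
  rw [parAlpha, toInv_invR, hS.Ppar_eq hO (zB (base y)) (zTheta (base y)), toInv_invAlpha,
    tvec_conj hE] at hA
  have hU' := mulVec_injective hE (hU.trans (Matrix.mulVec_zero _).symm)
  have hA' := mulVec_injective hE (hA.trans (Matrix.mulVec_zero _).symm)
  have c0 := congrFun hU' 2
  have c1 := congrFun hU' 3
  have c2 := congrFun hA' 0
  have c3 := congrFun hA' 1
  simp [tvec_explicit, hK, hl, hr] at c0 c1 c2 c3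
  refine ⟨y (.inr 4), hy.2, base y, hy.1, ?_⟩
  rw [surf]
  congr 1
  ext (i | k)
  · rfl
  · fin_cases k
    · exact c0
    · exact c1
    · exact c2
    · exact c3
    · rfl

theorem invPoisson_eq_invTensor (hS : S.Admissible O) {r : ℝ} (hr : 0 < r)
    (hz : z ∈ S.domain ord O) :
    S.invPoisson ord O (S.surf r z) = S.invTensor ord (S.surf r z) := by
  ext a b
  rw [hS.invPoisson_surf hr hz, ← hS.sum_surfJac_eq_invTensor hz, hS.poisson_eq_gcTensor ord hz]
  simp only [hS.pd_surf hr hz]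

/-! Smoothness of the explicit brackets. -/

/-- Here the frozen vector varies with the phase-space point. Joint smoothness is read off from the
formula linear in that vector, which holds wherever the position lies in `O`. -/
theorem smT_gradDot (hS : S.Admissible O) {P : Vec → Ten} (hP : ∀ x ∈ O, SmT P x)
    {Z : InvIdx → ℝ} (hZ : invR Z ∈ O) {V : (InvIdx → ℝ) → Vec} (hV : SmV V Z) :
    SmT (fun W => gradDot P (V W) (invR W)) Z := by
  have cR := contDiffAt_invR Z
  have hp : ∀ σ ν τ, ContDiffAt ℝ ∞ (fun W => pd (fun y => P y ν τ) σ (invR W)) Z :=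
    fun σ ν τ => ContDiffAt.comp Z (contDiffAt_pd (hP _ hZ ν τ) σ) cR
  have h : SmT (fun W => Matrix.of fun μ ν => ∑ σ, eta μ σ *
      ∑ τ, pd (fun y => P y ν τ) σ (invR W) * eta.mulVec (V W) τ) Z := by
    intro μ ν
    simp only [Matrix.of_apply]
    exact ContDiffAt.sum fun σ _ => contDiffAt_const.mul <| ContDiffAt.sum fun τ _ =>
      (hp σ ν τ).mul (SmV.mulVec (SmT.const eta) hV τ)
  refine h.congr ?_
  filter_upwards [cR.continuousAt.preimage_mem_nhds (hS.isOpen.mem_nhds hZ)] with W hW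
  ext μ ν
  exact gradDot_apply (hP _ hW) _ μ ν

variable {Z : InvIdx → ℝ}

theorem smT_gradU (hS : S.Admissible O) (hZ : invR Z ∈ O) : SmT S.gradU Z :=
  hS.smT_gradDot (fun _ hx => hS.smT_Ppar hx) hZ (smV_invU Z)

theorem smT_gradAlpha (hS : S.Admissible O) (ord : GCOrder) (hZ : invR Z ∈ O) :
    SmT (S.gradAlpha ord) Z := by
  have cR := contDiffAt_invR Z
  have h := hS.smT_gradDot (fun _ hx => hS.smT_Pperp hx) hZ (smV_invAlpha Z)
  cases ord
  · exact h.sub (SmT.smul (contDiffAt_const.div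
      (ContDiffAt.comp (g := S.lamB) Z (hS.contDiffAt_lamB hZ) cR) (hS.lamB_pos _ hZ).ne')
      (SmT.dyad ((hS.smV_Rvec hZ).comp cR) (SmV.tvec ((hS.smT_F0 hZ).comp cR) (smV_invAlpha Z))))
  · exact h

theorem smT_Fppp (hS : S.Admissible O) (ord : GCOrder) (hZ : invR Z ∈ O) :
    SmT (S.Fppp ord) Z :=
  (hS.smT_Fp_param ord hZ (contDiffAt_invR Z) (contDiffAt_invMu Z)).add
    (SmT.smul contDiffAt_const ((hS.smT_gradU hZ).sub (hS.smT_gradU hZ).transpose))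

theorem contDiffAt_Upsp (hS : S.Admissible O) (ord : GCOrder) (hZ : invR Z ∈ O) :
    ContDiffAt ℝ ∞ (S.Upsp ord) Z := by
  have cR := contDiffAt_invR Z
  have cl : ContDiffAt ℝ ∞ (fun W => S.lamB (invR W)) Z :=
    ContDiffAt.comp (g := S.lamB) Z (hS.contDiffAt_lamB hZ) cR
  exact contDiffAt_const.add ((contDiffAt_const.mul
    (contDiffAt_ddot ((hS.smT_F0 hZ).comp cR) (hS.smT_Fppp ord hZ))).div
    (contDiffAt_const.mul (cl.pow 2))
    (mul_ne_zero two_ne_zero (pow_ne_zero 2 (hS.lamB_pos _ hZ).ne')))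

theorem contDiffAt_invTensor (hS : S.Admissible O) (hZ : invR Z ∈ O) (hY : S.Upsp ord Z ≠ 0)
    (a b : InvIdx) : ContDiffAt ℝ ∞ (fun W => S.invTensor ord W a b) Z := by
  have cR := contDiffAt_invR Z
  have hl := (hS.lamB_pos _ hZ).ne'
  have hm := hS.m_pos.ne'
  have hΩ : S.OmegaB (invR Z) ≠ 0 :=
    div_ne_zero (mul_ne_zero hS.q_ne hl) (mul_ne_zero hm hS.c_pos.ne')
  have cl : ContDiffAt ℝ ∞ (fun W => S.lamB (invR W)) Z :=
    ContDiffAt.comp (g := S.lamB) Z (hS.contDiffAt_lamB hZ) cR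
  have cΩ : ContDiffAt ℝ ∞ (fun W => S.OmegaB (invR W)) Z :=
    ContDiffAt.comp (g := S.OmegaB) Z (hS.contDiffAt_OmegaB hZ) cR
  have cY := hS.contDiffAt_Upsp ord hZ
  have cF := (hS.smT_F0 hZ).comp cR
  have cD := (hS.smT_dualF0 hZ).comp cR
  have cP := (hS.smT_Ppar hZ).comp cR
  have cU := hS.smT_gradU hZ
  have cA := hS.smT_gradAlpha ord hZ
  have cFp := hS.smT_Fppp ord hZ
  have k1 : ContDiffAt ℝ ∞
      (fun W => S.ε / (S.m * S.lamB (invR W) * S.OmegaB (invR W) * S.Upsp ord W)) Z :=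
    contDiffAt_const.div (((contDiffAt_const.mul cl).mul cΩ).mul cY)
      (mul_ne_zero (mul_ne_zero (mul_ne_zero hm hl) hΩ) hY)
  have k2 : ContDiffAt ℝ ∞ (fun W => S.ε / (S.m * S.lamB (invR W) ^ 2 * S.Upsp ord W)) Z :=
    contDiffAt_const.div ((contDiffAt_const.mul (cl.pow 2)).mul cY)
      (mul_ne_zero (mul_ne_zero hm (pow_ne_zero 2 hl)) hY)
  have k3 : ContDiffAt ℝ ∞ (fun W => S.ε / (S.lamB (invR W) ^ 2 * S.Upsp ord W)) Z :=
    contDiffAt_const.div ((cl.pow 2).mul cY) (mul_ne_zero (pow_ne_zero 2 hl) hY)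
  have cX : SmT (S.Xip ord) Z := (SmT.const eta).add (SmT.smul k3 (cFp.tdot cF))
  have k4 : ContDiffAt ℝ ∞ (fun W => S.OmegaB (invR W) / (2 * S.m * S.lamB (invR W) ^ 3)
      * ddot (S.dualF0 (invR W)) (S.Fppp ord W ⊡ (S.Xip ord W).transpose)) Z :=
    (cΩ.div (contDiffAt_const.mul (cl.pow 3))
      (mul_ne_zero (mul_ne_zero two_ne_zero hm) (pow_ne_zero 3 hl))).mul
      (contDiffAt_ddot cD (cFp.tdot cX.transpose))
  have cRR : SmT (S.invRR ord) Z := SmT.smul k1.neg cF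
  have cRU : SmT (S.invRU ord) Z := (SmT.smul contDiffAt_const cP).add
    (SmT.smul k2 (cF.tdot ((cFp.tdot cP).sub (SmT.smul contDiffAt_const cU))))
  have cUU : SmT (S.invUU ord) Z := ((SmT.smul k4.neg cD).sub (SmT.smul contDiffAt_const
    (((cP.tdot cX).tdot cU).sub ((cU.transpose.tdot cX.transpose).tdot cP)))).sub
    (SmT.smul k1 ((cU.transpose.tdot cF).tdot cU))
  have cRA : SmT (S.invRAlpha ord) Z := cRR.tdot cA
  have cUA : SmT (S.invUAlpha ord) Z := cRU.transpose.neg.tdot cA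
  have cAA : SmT (S.invAlphaAlpha ord) Z := SmT.smul k1.neg ((cA.transpose.tdot cF).tdot cA)
  have cAM : SmV S.invAlphaMu Z := SmV.smul
    (contDiffAt_const.div (contDiffAt_const.mul cl) (mul_ne_zero hS.ε_ne hl))
    (SmV.tvec cF (smV_invAlpha Z))
  obtain μ | μ | μ | μ := a <;> obtain ν | ν | ν | ν := b
  · exact cRR μ ν
  · exact cRU μ ν
  · exact contDiffAt_const
  · exact cRA μ ν
  · exact (cRU ν μ).neg
  · exact cUU μ ν
  · exact contDiffAt_const
  · exact cUA μ ν
  · exact contDiffAt_const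
  · exact contDiffAt_const
  · exact contDiffAt_const
  · exact (cAM ν).neg
  · exact (cRA ν μ).neg
  · exact (cUA ν μ).neg
  · exact cAM μ
  · exact cAA μ ν

/-- Off the hypersurface the explicit tensor is not compared with the push-forward. It suffices that
the leaf parametrization relates the eight-dimensional bracket to it at all points of the leaf:
Hamiltonian vectors are tangent to the leaf, so transverse derivatives do not enter. -/
theorem jacobiAt_invTensor (hS : S.Admissible O) (hZ : Z ∈ S.constraintSurface ord O) :
    JacobiAt (S.invTensor ord) (S.invDomain ord O) Z := by
  obtain ⟨r, hr, z, hz, rfl⟩ := hS.exists_surf_eq hZ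
  refine jacobi_push (J := S.poisson ord) (hS.isOpen_domain ord)
    (fun w hw => hS.contDiffAt_surf hr hw) ?_ (hS.isOpen_invDomain ord)
    (fun w hw => ⟨_, surf_mem hr hw, rfl⟩) ?_ (hS.isPoissonOn_poisson ord).jacobi hz
  · intro w hw a b
    rw [← hS.invPoisson_eq_invTensor hr hw, hS.invPoisson_surf hr hw]
  · intro w hw a b
    refine hS.contDiffAt_invTensor (Z := S.surf r w) hw.1 ?_ a b
    rw [hS.Upsp_surf hw.1]
    exact hw.2.2

/-- A function that is constant on the leaf `surf r` is a Casimir function there. -/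
theorem casimirAt_surf (hS : S.Admissible O) {r k : ℝ} (hr : 0 < r) (hz : z ∈ S.domain ord O)
    {C : (InvIdx → ℝ) → ℝ} (hC : ContDiffAt ℝ ∞ C (S.surf r z))
    (h : ∀ w ∈ S.domain ord O, C (S.surf r w) = k) :
    CasimirAt (S.invPoisson ord O) (S.invDomain ord O) C (S.surf r z) := by
  have hm := surf_mem hr hz
  refine hS.casimirAt_of_pd_eq_zero hm hC.diff fun i => ?_
  rw [pd_slice_left (f := fun w => C (S.toInv w))
    (DifferentiableAt.comp _ hC.diff (hS.contDiffAt_toInv hm).diff)]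
  refine (pd_congr (g := fun _ => k) ?_ i).trans (pd_const _ _ _)
  filter_upwards [(hS.isOpen_domain ord).mem_nhds hz] with w hw using h w hw

theorem perpU_surf (hS : S.Admissible O) (hz : zR z ∈ O) (r : ℝ) : S.perpU (S.surf r z) = 0 := by
  have hE := hS.frame_orthonormal hz (zB z) 0
  rw [perpU, invR_surf, invU_surf, hS.Pperp_eq hz (zB z) 0, frame_mulVec_that S _ _ 0,
    tvec_smul, tvec_conj hE, tvec_explicit, show (![_, _, _, _] : Vec) = 0 from ?_, Matrix.mulVec_zero,
    smul_zero]
  ext i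
  fin_cases i <;> simp

theorem parAlpha_surf (hS : S.Admissible O) (hz : zR z ∈ O) (r : ℝ) :
    S.parAlpha (S.surf r z) = 0 := by
  have hE := hS.frame_orthonormal hz 0 (zTheta z)
  rw [parAlpha, invR_surf, invAlpha_surf, hS.Ppar_eq hz 0 (zTheta z), frame_mulVec_ahat S _ 0,
    tvec_smul, tvec_conj hE, tvec_explicit, show (![_, _, _, _] : Vec) = 0 from ?_, Matrix.mulVec_zero,
    smul_zero]
  ext i
  fin_cases i <;> simp

theorem casimirAt_surface (hS : S.Admissible O) (hZ : Z ∈ S.constraintSurface ord O) :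
    (∀ ν : Fin 4, CasimirAt (S.invPoisson ord O) (S.invDomain ord O) (fun W => S.perpU W ν) Z) ∧
    (∀ ν : Fin 4, CasimirAt (S.invPoisson ord O) (S.invDomain ord O)
      (fun W => S.parAlpha W ν) Z) ∧
    CasimirAt (S.invPoisson ord O) (S.invDomain ord O)
      (fun W => vdot (invAlpha W) (invAlpha W)) Z := by
  obtain ⟨r, hr, z, hz, rfl⟩ := hS.exists_surf_eq hZ
  have cR := contDiffAt_invR (S.surf r z)
  refine ⟨fun ν => ?_, fun ν => ?_, ?_⟩
  · exact hS.casimirAt_surf (k := 0) hr hz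
      (SmV.tvec ((hS.smT_Pperp hz.1).comp (φ := invR) cR) (smV_invU _) ν)
      fun w hw => congrFun (hS.perpU_surf hw.1 r) ν
  · exact hS.casimirAt_surf (k := 0) hr hz
      (SmV.tvec ((hS.smT_Ppar hz.1).comp (φ := invR) cR) (smV_invAlpha _) ν)
      fun w hw => congrFun (hS.parAlpha_surf hw.1 r) ν
  · refine hS.casimirAt_surf (k := r) hr hz
      (contDiffAt_vdot (smV_invAlpha _) (smV_invAlpha _)) fun w hw => ?_
    rw [invAlpha_surf, vdot_smul_left, vdot_smul_right,
      (hS.vdot_frame hw.1 0 (zTheta w)).2.2.2.2.1, mul_one, Real.mul_self_sqrt hr.le]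

end Data.Admissible
end GuidingCenter

/-! ### Independence of the adapted tetrad -/

namespace GuidingCenter
namespace Data.Admissible

variable {S : Data} {O : Set Vec} {e' : Fin 4 → Vec → Vec} {x : Vec}

/-- Two adapted tetrads differ by a rotation in the perpendicular two-flat. -/
theorem tetrad_rotation (hS : S.Admissible O) (hS' : Admissible { S with e := e' } O)
    (hx : x ∈ O) :
    e' 2 x = vdot (e' 2 x) (S.e 2 x) • S.e 2 x + vdot (e' 2 x) (S.e 3 x) • S.e 3 x ∧
    e' 3 x = -vdot (e' 2 x) (S.e 3 x) • S.e 2 x + vdot (e' 2 x) (S.e 2 x) • S.e 3 x ∧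
    vdot (e' 2 x) (S.e 2 x) ^ 2 + vdot (e' 2 x) (S.e 3 x) ^ 2 = 1 := by
  have hl := (hS.lamB_pos _ hx).ne'
  have o22 : vdot (e' 2 x) (e' 2 x) = 1 := by
    have := hS'.orthonormal x hx 2 2
    simpa [eta] using this
  have o23 : vdot (e' 3 x) (e' 2 x) = 0 := by
    have := hS'.orthonormal x hx 3 2
    simpa [eta] using this
  -- P_⊥ is built from F₀ alone, so it can be expanded in either tetrad: in the primed one it fixes
  -- ê₂', in the other it yields the components of ê₂'.
  have h1 : tvec (S.Pperp x) (e' 2 x) = e' 2 x := by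
    have h := hS'.tvec_Pperp hx 0 (e' 2 x)
    simp only [chat, ahat, Real.sin_zero, Real.cos_zero, zero_smul, neg_zero, one_smul, zero_sub,
      sub_zero] at h
    refine h.trans ?_
    rw [o22, show vdot (-e' 3 x) (e' 2 x) = 0 by
      rw [← neg_one_smul ℝ, vdot_smul_left, o23, mul_zero]]
    simp
  have h2 := hS.tvec_Pperp hx 0 (e' 2 x)
  simp only [chat, ahat, Real.sin_zero, Real.cos_zero, zero_smul, neg_zero, one_smul, zero_sub,
    sub_zero] at h2
  rw [h1, ← neg_one_smul ℝ (S.e 3 x), vdot_smul_left, vdot_comm, vdot_comm (S.e 2 x),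
    smul_smul] at h2
  have h3 : e' 2 x = vdot (e' 2 x) (S.e 2 x) • S.e 2 x + vdot (e' 2 x) (S.e 3 x) • S.e 3 x := by
    rw [add_comm]
    convert h2 using 3
    ring
  refine ⟨h3, ?_, ?_⟩
  -- F₀ maps ê₂' to a nonzero multiple of ê₃', which fixes the orientation and excludes a
  -- reflection.
  · have h4 : tvec (S.F0 x) (e' 2 x) = -S.lamB x • e' 3 x := hS'.F_e2 x hx
    have h5 : tvec (S.F0 x) (e' 2 x)
        = -S.lamB x • (-vdot (e' 2 x) (S.e 3 x) • S.e 2 x + vdot (e' 2 x) (S.e 2 x) • S.e 3 x) := by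
      conv_lhs => rw [h3]
      rw [show ∀ u v : Vec, tvec (S.F0 x) (u + v) = tvec (S.F0 x) u + tvec (S.F0 x) v from
        fun u v => by simp [tvec, Matrix.mulVec_add], tvec_smul, tvec_smul, hS.F_e2 x hx,
        hS.F_e3 x hx]
      ext i
      simp
      ring
    exact smul_right_injective _ (neg_ne_zero.2 hl) (h4.symm.trans h5)
  · have h6 : vdot (e' 2 x) (e' 2 x) = vdot (e' 2 x) (S.e 2 x) ^ 2
        + vdot (e' 2 x) (S.e 3 x) ^ 2 := by
      conv_lhs => enter [2]; rw [h3]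
      rw [vdot_add_right, vdot_smul_right, vdot_smul_right]
      ring
    rw [← h6, o22]

/-- With c and s the cosine and sine of the rotation, the added term c ds − s dc is the differential
of the angle, written so that no branch of the angle has to be chosen. -/
theorem Rcov_rotation (hS : S.Admissible O) (hS' : Admissible { S with e := e' } O)
    (hx : x ∈ O) (σ : Fin 4) :
    Rcov { S with e := e' } x σ = S.Rcov x σ
      + (vdot (e' 2 x) (S.e 2 x) * pd (fun y => vdot (e' 2 y) (S.e 3 y)) σ x
        - vdot (e' 2 x) (S.e 3 x) * pd (fun y => vdot (e' 2 y) (S.e 2 y)) σ x) := by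
  have s2 := hS.smV_e hx 2
  have s3 := hS.smV_e hx 3
  have s2' : SmV (e' 2) x := hS'.smV_e hx 2
  have dc := (contDiffAt_vdot s2' s2).diff
  have ds := (contDiffAt_vdot s2' s3).diff
  have n2 : vdot (S.e 2 x) (S.e 2 x) = 1 := by
    rw [hS.orthonormal x hx]; simp [eta]
  have n3 : vdot (S.e 3 x) (S.e 3 x) = 1 := by
    rw [hS.orthonormal x hx]; simp [eta]
  have n23 : vdot (S.e 2 x) (S.e 3 x) = 0 := by
    rw [hS.orthonormal x hx]; simp [eta]
  have o22 := hS.vdot_jac hx s2 s2 (k := 1) (fun y hy => by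
    rw [hS.orthonormal y hy]; simp [eta]) σ
  have o33 := hS.vdot_jac hx s3 s3 (k := 1) (fun y hy => by
    rw [hS.orthonormal y hy]; simp [eta]) σ
  have o23 := hS.vdot_jac hx s2 s3 (k := 0) (fun y hy => by
    rw [hS.orthonormal y hy]; simp [eta]) σ
  rw [vdot_comm (S.e 2 x) (jac _ x σ)] at o22 o23
  rw [vdot_comm (S.e 3 x) (jac _ x σ)] at o33
  obtain ⟨-, h3, h1⟩ := hS.tetrad_rotation hS' hx
  have hj : jac (e' 2) x σ = (pd (fun y => vdot (e' 2 y) (S.e 2 y)) σ x • S.e 2 x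
      + vdot (e' 2 x) (S.e 2 x) • jac (S.e 2) x σ)
      + (pd (fun y => vdot (e' 2 y) (S.e 3 y)) σ x • S.e 3 x
      + vdot (e' 2 x) (S.e 3 x) • jac (S.e 3) x σ) := by
    ext ν
    rw [jac, Matrix.of_apply, pd_congr (g := fun y => vdot (e' 2 y) (S.e 2 y) * S.e 2 y ν
      + vdot (e' 2 y) (S.e 3 y) * S.e 3 y ν) (by
      filter_upwards [hS.isOpen.mem_nhds hx] with y hy
      exact congrFun (hS.tetrad_rotation hS' hy).1 ν),
      pd_add (dc.fun_mul (s2 ν).diff) (ds.fun_mul (s3 ν).diff), pd_mul dc (s2 ν).diff,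
      pd_mul ds (s3 ν).diff]
    rfl
  change vdot (jac (e' 2) x σ) (e' 3 x) = vdot (jac (S.e 2) x σ) (S.e 3 x) + _
  rw [h3, hj]
  set c := vdot (e' 2 x) (S.e 2 x)
  set s := vdot (e' 2 x) (S.e 3 x)
  simp only [vdot_add_left, vdot_add_right, vdot_smul_left, vdot_smul_right]
  rw [vdot_comm (S.e 3 x) (S.e 2 x), n2, n3, n23]
  linear_combination vdot (jac (S.e 2) x σ) (S.e 3 x) * h1 - s ^ 2 * o23 - c * s / 2 * o22
    + c * s / 2 * o33

/-- The exterior derivative of c ds − s dc is 2 dc∧ds. On c² + s² = 1 one has c dc + s ds = 0, so dc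
and ds are proportional and the product is zero. -/
theorem Ncurv_eq_of_tetrad (hS : S.Admissible O) (hS' : Admissible { S with e := e' } O)
    (hx : x ∈ O) : Ncurv { S with e := e' } x = S.Ncurv x := by
  have s2' : ∀ y ∈ O, SmV (e' 2) y := fun y hy => hS'.smV_e hy 2
  set c := fun y => vdot (e' 2 y) (S.e 2 y) with hc
  set s := fun y => vdot (e' 2 y) (S.e 3 y) with hs
  have cc : ContDiffAt ℝ ∞ c x := contDiffAt_vdot (s2' x hx) (hS.smV_e hx 2)
  have cs : ContDiffAt ℝ ∞ s x := contDiffAt_vdot (s2' x hx) (hS.smV_e hx 3)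
  have hnear := hS.isOpen.mem_nhds hx
  have hunit : ∀ σ, c x * pd c σ x + s x * pd s σ x = 0 := by
    intro σ
    have h := pd_add (cc.diff.fun_mul cc.diff) (cs.diff.fun_mul cs.diff) (i := σ)
    rw [pd_congr (g := fun _ => 1) (by
      filter_upwards [hnear] with y hy
      have := (hS.tetrad_rotation hS' hy).2.2
      rw [sq, sq] at this
      exact this), pd_const, pd_mul cc.diff cc.diff, pd_mul cs.diff cs.diff] at h
    linarith
  have hpd : ∀ σ τ, pd (fun y => Rcov { S with e := e' } y τ) σ x
      = pd (fun y => S.Rcov y τ) σ x + ((pd c σ x * pd s τ x + c x * pd (pd s τ) σ x)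
        - (pd s σ x * pd c τ x + s x * pd (pd c τ) σ x)) := by
    intro σ τ
    have dps : DifferentiableAt ℝ (pd s τ) x := (contDiffAt_pd cs τ).diff
    have dpc : DifferentiableAt ℝ (pd c τ) x := (contDiffAt_pd cc τ).diff
    rw [pd_congr (g := fun y => S.Rcov y τ + (c y * pd s τ y - s y * pd c τ y)) (by
      filter_upwards [hnear] with y hy
      exact hS.Rcov_rotation hS' hy τ),
      pd_add (hS.smV_Rcov hx τ).diff ((cc.diff.fun_mul dps).fun_sub (cs.diff.fun_mul dpc)),
      pd_sub (cc.diff.fun_mul dps) (cs.diff.fun_mul dpc), pd_mul cc.diff dps, pd_mul cs.diff dpc]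
  rw [Ncurv, Ncurv]
  congr 1
  ext σ τ
  simp only [extD, Matrix.of_apply]
  rw [hpd, hpd, pd_pd_comm cc σ τ, pd_pd_comm cs σ τ]
  have h1 : c x ^ 2 + s x ^ 2 = 1 := (hS.tetrad_rotation hS' hx).2.2
  have hσ := hunit σ
  have hτ := hunit τ
  -- Multiplying dc∧ds by c² + s² = 1 brings out the factors c dc + s ds, which vanish.
  linear_combination
    (-2 * (pd c σ x * pd s τ x - pd c τ x * pd s σ x)) * h1
    + 2 * (c x * pd s τ x - s x * pd c τ x) * hσ - 2 * (c x * pd s σ x - s x * pd c σ x) * hτ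

/-- At the higher order 𝓝 is the only ingredient that contains the tetrad; everything else is built
from the potentials and coincides definitionally. -/
theorem invTensor_eq_of_tetrad (hS : S.Admissible O) (hS' : Admissible { S with e := e' } O)
    {Z : InvIdx → ℝ} (hZ : invR Z ∈ O) :
    invTensor { S with e := e' } .higher Z = S.invTensor .higher Z := by
  have hF : Fppp { S with e := e' } .higher Z = S.Fppp .higher Z := by
    simp only [Fppp, Fp, hS.Ncurv_eq_of_tetrad hS' hZ]
    rfl
  have hY : Upsp { S with e := e' } .higher Z = S.Upsp .higher Z := by
    simp only [Upsp, hF]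
    rfl
  have hX : Xip { S with e := e' } .higher Z = S.Xip .higher Z := by
    simp only [Xip, hF, hY]
    rfl
  have hRR : invRR { S with e := e' } .higher Z = S.invRR .higher Z := by
    simp only [invRR, hY]
    rfl
  have hRU : invRU { S with e := e' } .higher Z = S.invRU .higher Z := by
    simp only [invRU, hF, hY]
    rfl
  have hUU : invUU { S with e := e' } .higher Z = S.invUU .higher Z := by
    simp only [invUU, hF, hX, hY]
    rfl
  have hAA : invAlphaAlpha { S with e := e' } .higher Z = S.invAlphaAlpha .higher Z := by
    simp only [invAlphaAlpha, hY]
    rfl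
  simp only [invTensor, invRAlpha, invUAlpha, hRR, hRU, hUU, hAA]
  rfl

end Data.Admissible
end GuidingCenter

/-! ### Assembly of the theorem -/

theorem mainTheorem2 (S : GuidingCenter.Data) (O : Set GuidingCenter.Vec) (hS : S.Admissible O)
    (ord : GuidingCenter.GCOrder) :
    -- the Lagrangian two-form is exactly closed
    (∀ z : GuidingCenter.GCIdx → ℝ, GuidingCenter.zR z ∈ O → ∀ i j k : GuidingCenter.GCIdx,
      GuidingCenter.pd (fun y => S.omega ord y j k) i z
        + GuidingCenter.pd (fun y => S.omega ord y k i) j z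
        + GuidingCenter.pd (fun y => S.omega ord y i j) k z = 0) ∧
    -- it is invertible, and its inverse is the explicit table of brackets
    (∀ z ∈ S.domain ord O,
      IsUnit (S.omega ord z).det ∧ S.poisson ord z = S.gcTensor ord z) ∧
    -- these brackets are antisymmetric and satisfy the Jacobi identity exactly
    GuidingCenter.IsPoissonOn (S.poisson ord) (S.domain ord O) ∧
    -- so do the brackets of the extended phase space
    GuidingCenter.IsPoissonOn (S.extPoisson ord) (S.extDomain ord O) ∧
    -- the change to the gauge-invariant coordinates is a local diffeomorphism, and it sends the five
    -- appended coordinates to the constraint functions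
    (∀ y ∈ S.extDomain ord O,
      (∀ v : GuidingCenter.ExtIdx → ℝ, (S.jacInv y).mulVec v = 0 → v = 0) ∧
      ∀ k : Fin 5, S.constraint k (S.toInv y) = y (.inr k)) ∧
    -- the transformed Poisson structure in the gauge-invariant coordinates
    (∃ P : (GuidingCenter.InvIdx → ℝ) →
        Matrix GuidingCenter.InvIdx GuidingCenter.InvIdx ℝ,
      (∀ y ∈ S.extDomain ord O,
        P (S.toInv y) = S.jacInv y * S.extPoisson ord y * (S.jacInv y).transpose) ∧
      GuidingCenter.IsPoissonOn P (S.invDomain ord O) ∧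
      (∀ k : Fin 5, ∀ Z ∈ S.invDomain ord O,
        GuidingCenter.CasimirAt P (S.invDomain ord O) (S.constraint k) Z) ∧
      -- on the hypersurface it is the explicit manifestly invariant table of brackets
      (∀ Z ∈ S.constraintSurface ord O, P Z = S.invTensor ord Z) ∧
      -- `P_⊥ · U`, `P_∥ · α̂` and `α̂ · α̂` are Casimir functions there
      (∀ Z ∈ S.constraintSurface ord O,
        (∀ ν : Fin 4, GuidingCenter.CasimirAt P (S.invDomain ord O) (fun W => S.perpU W ν) Z) ∧
        (∀ ν : Fin 4, GuidingCenter.CasimirAt P (S.invDomain ord O) (fun W => S.parAlpha W ν) Z) ∧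
        GuidingCenter.CasimirAt P (S.invDomain ord O)
          (fun W => GuidingCenter.vdot (GuidingCenter.invAlpha W) (GuidingCenter.invAlpha W)) Z)) ∧
    -- the explicit manifestly invariant brackets themselves satisfy the Jacobi identity exactly
    -- on the hypersurface
    (∀ Z ∈ S.constraintSurface ord O,
      GuidingCenter.JacobiAt (S.invTensor ord) (S.invDomain ord O) Z) ∧
    -- at the higher order they do not depend on the choice of the adapted tetrad
    (∀ e' : Fin 4 → GuidingCenter.Vec → GuidingCenter.Vec,
      GuidingCenter.Data.Admissible { S with e := e' } O →
      ∀ Z : GuidingCenter.InvIdx → ℝ, GuidingCenter.invR Z ∈ O →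
        GuidingCenter.Data.invTensor { S with e := e' } .higher Z = S.invTensor .higher Z) := by
  refine ⟨fun z hz => hS.omega_closed ord hz,
    fun z hz => ⟨hS.isUnit_det_omega ord hz, hS.poisson_eq_gcTensor ord hz⟩,
    hS.isPoissonOn_poisson ord, hS.isPoissonOn_extPoisson ord,
    fun y hy => ⟨fun v hv => ?_, hS.constraint_toInv hy⟩,
    ⟨S.invPoisson ord O, fun y hy => hS.invPoisson_toInv hy, hS.isPoissonOn_invPoisson ord,
      ?_, ?_, fun Z hZ => hS.casimirAt_surface hZ⟩,
    fun Z hZ => hS.jacobiAt_invTensor hZ,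
    fun e' hS' Z hZ => hS.invTensor_eq_of_tetrad hS' hZ⟩
  · rw [S.jacInv_mulVec (hS.contDiffAt_toInv hy).diff] at hv
    exact hS.eq_zero_of_fderiv_toInv hy hv
  · rintro k _ ⟨y, hy, rfl⟩
    exact hS.casimirAt_constraint hy k
  · intro Z hZ
    obtain ⟨r, hr, z, hz, rfl⟩ := hS.exists_surf_eq hZ
    exact hS.invPoisson_eq_invTensor hr hz
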